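/- **Corollary 5.2 (Reconstruction of the $Q$-operator).** Let $N\ge 0$, let $2s_1,\dots,2s_N$ be positive integers, $N_s=\sum_n 2s_n$, and let $\eta\in\mathbb C\setminus\{0\}$. For $\xi=(\xi_1,\dots,\xi_N)\in\mathbb C^N$ and $K\in\mathrm{End}(\mathbb C^2)$ consider on $\mathcal H=\bigotimes_{n=1}^N\mathbb C^{2s_n+1}$ the monodromy matrix $$M^{(K)}_0(\lambda)=\begin{pmatrix}\mathsf A(\lambda)&\mathsf B(\lambda)\\ \mathsf C(\lambda)&\mathsf D(\lambda)\end{pmatrix}=K_0\,L_{0N}(\lambda-\xi_N)\cdots L_{01}(\lambda-\xi_1),\qquad L_{0n}(\lambda)=\begin{pmatrix}\lambda+\eta(\tfrac12+S^z_n)&\eta S^-_n\\ \eta S^+_n&\lambda+\eta(\tfrac12-S^z_n)\end{pmatrix},$$ where $S^z_n,S^\pm_n$ act on the $n$-th factor by the spin-$s_n$ representation $S^z=\mathrm{diag}(s_n,s_n-1,\dots,-s_n)$, $(S^+)_{j,j+1}=\sqrt{j(2s_n+1-j)}$ for $1\le j\le 2s_n$ (all other entries of $S^+$ being $0$), $S^-=(S^+)^t$.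 Put - $T^{(K)}(\lambda)=\mathrm{tr}_0M^{(K)}_0(\lambda)$ and $\det_qM^{(K)}(\lambda)=\mathsf A(\lambda)\mathsf D(\lambda-\eta)-\mathsf B(\lambda)\mathsf C(\lambda-\eta)$; - $T^{(K|l)}(\lambda)=\mathrm{tr}\big[P^+_{1\ldots l}M^{(K)}_1(\lambda+(l-1)\eta)\cdots M^{(K)}_l(\lambda)P^+_{1\ldots l}\big]$, where $P^+_{1\ldots l}$ is the projector of $(\mathbb C^2)^{\otimes l}$ on its symmetric part and the trace is over the auxiliary spaces ($T^{(K|0)}=1$); - $\xi_n^{(k)}=\xi_n-\tfrac\eta2+(s_n-k)\eta$, $\;a(\lambda)=\prod_n(\lambda-\xi_n+\tfrac\eta2+s_n\eta)$, $\;d(\lambda)=\prod_n(\lambda-\xi_n+\tfrac\eta2-s_n\eta)$. Let $\mathsf k_1\ne\mathsf k_2$ be nonzero and let $K$ have the eigenvalues $\mathsf k_1,\mathsf k_2$. Put $\beta(\lambda)=\mathsf k_1a(\lambda)$, $\alpha(\lambda)=\beta(\lambda)\beta(\lambda-\eta)$ and, for $1\le a\le N$ and $0\le h\le 2s_a$,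 $$\mathsf Q_a^{(h)}=\frac{T^{(K|2s_a-h)}(\xi_a^{(2s_a)})}{\mathsf k_2^{2s_a-h}\prod_{k=0}^{2s_a-h-1}d(\xi_a^{(2s_a-k)})}.$$ For $\zeta\in\mathbb C$ define $N\times N$ matrices of operators by $$[C_\zeta]_{ab}=-\delta_{ab}\mathsf Q_a^{(0)}+\sum_{h=1}^{2s_b}\frac{\xi_a^{(0)}-\zeta}{\xi_b^{(h)}-\zeta}\prod_{(c,k)\ne(b,h)}\frac{\xi_a^{(0)}-\xi_c^{(k)}}{\xi_b^{(h)}-\xi_c^{(k)}}\;\mathsf Q_b^{(h)},$$ $$[\Delta_\zeta(\lambda)]_{ab}=\sum_{h=1}^{2s_b}\frac{\lambda-\zeta}{\xi_b^{(h)}-\lambda}\;\frac{\prod_{(c,k)}(\xi_a^{(0)}-\xi_c^{(k)})}{(\xi_b^{(h)}-\zeta)\prod_{(c,k)\ne(b,h)}(\xi_b^{(h)}-\xi_c^{(k)})}\;\mathsf Q_b^{(h)},$$ where $(c,k)$ runs over the pairs with $1\le c\le N$, $1\le k\le 2s_c$. Fix either a constant $\zeta\in\mathbb C$ or an index $c$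 and the choice $\zeta=\xi_c^{(0)}$. Then for almost all values of $\xi_1,\dots,\xi_N,\mathsf k_1,\mathsf k_2$ (namely, off the zero set of a nonzero polynomial in these $N+2$ variables, depending only on $N$, $(s_n)_n$, $\eta$ and the choice of $\zeta$), and for every $K$ with distinct nonzero eigenvalues $\mathsf k_1,\mathsf k_2$: no denominator above vanishes, $\zeta\neq\xi_b^{(k)}$ for all $b$ and $1\le k\le 2s_b$, the entries of $C_\zeta$ and of all $\Delta_\zeta(\lambda)$ commute with each other, the operator $\det_NC_\zeta$ is invertible, and $$\mathsf Q(\lambda)=\frac{\det_N[C_\zeta+\Delta_\zeta(\lambda)]}{\det_N[C_\zeta]}\prod_{b=1}^N\prod_{k=1}^{2s_b}\frac{\lambda-\xi_b^{(k)}}{\zeta-\xi_b^{(k)}}\qquad\big(\lambda\notin\{\xi_b^{(k)}:1\le k\le 2s_b\}\big)$$ extends to a polynomial in $\lambda$ of degree at most $N_s$ with operator coefficients. These operators satisfy $[\mathsf Q(\lambda),\mathsf Q(\mu)]=0$ and $[\mathsf Q(\lambda),T^{(K)}(\mu)]=0$ for all $\lambda,\mu\in\mathbb C$, the equation $$\alpha(\lambda)\mathsf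 Q(\lambda-2\eta)-\beta(\lambda)T^{(K)}(\lambda-\eta)\mathsf Q(\lambda-\eta)+\det_qM^{(K)}(\lambda)\,\mathsf Q(\lambda)=0$$ holds for all $\lambda\in\mathbb C$, and $\mathsf Q(\xi_a^{(2s_a)})$ is invertible for every $a\in\{1,\dots,N\}$. -/

import Mathlib

open Polynomial

noncomputable section

namespace HigherSpinChain

/-- The operator which acts as `X` on the `n`-th factor of the tensor product of the coordinate
spaces indexed by `κ i`, and as the identity on all other factors. The canonical basis of the
tensor product is indexed by the functions `f : ∀ i, κ i`. -/
def embed {ι : Type*} [Fintype ι] [DecidableEq ι] {κ : ι → Type*} [∀ i, DecidableEq (κ i)]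
    {R : Type*} [Zero R] (n : ι) (X : Matrix (κ n) (κ n) R) :
    Matrix (∀ i, κ i) (∀ i, κ i) R :=
  Matrix.of fun f g => if ∀ r, r ≠ n → f r = g r then X (f n) (g n) else 0

/-- Labels of the canonical basis of the quantum space `⨂ₙ ℂ^(2sₙ+1)`, where `m n = 2sₙ`. -/
abbrev Conf {N : ℕ} (m : Fin N → ℕ) : Type := ∀ n, Fin (m n + 1)

/-- Operators on the quantum space. -/
abbrev Op {N : ℕ} (m : Fin N → ℕ) : Type := Matrix (Conf m) (Conf m) ℂ

/-! Spin-`M/2` representation of `sl(2)` on `ℂ^(M+1)`. -/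

/-- `S^z = diag(s, s-1, …, -s)` with `s = M/2`. -/
def Sz (M : ℕ) : Matrix (Fin (M + 1)) (Fin (M + 1)) ℂ :=
  Matrix.diagonal fun j => (M : ℂ) / 2 - ((j : ℕ) : ℂ)

/-- `S^+`, whose only nonzero entries are `x(j) = √(j(2s+1-j))`, `1 ≤ j ≤ 2s = M`, at the
(one-based) places `(j, j+1)`. -/
def Sp (M : ℕ) : Matrix (Fin (M + 1)) (Fin (M + 1)) ℂ :=
  Matrix.of fun i j =>
    if (i : ℕ) + 1 = (j : ℕ) then
      ((Real.sqrt (((j : ℕ) : ℝ) * ((M : ℝ) + 1 - ((j : ℕ) : ℝ))) : ℝ) : ℂ)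
    else 0

/-- `S^-`, the transpose of `S^+`. -/
def Sm (M : ℕ) : Matrix (Fin (M + 1)) (Fin (M + 1)) ℂ := (Sp M).transpose

/-- The Lax operator, as a `2 × 2` matrix of operators on the local space `ℂ^(M+1)`. -/
def lax (η : ℂ) (M : ℕ) (x : ℂ) :
    Matrix (Fin 2) (Fin 2) (Matrix (Fin (M + 1)) (Fin (M + 1)) ℂ) :=
  !![x • (1 : Matrix (Fin (M + 1)) (Fin (M + 1)) ℂ)
        + η • ((1 / 2 : ℂ) • (1 : Matrix (Fin (M + 1)) (Fin (M + 1)) ℂ) + Sz M),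
      η • Sm M;
    η • Sp M,
      x • (1 : Matrix (Fin (M + 1)) (Fin (M + 1)) ℂ)
        + η • ((1 / 2 : ℂ) • (1 : Matrix (Fin (M + 1)) (Fin (M + 1)) ℂ) - Sz M)]

variable {N : ℕ}

/-- The monodromy matrix `K₀ L_{0N}(x - ξ_N) ⋯ L_{01}(x - ξ_1)`, as a `2 × 2` matrix of operators
on the quantum space. -/
def monodromy (η : ℂ) (m : Fin N → ℕ) (ξ : Fin N → ℂ) (K : Matrix (Fin 2) (Fin 2) ℂ) (x : ℂ) :
    Matrix (Fin 2) (Fin 2) (Op m) :=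
  K.map (algebraMap ℂ (Op m)) *
    (List.ofFn fun n : Fin N =>
      (lax η (m n) (x - ξ n)).map fun X => (embed n X : Op m)).reverse.prod

/-- The transfer matrix `T^{(K)}(x)`. -/
def transfer (η : ℂ) (m : Fin N → ℕ) (ξ : Fin N → ℂ) (K : Matrix (Fin 2) (Fin 2) ℂ) (x : ℂ) :
    Op m :=
  (monodromy η m ξ K x).trace

/-- The quantum determinant `A(x) D(x-η) - B(x) C(x-η)`. -/
def qdet (η : ℂ) (m : Fin N → ℕ) (ξ : Fin N → ℂ) (K : Matrix (Fin 2) (Fin 2) ℂ) (x : ℂ) :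
    Op m :=
  monodromy η m ξ K x 0 0 * monodromy η m ξ K (x - η) 1 1
    - monodromy η m ξ K x 0 1 * monodromy η m ξ K (x - η) 1 0

/-- The projector `P⁺` of `(ℂ²)^{⊗l}` on its symmetric part: the average over the permutations `π`
of the operators `v₁ ⊗ ⋯ ⊗ v_l ↦ v_{π 1} ⊗ ⋯ ⊗ v_{π l}`. -/
def symProj (l : ℕ) : Matrix (Fin l → Fin 2) (Fin l → Fin 2) ℂ :=
  ((Nat.factorial l : ℂ))⁻¹ •
    ∑ π : Equiv.Perm (Fin l), Matrix.of fun i j => if i = j ∘ π then (1 : ℂ) else 0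

/-- The fused monodromy matrix `P⁺ M_1(x + (l-1)η) ⋯ M_{l-1}(x + η) M_l(x) P⁺`. -/
def fusedMonodromy (η : ℂ) (m : Fin N → ℕ) (ξ : Fin N → ℂ) (K : Matrix (Fin 2) (Fin 2) ℂ)
    (l : ℕ) (x : ℂ) : Matrix (Fin l → Fin 2) (Fin l → Fin 2) (Op m) :=
  (symProj l).map (algebraMap ℂ (Op m)) *
    (List.ofFn fun r : Fin l =>
      (embed r (monodromy η m ξ K (x + ((l : ℂ) - 1 - ((r : ℕ) : ℂ)) * η)) :
        Matrix (Fin l → Fin 2) (Fin l → Fin 2) (Op m))).prod *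
    (symProj l).map (algebraMap ℂ (Op m))

/-- The fused transfer matrix `T^{(K|l)}(x)`. The fused monodromy matrix maps into the symmetric
part and vanishes on the kernel of `P⁺`, so its trace over the symmetric part is its trace over
`(ℂ²)^{⊗l}`. For `l = 0` this is the identity. -/
def fusedTransfer (η : ℂ) (m : Fin N → ℕ) (ξ : Fin N → ℂ) (K : Matrix (Fin 2) (Fin 2) ℂ)
    (l : ℕ) (x : ℂ) : Op m :=
  (fusedMonodromy η m ξ K l x).trace

/-- `a(x) = ∏ₙ (x - ξₙ + η/2 + sₙ η)`. -/
def aFun (η : ℂ) (m : Fin N → ℕ) (ξ : Fin N → ℂ) (x : ℂ) : ℂ :=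
  ∏ n, (x - (ξ n - η / 2) + (m n : ℂ) / 2 * η)

/-- `d(x) = ∏ₙ (x - ξₙ + η/2 - sₙ η)`. -/
def dFun (η : ℂ) (m : Fin N → ℕ) (ξ : Fin N → ℂ) (x : ℂ) : ℂ :=
  ∏ n, (x - (ξ n - η / 2) - (m n : ℂ) / 2 * η)

/-- `ξₙ^{(k)} = ξₙ - η/2 + (sₙ - k) η`. -/
def pt (η : ℂ) (m : Fin N → ℕ) (ξ : Fin N → ℂ) (n : Fin N) (k : ℕ) : ℂ :=
  ξ n - η / 2 + ((m n : ℂ) / 2 - (k : ℂ)) * η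

/-- The points `ξ_b^{(k)}`, `1 ≤ b ≤ N`, `1 ≤ k ≤ 2s_b`; the pair `⟨b, j⟩` stands for
`(b, k)` with `k = j + 1`. -/
def node (η : ℂ) (m : Fin N → ℕ) (ξ : Fin N → ℂ) (p : Σ b : Fin N, Fin (m b)) : ℂ :=
  pt η m ξ p.1 ((p.2 : ℕ) + 1)

/-- `Q_a^{(h)} = T^{(K|2s_a-h)}(ξ_a^{(2s_a)}) / (k₂^{2s_a-h} ∏_{k=0}^{2s_a-h-1} d(ξ_a^{(2s_a-k)}))`,
used for `0 ≤ h ≤ 2s_a`. -/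
def Qcoef (η : ℂ) (m : Fin N → ℕ) (ξ : Fin N → ℂ) (K : Matrix (Fin 2) (Fin 2) ℂ) (k₂ : ℂ)
    (a : Fin N) (h : ℕ) : Op m :=
  (k₂ ^ (m a - h) * ∏ k ∈ Finset.range (m a - h), dFun η m ξ (pt η m ξ a (m a - k)))⁻¹ •
    fusedTransfer η m ξ K (m a - h) (pt η m ξ a (m a))

/-- The matrix `C_ζ`, with operator entries. -/
def Cmat (η : ℂ) (m : Fin N → ℕ) (ξ : Fin N → ℂ) (K : Matrix (Fin 2) (Fin 2) ℂ) (k₂ ζ : ℂ) :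
    Matrix (Fin N) (Fin N) (Op m) :=
  Matrix.of fun a b =>
    -(if a = b then Qcoef η m ξ K k₂ a 0 else 0) +
      ∑ h : Fin (m b),
        ((pt η m ξ a 0 - ζ) / (node η m ξ ⟨b, h⟩ - ζ) *
          ∏ p ∈ Finset.univ.erase (⟨b, h⟩ : Σ b : Fin N, Fin (m b)),
            (pt η m ξ a 0 - node η m ξ p) / (node η m ξ ⟨b, h⟩ - node η m ξ p)) •
          Qcoef η m ξ K k₂ b ((h : ℕ) + 1)

/-- The matrix `Δ_ζ(x)`, with operator entries. -/
def Deltamat (η : ℂ) (m : Fin N → ℕ) (ξ : Fin N → ℂ) (K : Matrix (Fin 2) (Fin 2) ℂ) (k₂ ζ : ℂ)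
    (x : ℂ) : Matrix (Fin N) (Fin N) (Op m) :=
  Matrix.of fun a b =>
    ∑ h : Fin (m b),
      ((x - ζ) / (node η m ξ ⟨b, h⟩ - x) *
        ((∏ p, (pt η m ξ a 0 - node η m ξ p)) /
          ((node η m ξ ⟨b, h⟩ - ζ) *
            ∏ p ∈ Finset.univ.erase (⟨b, h⟩ : Σ b : Fin N, Fin (m b)),
              (node η m ξ ⟨b, h⟩ - node η m ξ p)))) •
        Qcoef η m ξ K k₂ b ((h : ℕ) + 1)

/-- The determinant of a matrix with pairwise commuting entries in a ring, by Leibniz' formula. -/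
def opDet {R : Type*} [Ring R] (A : Matrix (Fin N) (Fin N) R) : R :=
  ∑ σ : Equiv.Perm (Fin N),
    (((Equiv.Perm.sign σ : ℤˣ) : ℤ) : R) * (List.ofFn fun i => A (σ i) i).prod

theorem opDet_eq_det {R : Type*} [CommRing R] (A : Matrix (Fin N) (Fin N) R) :
    opDet A = A.det := by
  simp [opDet, Matrix.det_apply', List.prod_ofFn]

/-- The value at `x` of a matrix of polynomials, that is, of a polynomial with operator
coefficients. -/
def evalAt {m : Fin N → ℕ} (Q : Matrix (Conf m) (Conf m) ℂ[X]) (x : ℂ) : Op m :=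
  Q.map (Polynomial.eval x)

/-- `β(x) = k₁ a(x)`. -/
def betaFun (η : ℂ) (m : Fin N → ℕ) (ξ : Fin N → ℂ) (k₁ : ℂ) (x : ℂ) : ℂ :=
  k₁ * aFun η m ξ x

/-- `α(x) = β(x) β(x - η)`. -/
def alphaFun (η : ℂ) (m : Fin N → ℕ) (ξ : Fin N → ℂ) (k₁ : ℂ) (x : ℂ) : ℂ :=
  betaFun η m ξ k₁ x * betaFun η m ξ k₁ (x - η)

end HigherSpinChain

end

open HigherSpinChain

/-! Everything rests on the first-order form of the equation, T(x) Q(x) = k₁ a(x) Q(x - η) + k₂ d(x)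
Q(x + η), applied to polynomials of degree at most N_s with values in the quantum space. Since the
quantum determinant is the scalar k₁ k₂ a(x) d(x - η), shifting x by η and multiplying by β gives
the stated equation (`Regular.baxter`).

The exchange relation `RTT` makes the transfer matrices commute and yields the fusion recursion
`fusedTransfer_rec`. For a site of spin s_a the fusion hierarchy based at ξ_a^{(2s_a)} stops: the
fused transfer matrix of order 2s_a + 1 vanishes (`fusedTransfer_eq_zero`). After normalisation, the
recursion says exactly that the operators Q_a^{(h)} satisfy the equation at the N_s + N points
ξ_a^{(h)}, 0 ≤ h ≤ 2s_a (`transfer_mul_Qcoef`). Suppose that a polynomial V of degree at most N_s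
has the values Q_a^{(h)} w_a at all these points. The two sides for V then differ by a polynomial of
degree less than N_s + N, the top terms cancelling because tr K = k₁ + k₂; it vanishes at N_s + N
points, so V is a solution (`tqDefect_eq_zero`).

Such a V is determined by its value v at ζ and its values at the N_s nodes with h ≥ 1. The remaining
N conditions, at the points ξ_a^{(0)}, form a linear system for w whose matrix is C_ζ and whose
right-hand side is proportional to v. If no nonzero solution vanishes at ζ, then v = 0 forces w = 0,
because Q_a^{(2s_a)} = 1, and C_ζ is invertible. Solving with v replaced by the identity operator
defines Q. As Δ_ζ(x) has rank one over the commutative algebra of transfer matrices, the matrix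
determinant lemma turns the interpolation formula into the quotient of determinants
(`Regular.reconstruct`). Invertibility of Q(ξ_a^{(2s_a)}) likewise follows if no nonzero solution
vanishes there.

It remains to exclude nonzero solutions vanishing at a given point, for generic parameters. By GL(2)
invariance the twist may be taken diagonal, and the exclusion becomes injectivity of a matrix
polynomial in the parameters; one good parameter point is then enough. At k₁ = 0, k₂ = 1 the
transfer matrix is triangular, and a zero of the top component of a solution propagates along z, z -
η, z - 2η, …, which is impossible for a nonzero polynomial (`noSol_special`). -/

open Polynomial

noncomputable section

namespace HigherSpinChain

/-! ### Operators acting on one factor of a tensor product. -/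

section Embed

variable {ι : Type*} [Fintype ι] [DecidableEq ι] {κ : ι → Type*} [∀ i, DecidableEq (κ i)]
  [∀ i, Fintype (κ i)]

theorem embed_mul_apply {R : Type*} [NonUnitalNonAssocSemiring R] (n : ι) (X : Matrix (κ n) (κ n) R)
    (B : Matrix (∀ i, κ i) (∀ i, κ i) R) (f g : ∀ i, κ i) :
    ((embed n X : Matrix (∀ i, κ i) (∀ i, κ i) R) * B) f g =
      ∑ k, X (f n) k * B (Function.update f n k) g := by
  rw [Matrix.mul_apply]
  symm
  refine Fintype.sum_of_injective (Function.update f n) (Function.update_injective f n) _ _ ?_ ?_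
  · intro h hh
    have : ¬ ∀ r, r ≠ n → f r = h r := by
      intro H
      refine hh ⟨h n, ?_⟩
      funext r
      by_cases hr : r = n
      · subst hr; simp
      · simp [hr, H r hr]
    simp [embed, this]
  · intro k
    have : ∀ r, r ≠ n → f r = Function.update f n k r := fun r hr => by simp [hr]
    simp only [embed, Matrix.of_apply, Function.update_self]
    rw [if_pos this]

/-- Without repeated sites every intermediate configuration is forced, so a single path contributes
to each entry. The factors stay in the order of the list because `R` need not be commutative. -/
theorem prod_embed_apply {R : Type*} [Semiring R] (X : ∀ n, Matrix (κ n) (κ n) R) (L : List ι)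
    (hL : L.Nodup) (f g : ∀ i, κ i) :
    (L.map fun n => (embed n (X n) : Matrix (∀ i, κ i) (∀ i, κ i) R)).prod f g =
      if ∀ r, r ∉ L → f r = g r then (L.map fun n => X n (f n) (g n)).prod else 0 := by
  induction L generalizing f with
  | nil => simp [Matrix.one_apply, funext_iff]
  | cons n L ih =>
    rw [List.nodup_cons] at hL
    rw [List.map_cons, List.prod_cons, embed_mul_apply]
    simp_rw [ih hL.2]
    rw [Finset.sum_eq_single (g n)]
    · have e : (L.map fun r => X r (Function.update f n (g n) r) (g r)) =
          L.map fun r => X r (f r) (g r) := by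
        refine List.map_congr_left fun r hr => ?_
        have : r ≠ n := fun h => hL.1 (h ▸ hr)
        simp [this]
      rw [e]
      have : (∀ r, r ∉ L → Function.update f n (g n) r = g r) ↔ ∀ r, r ∉ n :: L → f r = g r := by
        constructor
        · intro H r hr
          have hr' : r ≠ n ∧ r ∉ L := by simpa using hr
          simpa [hr'.1] using H r hr'.2
        · intro H r hr
          by_cases h : r = n
          · subst h; simp
          · simpa [h] using H r (by simp [h, hr])
      simp only [this, List.map_cons, List.prod_cons, mul_ite, mul_zero]
    · intro k _ hk
      rw [if_neg, mul_zero]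
      intro H
      apply hk
      simpa using H n hL.1
    · simp

theorem embed_mul_embed_comm {R : Type*} [Semiring R] {n n' : ι} (h : n ≠ n')
    (X : Matrix (κ n) (κ n) R) (Y : Matrix (κ n') (κ n') R)
    (hc : ∀ i j k l, Commute (X i j) (Y k l)) :
    Commute (embed n X : Matrix (∀ i, κ i) (∀ i, κ i) R) (embed n' Y) := by
  -- One family contains both operators, so that `prod_embed_apply` computes the product in either
  -- order.
  let Z : ∀ r, Matrix (κ r) (κ r) R := Function.update (Function.update 0 n X) n' Y
  have hX : Z n = X := by simp [Z, h]
  have hY : Z n' = Y := by simp [Z]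
  ext f g
  have h1 := prod_embed_apply Z [n, n'] (by simp [h]) f g
  have h2 := prod_embed_apply Z [n', n] (by simp [h.symm]) f g
  simp only [List.map_cons, List.map_nil, List.prod_cons, List.prod_nil, mul_one, hX, hY] at h1 h2
  rw [h1, h2, (hc _ _ _ _).eq]
  refine if_congr (forall_congr' fun r => ?_) rfl rfl
  simp only [List.mem_cons, List.not_mem_nil, or_false]
  rw [or_comm]

/-- `embed n` as a homomorphism of algebras. -/
def embedHom (n : ι) : Matrix (κ n) (κ n) ℂ →ₐ[ℂ] Matrix (∀ i, κ i) (∀ i, κ i) ℂ :=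
  AlgHom.ofLinearMap
    { toFun := embed n
      map_add' := fun X Y => by
        ext f g; simp only [embed, Matrix.of_apply, Matrix.add_apply]; split_ifs <;> simp
      map_smul' := fun c X => by
        ext f g; simp only [embed, Matrix.of_apply, Matrix.smul_apply]; split_ifs <;> simp }
    (by
      ext f g
      by_cases h : f = g
      · subst h; simp [embed]
      · simp only [LinearMap.coe_mk, AddHom.coe_mk, embed, Matrix.of_apply, Matrix.one_apply, h,
          if_false]
        split_ifs with h1 h2
        · refine absurd (funext fun r => ?_) h
          by_cases hr : r = n
          · subst hr; exact h2
          · exact h1 r hr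
        · rfl
        · rfl)
    (fun X Y => by
      ext f g
      simp only [LinearMap.coe_mk, AddHom.coe_mk, embed_mul_apply]
      simp only [embed, Matrix.of_apply, Function.update_self, Matrix.mul_apply]
      have : ∀ k, (∀ r, r ≠ n → Function.update f n k r = g r) ↔ ∀ r, r ≠ n → f r = g r :=
        fun k => forall₂_congr fun r hr => by simp [hr]
      simp only [this]
      split_ifs <;> simp)

@[simp] theorem embedHom_apply (n : ι) (X : Matrix (κ n) (κ n) ℂ) : embedHom n X = embed n X := rfl

end Embed

/-! ### Spin representations and the entries of the Lax operator. -/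

section Spin

theorem Sp_mul_Sm (M : ℕ) :
    Sp M * Sm M = Matrix.diagonal fun i : Fin (M + 1) => ((i : ℕ) + 1 : ℂ) * ((M : ℂ) - (i : ℕ)) := by
  ext i j
  rw [Matrix.mul_apply]
  by_cases hi : (i : ℕ) < M
  · rw [Finset.sum_eq_single (⟨i + 1, by omega⟩ : Fin (M + 1))]
    · by_cases hij : i = j
      · subst hij
        have h0 : (0:ℝ) ≤ (((i : ℕ) + 1 : ℕ) : ℝ) * ((M : ℝ) + 1 - (((i : ℕ) + 1 : ℕ) : ℝ)) := by
          have : ((i : ℕ) : ℝ) < M := by exact_mod_cast hi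
          push_cast
          apply mul_nonneg <;> linarith [Nat.cast_nonneg (α := ℝ) (i : ℕ)]
        simp only [Sp, Sm, Matrix.transpose_apply, Matrix.of_apply, if_true,
          Matrix.diagonal_apply_eq]
        rw [← Complex.ofReal_mul, Real.mul_self_sqrt h0]
        push_cast; ring
      · have : ¬ ((j : ℕ) = i) := fun h => hij (Fin.ext h.symm)
        simp [Sp, Sm, hij, this]
    · intro k _ hk
      have : ¬ ((i : ℕ) + 1 = k) := fun h => hk (Fin.ext (by simp [h]))
      simp [Sp, this]
    · simp
  · have hi' : (i : ℕ) = M := by omega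
    rw [Finset.sum_eq_zero]
    · by_cases hij : i = j
      · subst hij; simp [hi']
      · simp [hij]
    · intro k _
      have : ¬ ((i : ℕ) + 1 = k) := by omega
      simp [Sp, this]

theorem Sm_mul_Sp (M : ℕ) :
    Sm M * Sp M = Matrix.diagonal fun i : Fin (M + 1) => ((i : ℕ) : ℂ) * ((M : ℂ) + 1 - (i : ℕ)) := by
  ext i j
  rw [Matrix.mul_apply]
  by_cases hi : 0 < (i : ℕ)
  · rw [Finset.sum_eq_single (⟨i - 1, by omega⟩ : Fin (M + 1))]
    · have h1 : (i : ℕ) - 1 + 1 = i := by omega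
      by_cases hij : i = j
      · subst hij
        have h0 : (0:ℝ) ≤ ((i : ℕ) : ℝ) * ((M : ℝ) + 1 - ((i : ℕ) : ℝ)) := by
          have : ((i : ℕ) : ℝ) < M + 1 := by exact_mod_cast i.2
          apply mul_nonneg <;> linarith [Nat.cast_nonneg (α := ℝ) (i : ℕ)]
        simp only [Sp, Sm, Matrix.transpose_apply, Matrix.of_apply, h1, if_true,
          Matrix.diagonal_apply_eq]
        rw [← Complex.ofReal_mul, Real.mul_self_sqrt h0]
        push_cast; ring
      · have : ¬ ((i : ℕ) = j) := fun h => hij (Fin.ext h)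
        simp [Sp, Sm, hij, this, h1]
    · intro k _ hk
      have : ¬ ((k : ℕ) + 1 = i) := fun h => hk (Fin.ext (by simp [← h]))
      simp [Sm, Sp, this]
    · simp
  · have hi' : (i : ℕ) = 0 := by omega
    rw [Finset.sum_eq_zero]
    · by_cases hij : i = j
      · subst hij; simp [hi']
      · simp [hij]
    · intro k _
      have : ¬ ((k : ℕ) + 1 = i) := by omega
      simp [Sp, Sm, this]

theorem Sp_comm_Sm (M : ℕ) : Sp M * Sm M - Sm M * Sp M = (2 : ℂ) • Sz M := by
  rw [Sp_mul_Sm, Sm_mul_Sp, Sz, Matrix.diagonal_sub, ← Matrix.diagonal_smul]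
  congr 1; funext i; simp; ring

theorem Sz_comm_Sp (M : ℕ) : Sz M * Sp M - Sp M * Sz M = Sp M := by
  ext i j
  simp only [Sz, Matrix.sub_apply, Matrix.diagonal_mul, Matrix.mul_diagonal, Sp, Matrix.of_apply]
  split_ifs with h
  · rw [← h]; push_cast; ring
  · simp

theorem Sz_comm_Sm (M : ℕ) : Sz M * Sm M - Sm M * Sz M = - Sm M := by
  have := congrArg Matrix.transpose (Sz_comm_Sp M)
  have hz : (Sz M).transpose = Sz M := Matrix.diagonal_transpose _
  rw [Matrix.transpose_sub, Matrix.transpose_mul, Matrix.transpose_mul, hz] at this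
  rw [Sm]
  conv_rhs => rw [← this]
  rw [neg_sub]

/-- The entries `E_ij` of the Lax operator `x δ_ij + η E_ij`. -/
def laxE (M : ℕ) : Matrix (Fin 2) (Fin 2) (Matrix (Fin (M + 1)) (Fin (M + 1)) ℂ) :=
  !![(1 / 2 : ℂ) • 1 + Sz M, Sm M; Sp M, (1 / 2 : ℂ) • 1 - Sz M]

theorem lax_eq (η : ℂ) (M : ℕ) (x : ℂ) (i j : Fin 2) :
    lax η M x i j = (if i = j then x else 0) • 1 + η • laxE M i j := by
  fin_cases i <;> fin_cases j <;> simp [lax, laxE]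

/-- These are the gl(2) relations for transposed matrix units; they are all that the exchange
relation of the Lax operator needs. -/
theorem laxE_comm (M : ℕ) (i j k l : Fin 2) :
    laxE M i j * laxE M k l - laxE M k l * laxE M i j =
      (if i = l then (1 : ℂ) else 0) • laxE M k j - (if k = j then (1 : ℂ) else 0) • laxE M i l := by
  have h1 := Sp_comm_Sm M
  have h2 := Sz_comm_Sp M
  have h3 := Sz_comm_Sm M
  have h1' : Sp M * Sm M = (2 : ℂ) • Sz M + Sm M * Sp M := by rw [← h1]; abel
  have h2' : Sz M * Sp M = Sp M + Sp M * Sz M := by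
    rw [← sub_eq_iff_eq_add, h2]
  have h3' : Sz M * Sm M = - Sm M + Sm M * Sz M := by rw [← h3]; abel
  fin_cases i <;> fin_cases j <;> fin_cases k <;> fin_cases l <;>
    simp [laxE, mul_add, add_mul, mul_sub, sub_mul, h1', h2', h3'] <;> module

end Spin

/-! ### Exchange relation, quantum determinant and commuting traces. -/

section RTT

set_option linter.unusedSectionVars false
variable {R : Type*} [Ring R] [Algebra ℂ R]

/-- The relation `R₁₂(x - y) M₁(x) M₂(y) = M₂(y) M₁(x) R₁₂(x - y)` with `R(u) = u + η P`. -/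
def RTT (η : ℂ) (M : ℂ → Matrix (Fin 2) (Fin 2) R) : Prop :=
  ∀ x y i j k l, (x - y) • (M x i j * M y k l) + η • (M x k j * M y i l) =
    (x - y) • (M y k l * M x i j) + η • (M y k j * M x i l)

theorem mul_entry_mul (A B A' B' : Matrix (Fin 2) (Fin 2) R)
    (hc : ∀ i j k l, Commute (B i j) (A' k l)) (i j k l : Fin 2) :
    (A * B) i j * (A' * B') k l = ∑ p, ∑ q, A i p * A' k q * (B p j * B' q l) := by
  rw [Matrix.mul_apply, Matrix.mul_apply, Finset.sum_mul_sum]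
  refine Finset.sum_congr rfl fun p _ => Finset.sum_congr rfl fun q _ => ?_
  rw [mul_assoc, ← mul_assoc (B p j), (hc p j k q).eq]
  simp only [mul_assoc]

/-- Entries of the two families commute, so the `M`-factors can be gathered to the left of the
`L`-factors; R then passes through the first pair and through the second. -/
theorem RTT.mul {η : ℂ} {M L : ℂ → Matrix (Fin 2) (Fin 2) R} (hM : RTT η M) (hL : RTT η L)
    (hc : ∀ x y i j k l, Commute (M x i j) (L y k l)) : RTT η fun x => M x * L x := by
  intro x y i j k l
  have hc' : ∀ x y i j k l, Commute (L x i j) (M y k l) := fun x y i j k l => (hc y x k l i j).symm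
  simp only [mul_entry_mul _ _ _ _ (hc' x y), mul_entry_mul _ _ _ _ (hc' y x)]
  have s1 : ∀ (c : ℂ) (F : Fin 2 → Fin 2 → R), c • ∑ p, ∑ q, F p q = ∑ p, ∑ q, c • F p q := by
    intro c F; simp only [Finset.smul_sum]
  simp only [s1]
  calc _ = ∑ p, ∑ q, ((x - y) • (M x i p * M y k q) + η • (M x k p * M y i q)) *
        (L x p j * L y q l) := by
        simp only [← Finset.sum_add_distrib, add_mul, smul_mul_assoc]
    _ = ∑ p, ∑ q, ((x - y) • (M y k q * M x i p) + η • (M y k p * M x i q)) *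
        (L x p j * L y q l) := by
        simp only [hM x y]
    -- Exchanging the names of p and q in the η-term hands the permutation over from the `M`-pair to
    -- the `L`-pair.
    _ = ∑ p, ∑ q, (M y k q * M x i p) * ((x - y) • (L x p j * L y q l) +
          η • (L x q j * L y p l)) := by
        simp only [add_mul, mul_add, Finset.sum_add_distrib, smul_mul_assoc, mul_smul_comm]
        congr 1
        rw [Finset.sum_comm]
    _ = ∑ p, ∑ q, (M y k q * M x i p) * ((x - y) • (L y q l * L x p j) +
          η • (L y q j * L x p l)) := by
        simp only [hL x y]
    _ = _ := by
        simp only [mul_add, Finset.sum_add_distrib, mul_smul_comm]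
        congr 1 <;> rw [Finset.sum_comm]

theorem RTT.map {S : Type*} [Ring S] [Algebra ℂ S] {η : ℂ} {M : ℂ → Matrix (Fin 2) (Fin 2) R}
    (hM : RTT η M) (φ : R →ₐ[ℂ] S) : RTT η fun x => (M x).map φ := by
  intro x y i j k l
  simpa using congrArg φ (hM x y i j k l)

theorem RTT_const (η : ℂ) (K : Matrix (Fin 2) (Fin 2) ℂ) :
    RTT η fun _ => K.map (algebraMap ℂ R) := by
  intro x y i j k l
  simp only [Matrix.map_apply, ← map_mul]
  rw [mul_comm (K i j), mul_comm (K k j)]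

theorem RTT_lax (η : ℂ) (M : ℕ) (z : ℂ) : RTT η fun x => lax η M (x - z) := by
  intro x y i j k l
  have h := laxE_comm M i j k l
  have h' : laxE M i j * laxE M k l = laxE M k l * laxE M i j +
      ((if i = l then (1 : ℂ) else 0) • laxE M k j - (if k = j then (1 : ℂ) else 0) • laxE M i l) := by
    rw [← h]; abel
  have g := laxE_comm M k j i l
  have g' : laxE M k j * laxE M i l = laxE M i l * laxE M k j +
      ((if k = l then (1 : ℂ) else 0) • laxE M i j - (if i = j then (1 : ℂ) else 0) • laxE M k l) := by
    rw [← g]; abel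
  simp only [lax_eq, mul_add, add_mul, smul_mul_assoc, mul_smul_comm, one_mul, mul_one, h', smul_add,
    smul_sub, smul_smul]
  have e1 : (if k = j then (1:ℂ) else 0) = if j = k then 1 else 0 := by simp only [eq_comm]
  split_ifs <;> module

/-- Symmetry of the rows implies symmetry of the columns in `M₁(x) M₂(x - η)`. -/
def Fusable (η : ℂ) (M : ℂ → Matrix (Fin 2) (Fin 2) R) : Prop :=
  ∀ x i j k l, M x i j * M (x - η) k l + M x k j * M (x - η) i l =
    M x i l * M (x - η) k j + M x k l * M (x - η) i j

/-- At y = x - η the R-matrix degenerates to η(1 + P), a multiple of the symmetriser, and the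
reversed product is visibly symmetric in the two column indices. -/
theorem RTT.fusable {η : ℂ} (hη : η ≠ 0) {M : ℂ → Matrix (Fin 2) (Fin 2) R} (hM : RTT η M) :
    Fusable η M := by
  have key : ∀ x i j k l, M x i j * M (x - η) k l + M x k j * M (x - η) i l =
      M (x - η) k l * M x i j + M (x - η) k j * M x i l := by
    intro x i j k l
    have h := hM x (x - η) i j k l
    have e : x - (x - η) = η := by ring
    rw [e, ← smul_add, ← smul_add] at h
    exact smul_right_injective R hη h
  intro x i j k l
  rw [key, key, add_comm]

/-- The quantum determinant `A(x) D(x - η) - B(x) C(x - η)` of a matrix family. -/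
def qd (η : ℂ) (M : ℂ → Matrix (Fin 2) (Fin 2) R) (x : ℂ) : R :=
  M x 0 0 * M (x - η) 1 1 - M x 0 1 * M (x - η) 1 0

theorem Fusable.row_comm {η : ℂ} {M : ℂ → Matrix (Fin 2) (Fin 2) R} (h : Fusable η M) (x : ℂ)
    (i j l : Fin 2) : M x i j * M (x - η) i l = M x i l * M (x - η) i j := by
  have := h x i j i l
  rw [← two_smul ℂ, ← two_smul ℂ] at this
  exact smul_right_injective R two_ne_zero this

theorem Fusable.qd_eq {η : ℂ} {M : ℂ → Matrix (Fin 2) (Fin 2) R} (h : Fusable η M) (x : ℂ) :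
    M x 1 1 * M (x - η) 0 0 - M x 1 0 * M (x - η) 0 1 = qd η M x := by
  have := h x 0 0 1 1
  rw [qd, sub_eq_sub_iff_add_eq_add, add_comm, ← this, add_comm]

/-- In the expansion over intermediate indices p, q the terms with p = q cancel by
`Fusable.row_comm`, and each antisymmetric pair with p ≠ q contributes the quantum determinant of
`L`. -/
theorem qd_mul {η : ℂ} {M L : ℂ → Matrix (Fin 2) (Fin 2) R} (hL : Fusable η L)
    (hc : ∀ x y i j k l, Commute (M x i j) (L y k l)) (x : ℂ) :
    qd η (fun x => M x * L x) x = qd η M x * qd η L x := by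
  have hc' : ∀ x y i j k l, Commute (L x i j) (M y k l) := fun x y i j k l => (hc y x k l i j).symm
  have h0 := hL.row_comm x 0 0 1
  have h1 := hL.row_comm x 1 0 1
  have h2 : L x 1 1 * L (x - η) 0 0 = qd η L x + L x 1 0 * L (x - η) 0 1 := by
    rw [← hL.qd_eq]; abel
  have h3 : L x 0 0 * L (x - η) 1 1 = qd η L x + L x 0 1 * L (x - η) 1 0 := by
    rw [qd]; abel
  conv_lhs => rw [qd]
  rw [mul_entry_mul _ _ _ _ (hc' _ _), mul_entry_mul _ _ _ _ (hc' _ _)]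
  simp only [Fin.sum_univ_two, h0, h1, h2, h3]
  rw [show qd η M x = M x 0 0 * M (x - η) 1 1 - M x 0 1 * M (x - η) 1 0 from rfl]
  noncomm_ring

theorem trace_comm_of_RTT {η : ℂ} {M : ℂ → Matrix (Fin 2) (Fin 2) R} (hM : RTT η M) {x y : ℂ}
    (hxy : (x - y) ^ 2 ≠ η ^ 2) : (M x).trace * (M y).trace = (M y).trace * (M x).trace := by
  simp only [Matrix.trace_fin_two, mul_add, add_mul]
  set d := x - y with hd
  have key : (d ^ 2 - η ^ 2) • (((M x 0 0 * M y 0 0 + M x 1 1 * M y 0 0) +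
      (M x 0 0 * M y 1 1 + M x 1 1 * M y 1 1)) -
      ((M y 0 0 * M x 0 0 + M y 1 1 * M x 0 0) + (M y 0 0 * M x 1 1 + M y 1 1 * M x 1 1))) = 0 := by
    have e : ∀ i j k l, d • (M x i j * M y k l) + η • (M x k j * M y i l) -
      (d • (M y k l * M x i j) + η • (M y k j * M x i l)) = 0 := fun i j k l => by
        rw [hd, hM x y i j k l, sub_self]
    -- The relation is contracted in two ways; η times the second contraction removes the mixed
    -- products from d times the first and leaves (d² - η²) times the commutator of the traces.
    have e1 : ∑ i, ∑ k, (d • (d • (M x i i * M y k k) + η • (M x k i * M y i k) -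
      (d • (M y k k * M x i i) + η • (M y k i * M x i k))) -
      η • (d • (M x i k * M y k i) + η • (M x k k * M y i i) -
      (d • (M y k i * M x i k) + η • (M y k k * M x i i)))) = 0 := by
      simp [e]
    rw [← e1]
    simp only [Fin.sum_univ_two]
    module
  have := (smul_eq_zero.mp key).resolve_left (sub_ne_zero.mpr hxy)
  exact sub_eq_zero.mp this

end RTT

/-! ### Polynomial dependence on the spectral parameter. -/

section PolynomialFamilies

variable {E F : Type*} [AddCommGroup E] [Module ℂ E] [AddCommGroup F] [Module ℂ F]

/-- `f` is a polynomial of degree at most `n` with coefficients in `E` and `n`-th coefficient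
`e`. -/
def PolyLead (f : ℂ → E) (n : ℕ) (e : E) : Prop :=
  ∃ c : ℕ → E, c n = e ∧ ∀ x, f x = ∑ k ∈ Finset.range (n + 1), x ^ k • c k

theorem PolyLead.map {f : ℂ → E} {n : ℕ} {e : E} (h : PolyLead f n e) (φ : E →ₗ[ℂ] F) :
    PolyLead (fun x => φ (f x)) n (φ e) := by
  obtain ⟨c, hc, hf⟩ := h
  exact ⟨fun k => φ (c k), by simp [hc], fun x => by simp [hf]⟩

theorem PolyLead.mul_left {A : Type*} [Ring A] [Algebra ℂ A] {f : ℂ → A} {n : ℕ} {e : A}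
    (h : PolyLead f n e) (b : A) : PolyLead (fun x => (x • 1 + b) * f x) (n + 1) e := by
  obtain ⟨c, hc, hf⟩ := h
  refine ⟨fun k => (if k ≤ n then b * c k else 0) + (if k = 0 then 0 else c (k - 1)),
    by simp [hc], fun x => ?_⟩
  simp only [hf, add_mul, smul_mul_assoc, one_mul, smul_add, Finset.sum_add_distrib]
  rw [add_comm, Finset.sum_range_succ (n := n + 1), Finset.sum_range_succ' (n := n + 1)]
  simp only [add_le_iff_nonpos_right, nonpos_iff_eq_zero, one_ne_zero, if_false, smul_zero, add_zero,
    if_true, Nat.add_sub_cancel, Nat.add_eq_zero_iff, and_false]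
  congr 1
  · rw [Finset.mul_sum]
    refine Finset.sum_congr rfl fun k hk => ?_
    rw [if_pos (by simpa [Nat.lt_succ_iff] using hk), mul_smul_comm]
  · rw [Finset.smul_sum]
    refine Finset.sum_congr rfl fun k hk => ?_
    rw [smul_smul, pow_succ']

theorem PolyLead.exists_polynomial {f : ℂ → ℂ} {n : ℕ} {e : ℂ} (h : PolyLead f n e) :
    ∃ p : ℂ[X], p.natDegree ≤ n ∧ p.coeff n = e ∧ ∀ x, p.eval x = f x := by
  obtain ⟨c, hc, hf⟩ := h
  refine ⟨∑ k ∈ Finset.range (n + 1), C (c k) * X ^ k, ?_, ?_, ?_⟩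
  · refine natDegree_sum_le_of_forall_le _ _ fun k hk => ?_
    exact (natDegree_C_mul_X_pow_le _ _).trans (by simpa [Nat.lt_succ_iff] using hk)
  · simp [finsetSum_coeff, coeff_C_mul, coeff_X_pow, hc]
  · intro x
    rw [hf, eval_finsetSum]
    exact Finset.sum_congr rfl fun k _ => by
      rw [eval_mul, eval_C, eval_pow, eval_X, smul_eq_mul, mul_comm]

theorem matrix_coeff_eq_zero {α β : Type*} (S : Set ℂ) (hS : S.Infinite) (n : ℕ)
    (c : ℕ → Matrix α β ℂ) (h : ∀ x ∈ S, ∑ k ∈ Finset.range n, x ^ k • c k = 0) :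
    ∀ k < n, c k = 0 := by
  intro k hk
  ext i j
  let p : ℂ[X] := ∑ k ∈ Finset.range n, C (c k i j) * X ^ k
  have hp : p = 0 := by
    refine Polynomial.eq_zero_of_infinite_isRoot p (hS.mono fun x hx => ?_)
    have := congrFun (congrFun (h x hx) i) j
    simp only [Matrix.sum_apply, Matrix.smul_apply, smul_eq_mul, Matrix.zero_apply] at this
    simp only [p, IsRoot.def, eval_finsetSum, eval_mul, eval_C, eval_pow, eval_X, Set.mem_ofPred_eq]
    rw [← this]
    exact Finset.sum_congr rfl fun k _ => mul_comm _ _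
  have := congrArg (fun q => q.coeff k) hp
  simpa [p, finsetSum_coeff, coeff_C_mul, coeff_X_pow, hk] using this

end PolynomialFamilies

/-! ### Monodromy matrix, commuting transfer matrices and the value of the quantum determinant. -/

section Monodromy

variable {N : ℕ} (η : ℂ) (m : Fin N → ℕ) (ξ : Fin N → ℂ)

/-- The Lax operator of the site `n`, with entries acting on the quantum space. -/
def siteLax (n : Fin N) (x : ℂ) : Matrix (Fin 2) (Fin 2) (Op m) :=
  (lax η (m n) (x - ξ n)).map fun X => (embed n X : Op m)

/-- The product of the Lax operators of a list of sites. -/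
def siteProd (L : List (Fin N)) (x : ℂ) : Matrix (Fin 2) (Fin 2) (Op m) :=
  (L.map fun n => siteLax η m ξ n x).prod

theorem monodromy_eq (K : Matrix (Fin 2) (Fin 2) ℂ) (x : ℂ) :
    monodromy η m ξ K x =
      K.map (algebraMap ℂ (Op m)) * siteProd η m ξ (List.finRange N).reverse x := by
  rw [monodromy, siteProd, List.ofFn_eq_map, List.map_reverse]
  rfl

theorem siteLax_commute {n n' : Fin N} (h : n ≠ n') (x y : ℂ) (i j k l : Fin 2) :
    Commute (siteLax η m ξ n x i j) (siteLax η m ξ n' y k l) :=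
  embed_mul_embed_comm h _ _ fun _ _ _ _ => Commute.all _ _

theorem siteProd_cons (n : Fin N) (L : List (Fin N)) (x : ℂ) :
    siteProd η m ξ (n :: L) x = siteLax η m ξ n x * siteProd η m ξ L x := by
  simp [siteProd]

theorem siteProd_append (L L' : List (Fin N)) (x : ℂ) :
    siteProd η m ξ (L ++ L') x = siteProd η m ξ L x * siteProd η m ξ L' x := by
  simp [siteProd]

theorem siteProd_commute_of {R : Op m} (L : List (Fin N))
    (h : ∀ n ∈ L, ∀ x i j, Commute R (siteLax η m ξ n x i j)) (x : ℂ) (i j : Fin 2) :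
    Commute R (siteProd η m ξ L x i j) := by
  induction L generalizing i j with
  | nil =>
    simp only [siteProd, List.map_nil, List.prod_nil, Matrix.one_apply]
    split_ifs
    · exact Commute.one_right _
    · exact Commute.zero_right _
  | cons n L ih =>
    rw [siteProd_cons, Matrix.mul_apply]
    exact Commute.sum_right _ _ _ fun k _ => (h n (by simp) x i k).mul_right
      (ih (fun n' hn' => h n' (by simp [hn'])) k j)

theorem siteProd_commute {L L' : List (Fin N)} (h : ∀ n ∈ L, n ∉ L') (x y : ℂ) (i j k l : Fin 2) :
    Commute (siteProd η m ξ L x i j) (siteProd η m ξ L' y k l) := by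
  refine siteProd_commute_of η m ξ L' (fun n' hn' y k l => Commute.symm ?_) y k l
  refine siteProd_commute_of η m ξ L (fun n hn x i j => ?_) x i j
  have e : n' ≠ n := by
    rintro rfl
    exact h _ hn hn'
  exact siteLax_commute η m ξ e _ _ _ _ _ _

theorem RTT_siteLax (n : Fin N) : RTT η (siteLax η m ξ n) :=
  (RTT_lax η (m n) (ξ n)).map (embedHom (κ := fun n => Fin (m n + 1)) n)

theorem RTT_siteProd (L : List (Fin N)) (hL : L.Nodup) : RTT η (siteProd η m ξ L) := by
  induction L with
  | nil =>
    have := RTT_const (R := Op m) η 1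
    rw [Matrix.map_one _ (map_zero _) (map_one _)] at this
    exact this
  | cons n L ih =>
    rw [List.nodup_cons] at hL
    have e : siteProd η m ξ (n :: L) = fun x => siteLax η m ξ n x * siteProd η m ξ L x := by
      funext x; exact siteProd_cons η m ξ n L x
    rw [e]
    refine (RTT_siteLax η m ξ n).mul (ih hL.2) fun x y i j k l => ?_
    refine siteProd_commute_of η m ξ L (fun n' hn' y k l => ?_) y k l
    exact siteLax_commute η m ξ (fun h : n = n' => hL.1 (h.symm ▸ hn')) _ _ _ _ _ _

theorem map_algebraMap_commute (K : Matrix (Fin 2) (Fin 2) ℂ) (X : Op m) (i j : Fin 2) :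
    Commute (K.map (algebraMap ℂ (Op m)) i j) X := by
  rw [Matrix.map_apply]
  exact Algebra.commutes _ _

theorem RTT_gauge_mul (K : Matrix (Fin 2) (Fin 2) ℂ) (L : List (Fin N)) (hL : L.Nodup) :
    RTT η fun x => K.map (algebraMap ℂ (Op m)) * siteProd η m ξ L x :=
  (RTT_const η K).mul (RTT_siteProd η m ξ L hL) fun _ _ _ _ _ _ => map_algebraMap_commute m K _ _ _

theorem nodup_sites : (List.finRange N).reverse.Nodup :=
  List.nodup_reverse.mpr (List.nodup_finRange N)

theorem RTT_monodromy (K : Matrix (Fin 2) (Fin 2) ℂ) : RTT η (monodromy η m ξ K) := by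
  have e : monodromy η m ξ K = _ := funext (monodromy_eq η m ξ K)
  rw [e]
  exact RTT_gauge_mul η m ξ K _ nodup_sites

theorem siteLax_eq (n : Fin N) (x : ℂ) :
    siteLax η m ξ n x = x • 1 + siteLax η m ξ n 0 := by
  ext1 i j
  simp only [siteLax, Matrix.map_apply, lax_eq, Matrix.add_apply, Matrix.smul_apply,
    Matrix.one_apply]
  simp only [← embedHom_apply, map_add, map_smul, map_one]
  split_ifs
  · module
  · module

theorem polyLead_siteProd (L : List (Fin N)) : PolyLead (siteProd η m ξ L) L.length 1 := by
  induction L with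
  | nil => exact ⟨fun _ => 1, rfl, fun x => by simp [siteProd]⟩
  | cons n L ih =>
    have e : siteProd η m ξ (n :: L) = fun x => (x • 1 + siteLax η m ξ n 0) * siteProd η m ξ L x := by
      funext x; rw [siteProd_cons, siteLax_eq]
    rw [e]
    exact ih.mul_left _

theorem polyLead_transfer (K : Matrix (Fin 2) (Fin 2) ℂ) :
    PolyLead (transfer η m ξ K) N (K.trace • 1) := by
  have h := polyLead_siteProd η m ξ (List.finRange N).reverse
  rw [List.length_reverse, List.length_finRange] at h
  have h2 := h.map (((Matrix.traceLinearMap (Fin 2) ℂ (Op m))).comp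
    (LinearMap.mulLeft ℂ (K.map (algebraMap ℂ (Op m)))))
  have e : transfer η m ξ K = fun x => (((Matrix.traceLinearMap (Fin 2) ℂ (Op m))).comp
    (LinearMap.mulLeft ℂ (K.map (algebraMap ℂ (Op m))))) (siteProd η m ξ (List.finRange N).reverse x) := by
    funext x
    simp [transfer, monodromy_eq]
  rw [e]
  convert h2 using 1
  simp [Matrix.trace_fin_two, Algebra.algebraMap_eq_smul_one, add_smul]

/-- The exchange relation leaves out x - y = ±η; since the commutator is polynomial in x, these
values follow from the infinitely many others. -/
theorem transfer_commute (K : Matrix (Fin 2) (Fin 2) ℂ) (x y : ℂ) :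
    Commute (transfer η m ξ K x) (transfer η m ξ K y) := by
  obtain ⟨c, -, hc⟩ := polyLead_transfer η m ξ K
  let S : Set ℂ := {x | (x - y) ^ 2 ≠ η ^ 2}
  have hS : S.Infinite := by
    have : Sᶜ ⊆ {y + η, y - η} := by
      intro z hz
      have : (z - y) ^ 2 = η ^ 2 := by simpa [S] using hz
      rcases sq_eq_sq_iff_eq_or_eq_neg.mp this with h | h
      · left; linear_combination h
      · right; simp only [Set.mem_singleton_iff]; linear_combination h
    exact fun hfin => Set.infinite_univ (α := ℂ) (by
        rw [← Set.union_compl_self S]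
        exact hfin.union ((Set.toFinite _).subset this))
  have key := matrix_coeff_eq_zero S hS (N + 1)
    (fun k => c k * transfer η m ξ K y - transfer η m ξ K y * c k) (by
      intro z hz
      have h := trace_comm_of_RTT (RTT_monodromy η m ξ K) (x := z) (y := y) hz
      change transfer η m ξ K z * transfer η m ξ K y = transfer η m ξ K y * transfer η m ξ K z at h
      rw [hc z] at h
      rw [Finset.sum_mul, Finset.mul_sum] at h
      simp only [smul_sub, Finset.sum_sub_distrib]
      simp only [smul_mul_assoc, mul_smul_comm] at h
      rw [h, sub_self])
  rw [hc x]
  refine Commute.sum_left _ _ _ fun k hk => Commute.smul_left ?_ _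
  exact sub_eq_zero.mp (key k (Finset.mem_range.mp hk))

/-- Both the product of the diagonal entries and S⁻S⁺ depend on the weight, but the dependence
cancels: what remains is essentially the Casimir. -/
theorem qd_siteLax (n : Fin N) (x : ℂ) : qd η (siteLax η m ξ n) x =
    ((x - (ξ n - η / 2) + (m n : ℂ) / 2 * η) * (x - η - (ξ n - η / 2) - (m n : ℂ) / 2 * η)) •
      (1 : Op m) := by
  have h : lax η (m n) (x - ξ n) 0 0 * lax η (m n) (x - η - ξ n) 1 1 -
      lax η (m n) (x - ξ n) 0 1 * lax η (m n) (x - η - ξ n) 1 0 =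
      ((x - (ξ n - η / 2) + (m n : ℂ) / 2 * η) * (x - η - (ξ n - η / 2) - (m n : ℂ) / 2 * η)) •
      (1 : Matrix (Fin (m n + 1)) (Fin (m n + 1)) ℂ) := by
    have hs := Sm_mul_Sp (m n)
    simp only [lax, Matrix.of_apply, Matrix.cons_val', Matrix.cons_val_zero, Matrix.cons_val_one,
      Matrix.cons_val_fin_one, smul_mul_assoc, mul_smul_comm, hs]
    have hz : Sz (m n) = Matrix.diagonal fun j : Fin (m n + 1) => (m n : ℂ) / 2 - ((j : ℕ) : ℂ) := rfl
    rw [hz, ← Matrix.diagonal_one]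
    simp only [← Matrix.diagonal_smul, Matrix.diagonal_add, Matrix.diagonal_sub,
      Matrix.diagonal_mul_diagonal]
    congr 1
    funext j
    simp only [Pi.smul_apply, smul_eq_mul]
    ring
  have := congrArg (embedHom (κ := fun n => Fin (m n + 1)) n) h
  rw [map_sub, map_mul, map_mul, map_smul, map_one] at this
  exact this

theorem qd_siteProd (hη : η ≠ 0) (L : List (Fin N)) (hL : L.Nodup) (x : ℂ) :
    qd η (siteProd η m ξ L) x =
      ((L.map fun n => (x - (ξ n - η / 2) + (m n : ℂ) / 2 * η) *
        (x - η - (ξ n - η / 2) - (m n : ℂ) / 2 * η)).prod) • (1 : Op m) := by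
  induction L with
  | nil => simp [qd, siteProd]
  | cons n L ih =>
    rw [List.nodup_cons] at hL
    have e : siteProd η m ξ (n :: L) = fun x => siteLax η m ξ n x * siteProd η m ξ L x := by
      funext x; exact siteProd_cons η m ξ n L x
    rw [e, qd_mul ((RTT_siteProd η m ξ L hL.2).fusable hη), ih hL.2, qd_siteLax, List.map_cons,
      List.prod_cons]
    · simp [smul_smul, mul_comm]
    · intro x y i j k l
      refine siteProd_commute_of η m ξ L (fun n' hn' y k l => ?_) y k l
      exact siteLax_commute η m ξ (fun h : n = n' => hL.1 (h.symm ▸ hn')) _ _ _ _ _ _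

theorem qdet_eq (hη : η ≠ 0) (K : Matrix (Fin 2) (Fin 2) ℂ) (x : ℂ) :
    qdet η m ξ K x = (K.det * (aFun η m ξ x * dFun η m ξ (x - η))) • (1 : Op m) := by
  have e : monodromy η m ξ K = _ := funext (monodromy_eq η m ξ K)
  change qd η (monodromy η m ξ K) x = _
  rw [e, qd_mul (M := fun _ => K.map (algebraMap ℂ (Op m)))
    ((RTT_siteProd η m ξ _ nodup_sites).fusable hη)
    (fun _ _ _ _ _ _ => map_algebraMap_commute m K _ _ _), qd_siteProd η m ξ hη _ nodup_sites]
  have h1 : qd η (fun _ => K.map (algebraMap ℂ (Op m))) x = K.det • (1 : Op m) := by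
    simp only [qd, Matrix.map_apply, Matrix.det_fin_two, Algebra.algebraMap_eq_smul_one,
      smul_mul_smul_comm, mul_one, sub_smul]
  rw [h1, smul_mul_smul_comm, mul_one, List.map_reverse, List.prod_reverse,
    ← List.ofFn_eq_map, List.prod_ofFn, Finset.prod_mul_distrib]
  rfl

end Monodromy

/-! ### Fusion recursion in terms of generating polynomials over the row indices. -/

section Fusion

variable {R : Type*} [Ring R]

/-- The generating polynomial `M_{0j} + X M_{1j}` of the `j`-th column. -/
def colPoly (M : Matrix (Fin 2) (Fin 2) R) (j : Fin 2) : R[X] := C (M 0 j) + X * C (M 1 j)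

theorem linear_mul_linear (a b c d : R) : (C a + X * C b) * (C c + X * C d) =
    C (a * c) + X * C (a * d + b * c) + X * X * C (b * d) := by
  have h : ∀ (a : R) (p : R[X]), C a * (X * p) = X * (C a * p) := fun a p => by
    rw [← mul_assoc, ← X_mul_C, mul_assoc]
  simp only [add_mul, mul_add, h, mul_assoc, C_add, C_mul]
  abel

theorem coeff_linear_mul_zero (a b : R) (p : R[X]) :
    ((C a + X * C b) * p).coeff 0 = a * p.coeff 0 := by
  simp [add_mul, mul_assoc]

theorem coeff_linear_mul_succ (a b : R) (p : R[X]) (k : ℕ) :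
    ((C a + X * C b) * p).coeff (k + 1) = a * p.coeff (k + 1) + b * p.coeff k := by
  simp [add_mul, mul_assoc, coeff_C_mul, coeff_X_mul]

/-- The generating polynomial, over the row indices, of the rows-symmetrised product
`M₁(y + (l - 1)η) ⋯ M_l(y)` in a column of type `(0, …, 0, 1, …, 1)` with `c` ones. -/
def fusedCol (η y : ℂ) (M : ℂ → Matrix (Fin 2) (Fin 2) R) : ℕ → ℕ → R[X]
  | 0, _ => 1
  | l + 1, c => if c ≤ l then colPoly (M (y + l * η)) 0 * fusedCol η y M l c
      else colPoly (M (y + l * η)) 1 * fusedCol η y M l l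

theorem fusedCol_succ_of_le {η y : ℂ} {M : ℂ → Matrix (Fin 2) (Fin 2) R} {l c : ℕ} (h : c ≤ l) :
    fusedCol η y M (l + 1) c = colPoly (M (y + l * η)) 0 * fusedCol η y M l c := by
  rw [fusedCol, if_pos h]

theorem fusedCol_succ_self {η y : ℂ} {M : ℂ → Matrix (Fin 2) (Fin 2) R} {l : ℕ} :
    fusedCol η y M (l + 1) (l + 1) = colPoly (M (y + l * η)) 1 * fusedCol η y M l l := by
  rw [fusedCol, if_neg (by omega)]

/-- The trace over the symmetric part, in terms of the generating polynomials. -/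
def fusedTr (η y : ℂ) (M : ℂ → Matrix (Fin 2) (Fin 2) R) (l : ℕ) : R :=
  ∑ c ∈ Finset.range (l + 1), (fusedCol η y M l c).coeff c

theorem fusedCol_coeff_eq_zero (η y : ℂ) (M : ℂ → Matrix (Fin 2) (Fin 2) R) (l c k : ℕ)
    (hk : l < k) : (fusedCol η y M l c).coeff k = 0 := by
  induction l generalizing c k with
  | zero => simp [fusedCol, coeff_one, hk.ne']
  | succ l ih =>
    obtain ⟨k, rfl⟩ : ∃ k', k = k' + 1 := ⟨k - 1, by omega⟩
    rw [fusedCol]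
    split_ifs <;>
      rw [colPoly, coeff_linear_mul_succ, ih _ _ (by omega), ih _ _ (by omega)] <;> simp

theorem fusedTr_zero (η y : ℂ) (M : ℂ → Matrix (Fin 2) (Fin 2) R) : fusedTr η y M 0 = 1 := by
  simp [fusedTr, fusedCol]

variable [Algebra ℂ R]

/-- The central variable X records only how many row indices equal 1, which amounts to symmetrising
the rows; hence neighbouring column indices may be exchanged. -/
theorem Fusable.colPoly_swap {η : ℂ} {M : ℂ → Matrix (Fin 2) (Fin 2) R} (h : Fusable η M) (x : ℂ) :
    colPoly (M x) 1 * colPoly (M (x - η)) 0 = colPoly (M x) 0 * colPoly (M (x - η)) 1 := by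
  rw [colPoly, colPoly, colPoly, colPoly, linear_mul_linear, linear_mul_linear,
    h.row_comm x 0 1 0, h.row_comm x 1 1 0]
  have := h x 0 0 1 1
  rw [← this]

/-- A column index 1 in front migrates past the zeros to its canonical place. -/
theorem Fusable.fusedCol_one {η : ℂ} {M : ℂ → Matrix (Fin 2) (Fin 2) R} (h : Fusable η M) (y : ℂ)
    (l c : ℕ) (hc : c ≤ l) :
    colPoly (M (y + l * η)) 1 * fusedCol η y M l c = fusedCol η y M (l + 1) (c + 1) := by
  induction l generalizing c with
  | zero =>
    obtain rfl : c = 0 := by omega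
    simp [fusedCol]
  | succ l ih =>
    rcases hc.eq_or_lt with rfl | hc
    · rw [fusedCol_succ_self (l := l + 1)]
    · have hc' : c ≤ l := by omega
      rw [fusedCol_succ_of_le (l := l + 1) (by omega), ← ih c hc', fusedCol_succ_of_le hc']
      have e : y + (l : ℂ) * η = y + ((l + 1 : ℕ) : ℂ) * η - η := by push_cast; ring
      rw [e, ← mul_assoc, ← mul_assoc, h.colPoly_swap]

/-- Splitting off the first factor, the fused trace falls short of the product of traces by terms in
which the first two factors are antisymmetrised; those produce the quantum determinant times the
trace of order `l`. -/
theorem Fusable.fusedTr_rec {η : ℂ} {M : ℂ → Matrix (Fin 2) (Fin 2) R} (h : Fusable η M) (y : ℂ)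
    (l : ℕ) : fusedTr η y M (l + 2) =
      (M (y + (l + 1 : ℕ) * η)).trace * fusedTr η y M (l + 1) -
        qd η M (y + (l + 1 : ℕ) * η) * fusedTr η y M l := by
  have e : y + (l : ℂ) * η = y + ((l + 1 : ℕ) : ℂ) * η - η := by push_cast; ring
  set μ := y + ((l + 1 : ℕ) : ℂ) * η with hμ
  have h1 : fusedTr η y M (l + 2) = M μ 0 0 * fusedTr η y M (l + 1) +
      ∑ c ∈ Finset.range (l + 1), M μ 1 0 * (fusedCol η y M (l + 1) (c + 1)).coeff c +
      M μ 1 1 * (fusedCol η y M (l + 1) (l + 1)).coeff (l + 1) := by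
    rw [fusedTr, Finset.sum_range_succ]
    congr 1
    · have : ∀ c ∈ Finset.range (l + 2), (fusedCol η y M (l + 2) c).coeff c =
          (colPoly (M μ) 0 * fusedCol η y M (l + 1) c).coeff c := by
        intro c hc
        rw [fusedCol_succ_of_le (by simpa [Nat.lt_succ_iff] using hc)]
      rw [Finset.sum_congr rfl this, Finset.sum_range_succ']
      simp only [colPoly, coeff_linear_mul_zero, coeff_linear_mul_succ, Finset.sum_add_distrib]
      rw [fusedTr, Finset.sum_range_succ' _ (l + 1), mul_add, Finset.mul_sum]
      abel
    · rw [fusedCol_succ_self, ← hμ, colPoly, coeff_linear_mul_succ,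
        fusedCol_coeff_eq_zero _ _ _ _ _ _ (by omega), mul_zero, zero_add]
  -- The part of the expansion in X where the second factor takes row 1 cancels by
  -- `Fusable.row_comm`; the part with row 0 is `qd` in the form `Fusable.qd_eq`.
  have h2 : ∀ c ∈ Finset.range (l + 1), M μ 1 1 * (fusedCol η y M (l + 1) c).coeff c -
      M μ 1 0 * (fusedCol η y M (l + 1) (c + 1)).coeff c =
      qd η M μ * (fusedCol η y M l c).coeff c := by
    intro c hc
    have hc' : c ≤ l := by simpa [Nat.lt_succ_iff] using hc
    rw [← h.fusedCol_one y l c hc', fusedCol_succ_of_le hc', e]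
    have hr := h.row_comm μ 1 1 0
    rcases c with _ | k
    · simp only [colPoly, coeff_linear_mul_zero]
      rw [← h.qd_eq]
      noncomm_ring
    · simp only [colPoly, coeff_linear_mul_succ]
      rw [← h.qd_eq, mul_add, mul_add, ← mul_assoc (M μ 1 1) (M (μ - η) 1 0), hr]
      noncomm_ring
  rw [h1, eq_sub_iff_add_eq, fusedTr.eq_1 _ _ _ l, Finset.mul_sum, ← Finset.sum_congr rfl h2,
    Matrix.trace_fin_two, add_mul, fusedTr, Finset.sum_range_succ _ (l + 1)]
  simp only [Finset.sum_sub_distrib, mul_add, Finset.mul_sum]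
  abel

end Fusion

/-! ### Comparison of the trace over the symmetric part with the generating polynomials. -/

section TensorProducts

variable {R : Type*} [Ring R]

/-- The entries of `M₁ ⋯ M_l` acting on the `l` auxiliary spaces. -/
def tens {l : ℕ} (M : Fin l → Matrix (Fin 2) (Fin 2) R) (I J : Fin l → Fin 2) : R :=
  (List.ofFn fun r => M r (I r) (J r)).prod

/-- The number of ones of a multi-index. -/
def ones {l : ℕ} (I : Fin l → Fin 2) : ℕ := ∑ r, (I r : ℕ)

theorem ones_le {l : ℕ} (I : Fin l → Fin 2) : ones I ≤ l := by
  have : ones I ≤ ∑ _r : Fin l, 1 := Finset.sum_le_sum fun r _ => by omega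
  simpa using this

theorem prod_linear_eq_sum {w : R} (hw : ∀ x, Commute w x) {l : ℕ} (u : Fin l → Fin 2 → R) :
    (List.ofFn fun r => u r 0 + w * u r 1).prod =
      ∑ I : Fin l → Fin 2, w ^ ones I * (List.ofFn fun r => u r (I r)).prod := by
  induction l with
  | zero => simp [ones]
  | succ l ih =>
    rw [List.ofFn_succ, List.prod_cons, ih fun r => u r.succ, ← (Fin.consEquiv _).sum_comp,
      Fintype.sum_prod_type, Fin.sum_univ_two, add_mul, Finset.mul_sum, Finset.mul_sum]
    congr 1
    · refine Finset.sum_congr rfl fun I _ => ?_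
      simp only [ones, Fin.sum_univ_succ, Fin.consEquiv_apply, Fin.cons_zero, Fin.cons_succ,
        List.ofFn_succ, List.prod_cons, Fin.val_zero, zero_add]
      rw [← mul_assoc, ← mul_assoc, ((hw (u 0 0)).pow_left _).eq]
    · refine Finset.sum_congr rfl fun I _ => ?_
      simp only [ones, Fin.sum_univ_succ, Fin.consEquiv_apply, Fin.cons_zero, Fin.cons_succ,
        List.ofFn_succ, List.prod_cons, Fin.val_one, pow_add, pow_one]
      rw [← mul_assoc, mul_assoc w, ← ((hw (u 0 1)).pow_left _).eq]
      simp only [mul_assoc]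

theorem prod_colPoly {l : ℕ} (M : Fin l → Matrix (Fin 2) (Fin 2) R) (J : Fin l → Fin 2) :
    (List.ofFn fun r => colPoly (M r) (J r)).prod =
      ∑ I : Fin l → Fin 2, X ^ ones I * C (tens M I J) := by
  have := prod_linear_eq_sum (R := R[X]) (w := X) (fun p => commute_X p)
    (fun r i => C (M r i (J r)))
  simp only [colPoly]
  rw [this]
  refine Finset.sum_congr rfl fun I _ => ?_
  rw [tens, map_list_prod, List.map_ofFn]
  rfl

theorem coeff_prod_colPoly {l : ℕ} (M : Fin l → Matrix (Fin 2) (Fin 2) R) (J : Fin l → Fin 2)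
    (c : ℕ) : (List.ofFn fun r => colPoly (M r) (J r)).prod.coeff c =
      ∑ I with ones I = c, tens M I J := by
  rw [prod_colPoly, finsetSum_coeff, Finset.sum_filter]
  refine Finset.sum_congr rfl fun I _ => ?_
  rw [X_pow_mul, coeff_C_mul, coeff_X_pow]
  simp [eq_comm]

theorem tens_eq_prod_embed {l : ℕ} (M : Fin l → Matrix (Fin 2) (Fin 2) R) (I J : Fin l → Fin 2) :
    (List.ofFn fun r => (embed r (M r) : Matrix (Fin l → Fin 2) (Fin l → Fin 2) R)).prod I J =
      tens M I J := by
  rw [List.ofFn_eq_map, prod_embed_apply _ _ (List.nodup_finRange l), if_pos (by simp), tens,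
    List.ofFn_eq_map]

theorem tens_mul {l : ℕ} (A B : Fin l → Matrix (Fin 2) (Fin 2) R)
    (hc : ∀ r r' i j k n, Commute (A r i j) (B r' k n)) (I J : Fin l → Fin 2) :
    tens (fun r => A r * B r) I J = ∑ P, tens A I P * tens B P J := by
  induction l with
  | zero => simp [tens]
  | succ l ih =>
    have h := ih (fun r => A r.succ) (fun r => B r.succ)
      (fun r r' => hc r.succ r'.succ) (fun r => I r.succ) (fun r => J r.succ)
    simp only [tens] at h ⊢
    rw [List.ofFn_succ, List.prod_cons, h, Matrix.mul_apply, Finset.sum_mul_sum,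
      ← (Fin.consEquiv _).sum_comp, Fintype.sum_prod_type]
    refine Finset.sum_congr rfl fun p _ => Finset.sum_congr rfl fun P _ => ?_
    simp only [Fin.consEquiv_apply, Fin.cons_zero, Fin.cons_succ, List.ofFn_succ, List.prod_cons]
    have : Commute (B 0 p (J 0)) (List.ofFn fun r => A r.succ (I r.succ) (P r)).prod := by
      refine Commute.list_prod_right _ _ fun x hx => ?_
      obtain ⟨r, rfl⟩ := List.mem_ofFn.mp hx
      exact (hc _ _ _ _ _ _).symm
    simp only [mul_assoc]
    rw [← mul_assoc (B 0 p (J 0)), this.eq]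
    simp only [mul_assoc]

/-- After row symmetrisation the column indices can be sorted, so only the number of ones among them
matters. -/
theorem Fusable.prod_colPoly [Algebra ℂ R] {η : ℂ} {M : ℂ → Matrix (Fin 2) (Fin 2) R}
    (h : Fusable η M) (y : ℂ) (l : ℕ) (J : Fin l → Fin 2) :
    (List.ofFn fun r : Fin l => colPoly (M (y + ((l : ℂ) - 1 - ((r : ℕ) : ℂ)) * η)) (J r)).prod =
      fusedCol η y M l (ones J) := by
  induction l with
  | zero => simp [fusedCol]
  | succ l ih =>
    have ih' := ih fun r => J r.succ
    rw [List.ofFn_succ, List.prod_cons]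
    have e : (fun r : Fin l => colPoly (M (y + (((l + 1 : ℕ) : ℂ) - 1 - ((r.succ : ℕ) : ℂ)) * η))
        (J r.succ)) = fun r : Fin l => colPoly (M (y + ((l : ℂ) - 1 - ((r : ℕ) : ℂ)) * η))
        (J r.succ) := by
      funext r
      congr 3
      rw [Fin.val_succ]; push_cast; ring
    have e0 : y + (((l + 1 : ℕ) : ℂ) - 1 - (((0 : Fin (l + 1)) : ℕ) : ℂ)) * η = y + (l : ℂ) * η := by
      rw [Fin.val_zero]; push_cast; ring
    rw [e, ih', e0]
    have hle := ones_le fun r => J r.succ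
    have hs : ones J = (J 0 : ℕ) + ones fun r => J r.succ := by
      simp [ones, Fin.sum_univ_succ]
    have h01 : J 0 = 0 ∨ J 0 = 1 := by
      generalize J 0 = j; revert j; decide
    rcases h01 with h0 | h0
    · rw [hs, h0, fusedCol, Fin.val_zero, zero_add, if_pos hle]
    · rw [hs, h0, h.fusedCol_one y l _ hle, Fin.val_one, add_comm 1]

theorem Fusable.sum_tens [Algebra ℂ R] {η : ℂ} {M : ℂ → Matrix (Fin 2) (Fin 2) R}
    (h : Fusable η M) (y : ℂ) (l : ℕ) (J : Fin l → Fin 2) (c : ℕ) :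
    ∑ I with ones I = c, tens (fun r : Fin l => M (y + ((l : ℂ) - 1 - ((r : ℕ) : ℂ)) * η)) I J =
      (fusedCol η y M l (ones J)).coeff c := by
  rw [← h.prod_colPoly, ← coeff_prod_colPoly (fun r : Fin l => M (y + ((l : ℂ) - 1 - ((r : ℕ) : ℂ)) * η))]

theorem ones_comp {l : ℕ} (I : Fin l → Fin 2) (π : Equiv.Perm (Fin l)) : ones (I ∘ π) = ones I :=
  Equiv.sum_comp π fun r => (I r : ℕ)

theorem exists_perm_of_ones_eq {l : ℕ} {I J : Fin l → Fin 2} (h : ones I = ones J) :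
    ∃ π : Equiv.Perm (Fin l), J ∘ π = I := by
  have h1 : ∀ K : Fin l → Fin 2, ones K = Fintype.card {r // K r = 1} := by
    intro K
    rw [Fintype.card_subtype, Finset.card_filter, ones]
    refine Finset.sum_congr rfl fun r _ => ?_
    generalize K r = k
    revert k; decide
  have h0 : ∀ K : Fin l → Fin 2, Fintype.card {r // K r = 0} + ones K = l := by
    intro K
    have : ∀ r, K r = 0 ↔ ¬ K r = 1 := fun r => by
      generalize K r = k
      revert k; decide
    rw [h1, Fintype.card_congr (Equiv.subtypeEquivRight this), Fintype.card_subtype_compl]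
    have := Fintype.card_subtype_le fun r => K r = 1
    simp only [Fintype.card_fin] at this ⊢
    omega
  have hc : ∀ c, Fintype.card {r // I r = c} = Fintype.card {r // J r = c} := by
    intro c
    have hc : c = 0 ∨ c = 1 := by revert c; decide
    rcases hc with rfl | rfl
    · have := h0 I; have := h0 J; omega
    · rw [← h1, ← h1, h]
  refine ⟨Equiv.ofFiberEquiv (f := I) (g := J) fun c => Fintype.equivOfCardEq (hc c), ?_⟩
  funext r
  exact Equiv.ofFiberEquiv_map _ r

theorem symProj_mul_self (l : ℕ) : symProj l * symProj l = symProj l := by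
  have h : ∀ π σ : Equiv.Perm (Fin l),
      (Matrix.of fun i j : Fin l → Fin 2 => if i = j ∘ π then (1 : ℂ) else 0) *
        (Matrix.of fun i j => if i = j ∘ σ then (1 : ℂ) else 0) =
      Matrix.of fun i j => if i = j ∘ (σ * π : Equiv.Perm (Fin l)) then (1 : ℂ) else 0 := by
    intro π σ
    ext i k
    rw [Matrix.mul_apply, Finset.sum_eq_single (k ∘ σ)]
    · simp only [Matrix.of_apply, if_true, mul_one, Equiv.Perm.coe_mul, Function.comp_assoc]
      exact if_congr Iff.rfl rfl rfl
    · intro j _ hj; simp [hj]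
    · simp
  have hl : (Nat.factorial l : ℂ) ≠ 0 := by exact_mod_cast Nat.factorial_ne_zero l
  simp only [symProj, smul_mul_smul_comm, Finset.sum_mul_sum, h]
  have : ∀ π : Equiv.Perm (Fin l), ∑ σ : Equiv.Perm (Fin l),
      (Matrix.of fun i j : Fin l → Fin 2 => if i = j ∘ (σ * π : Equiv.Perm (Fin l)) then (1 : ℂ) else 0) =
      ∑ σ : Equiv.Perm (Fin l), Matrix.of fun i j => if i = j ∘ σ then (1 : ℂ) else 0 := by
    intro π
    exact Equiv.sum_comp (Equiv.mulRight π) fun σ : Equiv.Perm (Fin l) =>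
      (Matrix.of fun i j : Fin l → Fin 2 => if i = j ∘ σ then (1 : ℂ) else 0)
  rw [Finset.sum_congr rfl fun π _ => this π, Finset.sum_const, Finset.card_univ,
    Fintype.card_perm, Fintype.card_fin, ← Nat.cast_smul_eq_nsmul ℂ, smul_smul]
  congr 1
  field_simp

/-- Over a noncommutative ring the trace is not cyclic, but the entries of the projector are central
scalars, so one of the two projectors can be absorbed into the other. -/
theorem trace_symProj_conj [Algebra ℂ R] (l : ℕ) (Y : Matrix (Fin l → Fin 2) (Fin l → Fin 2) R) :
    ((symProj l).map (algebraMap ℂ R) * Y * (symProj l).map (algebraMap ℂ R)).trace =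
      ((Nat.factorial l : ℂ))⁻¹ • ∑ I : Fin l → Fin 2, ∑ π : Equiv.Perm (Fin l), Y (I ∘ π) I := by
  have h1 : ((symProj l).map (algebraMap ℂ R) * Y * (symProj l).map (algebraMap ℂ R)).trace =
      ((symProj l).map (algebraMap ℂ R) * Y).trace := by
    have : ((symProj l).map (algebraMap ℂ R) * ((symProj l).map (algebraMap ℂ R) * Y)).trace =
        ((symProj l).map (algebraMap ℂ R) * Y).trace := by
      rw [← mul_assoc, ← Matrix.map_mul, symProj_mul_self]
    rw [← this]
    simp only [Matrix.trace, Matrix.diag_apply]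
    simp only [Matrix.mul_apply (M := (symProj l).map (algebraMap ℂ R) * Y),
      Matrix.mul_apply (M := (symProj l).map (algebraMap ℂ R))
      (N := (symProj l).map (algebraMap ℂ R) * Y)]
    rw [Finset.sum_comm]
    refine Finset.sum_congr rfl fun I _ => Finset.sum_congr rfl fun J _ => ?_
    simp only [Matrix.map_apply]
    exact (Algebra.commutes _ _).symm
  rw [h1]
  simp only [Matrix.trace, Matrix.diag_apply, Matrix.mul_apply, Matrix.map_apply, symProj,
    Matrix.smul_apply, Matrix.sum_apply, Matrix.of_apply, smul_eq_mul, ← Algebra.smul_def,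
    mul_smul, ← Finset.smul_sum]
  congr 1
  simp only [Finset.sum_smul, ite_smul, one_smul, zero_smul]
  -- Substituting π⁻¹ for π moves the permutation from the column to the row index.
  have h2 : ∀ J I : Fin l → Fin 2, (∑ π : Equiv.Perm (Fin l), if J = I ∘ π then Y I J else 0) =
      ∑ π : Equiv.Perm (Fin l), if I = J ∘ π then Y I J else 0 := by
    intro J I
    rw [← Equiv.sum_comp (Equiv.inv (Equiv.Perm (Fin l)))]
    refine Finset.sum_congr rfl fun π _ => if_congr ?_ rfl rfl
    rw [Equiv.inv_apply]
    constructor <;> rintro rfl <;> funext r <;> simp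
  rw [Finset.sum_congr rfl fun J _ => Finset.sum_congr rfl fun I _ => h2 J I]
  refine Finset.sum_congr rfl fun J _ => ?_
  rw [Finset.sum_comm]
  refine Finset.sum_congr rfl fun π _ => ?_
  simp

theorem exists_ones_eq {l c : ℕ} (hc : c ≤ l) : ∃ I : Fin l → Fin 2, ones I = c := by
  refine ⟨fun r => if (r : ℕ) < c then 1 else 0, ?_⟩
  simp only [ones, apply_ite Fin.val, Fin.val_one, Fin.val_zero, Finset.sum_boole, Nat.cast_id]
  rw [← Fintype.card_subtype, Fintype.card_congr (Fin.castLEquiv hc).symm]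
  simp

/-- Permutations act transitively on multi-indices with a given number of ones, so the average over
permutations is the uniform average over this class. Summing the diagonal over the class cancels its
size and leaves one `g c` for each weight c. -/
theorem sum_perm_tens (l : ℕ) (Y : Matrix (Fin l → Fin 2) (Fin l → Fin 2) R) (g : ℕ → R)
    (hY : ∀ J, ∑ I with ones I = ones J, Y I J = g (ones J)) [Algebra ℂ R] :
    ((Nat.factorial l : ℂ))⁻¹ • ∑ I : Fin l → Fin 2, ∑ π : Equiv.Perm (Fin l), Y (I ∘ π) I =
      ∑ c ∈ Finset.range (l + 1), g c := by
  have hl : (Nat.factorial l : ℂ) ≠ 0 := by exact_mod_cast Nat.factorial_ne_zero l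
  let Z : (Fin l → Fin 2) → (Fin l → Fin 2) → R := fun J I => ∑ π : Equiv.Perm (Fin l), Y (J ∘ π) I
  have hZ : ∀ J J' I, ones J = ones J' → Z J I = Z J' I := by
    intro J J' I h
    obtain ⟨σ, rfl⟩ := exists_perm_of_ones_eq h
    exact Equiv.sum_comp (Equiv.mulLeft σ) fun π : Equiv.Perm (Fin l) => Y (J' ∘ π) I
  have hsum : ∀ I, ∑ J with ones J = ones I, Z J I = (Nat.factorial l : ℂ) • g (ones I) := by
    intro I
    simp only [Z]
    rw [Finset.sum_comm]
    have : ∀ π : Equiv.Perm (Fin l), ∑ J with ones J = ones I, Y (J ∘ π) I = g (ones I) := by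
      intro π
      rw [← hY, Finset.sum_filter, Finset.sum_filter]
      have := Equiv.sum_comp (Equiv.arrowCongr π.symm (Equiv.refl (Fin 2)))
        fun J : Fin l → Fin 2 => if ones J = ones I then Y J I else 0
      rw [← this]
      refine Finset.sum_congr rfl fun J _ => ?_
      have e : (Equiv.arrowCongr π.symm (Equiv.refl (Fin 2))) J = J ∘ π := rfl
      rw [e, ones_comp]
    rw [Finset.sum_congr rfl fun π _ => this π, Finset.sum_const, Finset.card_univ,
      Fintype.card_perm, Fintype.card_fin, ← Nat.cast_smul_eq_nsmul ℂ]
  have hcard : ∀ I, ((Finset.univ.filter fun J : Fin l → Fin 2 => ones J = ones I).card : ℂ) • Z I I =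
      (Nat.factorial l : ℂ) • g (ones I) := by
    intro I
    rw [← hsum, Finset.sum_congr rfl fun J hJ => hZ J I I (Finset.mem_filter.mp hJ).2,
      Finset.sum_const, Nat.cast_smul_eq_nsmul ℂ]
  have hfib : ∀ c ∈ Finset.range (l + 1), ∑ I : Fin l → Fin 2 with ones I = c, Z I I =
      (Nat.factorial l : ℂ) • g c := by
    intro c hc
    obtain ⟨I₀, rfl⟩ := exists_ones_eq (l := l) (c := c) (by simpa [Nat.lt_succ_iff] using hc)
    have h0 : ((Finset.univ.filter fun J : Fin l → Fin 2 => ones J = ones I₀).card : ℂ) ≠ 0 := by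
      have : 0 < (Finset.univ.filter fun J : Fin l → Fin 2 => ones J = ones I₀).card :=
        Finset.card_pos.mpr ⟨I₀, by simp⟩
      exact_mod_cast this.ne'
    apply smul_right_injective R h0
    simp only
    rw [Finset.smul_sum]
    have : ∀ I ∈ Finset.univ.filter (fun J : Fin l → Fin 2 => ones J = ones I₀),
        ((Finset.univ.filter fun J : Fin l → Fin 2 => ones J = ones I₀).card : ℂ) • Z I I =
        (Nat.factorial l : ℂ) • g (ones I₀) := by
      intro I hI
      have hI := (Finset.mem_filter.mp hI).2
      rw [← hI, hcard]
    rw [Finset.sum_congr rfl this, Finset.sum_const, ← Nat.cast_smul_eq_nsmul ℂ]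
  rw [inv_smul_eq_iff₀ hl, Finset.smul_sum, ← Finset.sum_congr rfl hfib]
  exact (Finset.sum_fiberwise_of_maps_to (fun I _ => by
    simpa [Nat.lt_succ_iff] using ones_le I) _).symm

end TensorProducts

/-! ### Fusion recursion for the transfer matrices. -/

section FusedTransfer

variable {N : ℕ} (η : ℂ) (m : Fin N → ℕ) (ξ : Fin N → ℂ)

theorem fusedTransfer_eq (hη : η ≠ 0) (K : Matrix (Fin 2) (Fin 2) ℂ) (l : ℕ) (y : ℂ) :
    fusedTransfer η m ξ K l y = fusedTr η y (monodromy η m ξ K) l := by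
  have h := (RTT_monodromy η m ξ K).fusable hη
  rw [fusedTransfer, fusedMonodromy, trace_symProj_conj]
  refine sum_perm_tens l _ (fun c => (fusedCol η y (monodromy η m ξ K) l c).coeff c) fun J => ?_
  rw [← h.sum_tens]
  exact Finset.sum_congr rfl fun I _ => tens_eq_prod_embed _ I J

theorem fusedTransfer_zero (hη : η ≠ 0) (K : Matrix (Fin 2) (Fin 2) ℂ) (y : ℂ) :
    fusedTransfer η m ξ K 0 y = 1 := by
  rw [fusedTransfer_eq η m ξ hη, fusedTr_zero]

theorem fusedTransfer_one (hη : η ≠ 0) (K : Matrix (Fin 2) (Fin 2) ℂ) (y : ℂ) :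
    fusedTransfer η m ξ K 1 y = transfer η m ξ K y := by
  rw [fusedTransfer_eq η m ξ hη, fusedTr, Finset.sum_range_succ, Finset.sum_range_one]
  simp [fusedCol, colPoly, transfer, Matrix.trace_fin_two, coeff_C]

theorem fusedTransfer_rec (hη : η ≠ 0) (K : Matrix (Fin 2) (Fin 2) ℂ) (l : ℕ) (y : ℂ) :
    fusedTransfer η m ξ K (l + 2) y =
      transfer η m ξ K (y + (l + 1 : ℕ) * η) * fusedTransfer η m ξ K (l + 1) y -
      (K.det * (aFun η m ξ (y + (l + 1 : ℕ) * η) * dFun η m ξ (y + (l : ℕ) * η))) •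
        fusedTransfer η m ξ K l y := by
  have h := (RTT_monodromy η m ξ K).fusable hη
  rw [fusedTransfer_eq η m ξ hη, fusedTransfer_eq η m ξ hη, fusedTransfer_eq η m ξ hη, h.fusedTr_rec]
  have e : y + (l : ℂ) * η = y + ((l + 1 : ℕ) : ℂ) * η - η := by push_cast; ring
  have := qdet_eq η m ξ hη K (y + ((l + 1 : ℕ) : ℂ) * η)
  rw [e]
  change qd η (monodromy η m ξ K) _ = _ at this
  rw [this, smul_mul_assoc, one_mul]
  rfl

end FusedTransfer

/-! ### Termination of the fusion hierarchy at a site of finite spin. -/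

section Vanishing

/-- The lowering operator of the boson `i` from `ℂ^(M+1)` to `ℂ^M`. -/
def low (M : ℕ) (i : Fin 2) : Matrix (Fin M) (Fin (M + 1)) ℂ :=
  Matrix.of fun a b => if (b : ℕ) = a + i then
    (if i = 0 then ((Real.sqrt ((M : ℝ) - ((a : ℕ) : ℝ)) : ℝ) : ℂ)
      else ((Real.sqrt (((a : ℕ) : ℝ) + 1) : ℝ) : ℂ)) else 0

theorem ofReal_sqrt_mul_self {x : ℝ} (hx : 0 ≤ x) :
    ((Real.sqrt x : ℝ) : ℂ) * ((Real.sqrt x : ℝ) : ℂ) = (x : ℂ) := by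
  rw [← Complex.ofReal_mul, Real.mul_self_sqrt hx]

/-- Schwinger's realisation: ℂ^(M+1) is the space of states with M bosons of two kinds, the basis
vector a having a bosons of kind 1. Up to a scalar, the entries of the Lax operator annihilate one
boson and create another. -/
theorem low_transpose_mul_low (M : ℕ) (i j : Fin 2) :
    (low M j).transpose * low M i =
      laxE M i j + (if i = j then ((M : ℂ) / 2 - 1 / 2) else 0) • 1 := by
  ext a b
  have ha : ((a : ℕ) : ℝ) ≤ M := by exact_mod_cast Nat.lt_succ_iff.mp a.2
  rw [Matrix.mul_apply]
  simp only [Matrix.transpose_apply]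
  have hab : a = b ↔ (a : ℕ) = b := Fin.ext_iff
  have hj : j = 0 ∨ j = 1 := by revert j; decide
  have hi : i = 0 ∨ i = 1 := by revert i; decide
  rcases hj with rfl | rfl
  · by_cases h : (a : ℕ) < M
    · rw [Finset.sum_eq_single (⟨a, h⟩ : Fin M)]
      · rcases hi with rfl | rfl
        · by_cases hb : (a : ℕ) = b
          · obtain rfl : a = b := Fin.ext hb
            simp [low, laxE, Sz]
            rw [ofReal_sqrt_mul_self (by linarith)]
            push_cast; ring
          · have hb' : ¬ (b : ℕ) = a := fun h => hb h.symm
            simp [low, laxE, Sz, hab, hb, hb']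
        · by_cases hb : (b : ℕ) = a + 1
          · simp [low, laxE, Sp, hb]
            rw [mul_comm]
          · have hb' : ¬ (a : ℕ) + 1 = b := fun h => hb h.symm
            simp [low, laxE, Sp, hb, hb']
      · intro k _ hk
        have : ¬ (a : ℕ) = k := fun h => hk (Fin.ext h.symm)
        simp [low, this]
      · simp
    · have hM : (a : ℕ) = M := by omega
      rw [Finset.sum_eq_zero]
      · rcases hi with rfl | rfl
        · by_cases hb : (a : ℕ) = b
          · obtain rfl : a = b := Fin.ext hb
            simp [laxE, Sz, hM]
            ring
          · simp [laxE, Sz, hab, hb]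
        · have hb : ¬ (a : ℕ) + 1 = b := by omega
          simp [laxE, Sp, hb]
      · intro k _
        have : ¬ (a : ℕ) = k := by omega
        simp [low, this]
  · by_cases h : 0 < (a : ℕ)
    · have ha1 : (a : ℕ) - 1 + 1 = a := by omega
      have hc : (((a : ℕ) - 1 : ℕ) : ℝ) = (a : ℕ) - 1 := by
        rw [Nat.cast_sub h]; simp
      rw [Finset.sum_eq_single (⟨a - 1, by omega⟩ : Fin M)]
      · rcases hi with rfl | rfl
        · by_cases hb : (b : ℕ) + 1 = a
          · have hb' : (b : ℕ) = a - 1 := by omega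
            simp [low, laxE, Sm, Sp, hb', ha1, hc]
            left; congr 1; ring
          · have hb' : ¬ (b : ℕ) = a - 1 := by omega
            simp [low, laxE, Sm, Sp, hb, hb']
        · by_cases hb : (a : ℕ) = b
          · obtain rfl : a = b := Fin.ext hb
            simp [low, laxE, Sz, ha1, hc]
            rw [ofReal_sqrt_mul_self (by positivity)]
            push_cast; ring
          · have hb' : ¬ (b : ℕ) = a := fun h => hb h.symm
            simp [low, laxE, Sz, hab, hb, hb', ha1]
      · intro k _ hk
        have : ¬ (a : ℕ) = k + 1 := fun h => hk (Fin.ext (by simp [h]))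
        simp [low, this]
      · simp
    · have hM : (a : ℕ) = 0 := by omega
      rw [Finset.sum_eq_zero]
      · rcases hi with rfl | rfl
        · have hb : ¬ (b : ℕ) + 1 = a := by omega
          simp [laxE, Sm, Sp, hb]
        · by_cases hb : (a : ℕ) = b
          · obtain rfl : a = b := Fin.ext hb
            simp [laxE, Sz, hM]
          · simp [laxE, Sz, hab, hb]
      · intro k _
        have : ¬ (a : ℕ) = k + 1 := by omega
        simp [low, this]

theorem low_mul_low_transpose (M : ℕ) (i j : Fin 2) :
    low (M + 1) i * (low (M + 1) j).transpose =
      laxE M i j + (if i = j then ((M : ℂ) / 2 + 1 / 2) else 0) • 1 := by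
  ext a b
  have ha : ((a : ℕ) : ℝ) ≤ M := by exact_mod_cast Nat.lt_succ_iff.mp a.2
  have hb0 : ((b : ℕ) : ℝ) ≤ M := by exact_mod_cast Nat.lt_succ_iff.mp b.2
  rw [Matrix.mul_apply]
  simp only [Matrix.transpose_apply]
  have hab : a = b ↔ (a : ℕ) = b := Fin.ext_iff
  have hj : j = 0 ∨ j = 1 := by revert j; decide
  have hi : i = 0 ∨ i = 1 := by revert i; decide
  rcases hi with rfl | rfl
  · rw [Finset.sum_eq_single (⟨a, by omega⟩ : Fin (M + 1 + 1))]
    · rcases hj with rfl | rfl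
      · by_cases hb : (a : ℕ) = b
        · obtain rfl : a = b := Fin.ext hb
          simp [low, laxE, Sz]
          rw [ofReal_sqrt_mul_self (by linarith)]
          push_cast; ring
        · simp [low, laxE, Sz, hab, hb]
      · by_cases hb : (a : ℕ) = b + 1
        · simp [low, laxE, Sm, Sp, hb]
          rw [mul_comm]
        · have hb' : ¬ (b : ℕ) + 1 = a := fun h => hb h.symm
          simp [low, laxE, Sm, Sp, hb, hb']
    · intro k _ hk
      have : ¬ (k : ℕ) = a := fun h => hk (Fin.ext h)
      simp [low, this]
    · simp
  · rw [Finset.sum_eq_single (⟨a + 1, by omega⟩ : Fin (M + 1 + 1))]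
    · rcases hj with rfl | rfl
      · by_cases hb : (a : ℕ) + 1 = b
        · simp [low, laxE, Sp, hb]
          left
          rw [← hb]; push_cast; rfl
        · simp [low, laxE, Sp, hb]
      · by_cases hb : (a : ℕ) = b
        · obtain rfl : a = b := Fin.ext hb
          simp [low, laxE, Sz]
          rw [ofReal_sqrt_mul_self (by positivity)]
          push_cast; ring
        · simp [low, laxE, Sz, hab, hb]
    · intro k _ hk
      have : ¬ (k : ℕ) = a + 1 := fun h => hk (Fin.ext h)
      simp [low, this]
    · simp

/-- The lowering operator in the direction `w`. -/
def lowDir (w : Fin 2 → ℂ) (M : ℕ) : Matrix (Fin M) (Fin (M + 1)) ℂ := ∑ i, w i • low M i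

/-- The `r`-th factor of the fused Lax operator contracted with `w`. -/
def fusedFactor (w : Fin 2 → ℂ) (M r : ℕ) (j : Fin 2) : Matrix (Fin (M + 1)) (Fin (M + 1)) ℂ :=
  (low M j).transpose * lowDir w M - ((r : ℂ) * w j) • 1

/-- The canonical commutation relation: moving an annihilator past a creator produces w_j, which
lowers the subtracted multiple from `r + 1` to `r`. -/
theorem lowDir_mul_fusedFactor (w : Fin 2 → ℂ) (M r : ℕ) (j : Fin 2) :
    lowDir w (M + 1) * fusedFactor w (M + 1) (r + 1) j =
      fusedFactor w M r j * lowDir w (M + 1) := by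
  have h : lowDir w (M + 1) * (low (M + 1) j).transpose =
      (low M j).transpose * lowDir w M + w j • 1 := by
    simp only [lowDir,
      Matrix.smul_mul, Matrix.mul_smul, Matrix.sum_mul, Matrix.mul_sum, low_mul_low_transpose,
      low_transpose_mul_low]
    have hj : j = 0 ∨ j = 1 := by revert j; decide
    rcases hj with rfl | rfl <;> simp [Fin.sum_univ_two] <;> module
  simp only [fusedFactor]
  rw [Matrix.mul_sub, ← Matrix.mul_assoc, h, Matrix.add_mul, Matrix.sub_mul, Matrix.mul_smul,
    Matrix.smul_mul, Matrix.smul_mul, Matrix.mul_one, Matrix.one_mul]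
  push_cast
  module

theorem mul_prod_ofFn_of_intertwine {p q : Type*} [Fintype p] [Fintype q] [DecidableEq p]
    [DecidableEq q] (A : Matrix p q ℂ) {l : ℕ} (Y : Fin l → Matrix q q ℂ) (Z : Fin l → Matrix p p ℂ)
    (h : ∀ r, A * Y r = Z r * A) : A * (List.ofFn Y).prod = (List.ofFn Z).prod * A := by
  induction l with
  | zero => simp
  | succ l ih =>
    rw [List.ofFn_succ, List.ofFn_succ, List.prod_cons, List.prod_cons, ← Matrix.mul_assoc, h,
      Matrix.mul_assoc, ih _ _ fun r => h r.succ, Matrix.mul_assoc]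

/-- The subtracted multiples of w_j are the normal-ordering corrections: the product consists of M +
1 creators followed by M + 1 annihilators, and only M bosons are available. -/
theorem prod_fusedFactor (w : Fin 2 → ℂ) (M : ℕ) (J : Fin (M + 1) → Fin 2) :
    (List.ofFn fun r : Fin (M + 1) => fusedFactor w M r (J r)).prod = 0 := by
  induction M with
  | zero =>
    have : lowDir w 0 = 0 := by ext a b; exact a.elim0
    simp [fusedFactor, this]
  | succ M ih =>
    rw [List.ofFn_succ, List.prod_cons]
    have h0 : fusedFactor w (M + 1) ((0 : Fin (M + 1 + 1)) : ℕ) (J 0) =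
        (low (M + 1) (J 0)).transpose * lowDir w (M + 1) := by
      simp [fusedFactor]
    rw [h0, Matrix.mul_assoc, mul_prod_ofFn_of_intertwine (lowDir w (M + 1))
      (fun r : Fin (M + 1) => fusedFactor w (M + 1) (r.succ : ℕ) (J r.succ))
      (fun r : Fin (M + 1) => fusedFactor w M r (J r.succ)), ih, Matrix.zero_mul, Matrix.mul_zero]
    intro r
    rw [Fin.val_succ]
    exact lowDir_mul_fusedFactor w M r _

/-- At this spectral parameter the scalar part of the Lax operator is precisely the normal-ordering
correction of the `r`-th factor. -/
theorem smul_fusedFactor (η : ℂ) (M r : ℕ) (w : ℂ) (j : Fin 2) (x : ℂ)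
    (hx : x = -(η / 2) - (M : ℂ) / 2 * η + ((M : ℂ) - r) * η) :
    lax η M x 0 j + w • lax η M x 1 j = η • fusedFactor ![1, w] M r j := by
  simp only [fusedFactor, lowDir, Matrix.mul_add, Matrix.mul_smul, low_transpose_mul_low, lax_eq,
    Fin.sum_univ_two, hx]
  have hj : j = 0 ∨ j = 1 := by revert j; decide
  rcases hj with rfl | rfl <;> simp <;> module

/-- Contracting every row index with (1, w) gives zero for all w, and the coefficient of w^c is the
sum over the rows with c ones. -/
theorem sum_tens_lax (η : ℂ) (M : ℕ) (Q : Fin (M + 1) → Fin 2) (c : ℕ) :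
    ∑ P with ones P = c, tens (fun r : Fin (M + 1) =>
      lax η M (-(η / 2) - (M : ℂ) / 2 * η + ((M : ℂ) - ((r : ℕ) : ℂ)) * η)) P Q = 0 := by
  set L : Fin (M + 1) → Matrix (Fin 2) (Fin 2) (Matrix (Fin (M + 1)) (Fin (M + 1)) ℂ) :=
    fun r => lax η M (-(η / 2) - (M : ℂ) / 2 * η + ((M : ℂ) - ((r : ℕ) : ℂ)) * η) with hL
  have key := matrix_coeff_eq_zero Set.univ Set.infinite_univ (M + 2)
    (fun c => ∑ P with ones P = c, tens L P Q) (by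
      intro w _
      have h1 := prod_linear_eq_sum (w := algebraMap ℂ (Matrix (Fin (M + 1)) (Fin (M + 1)) ℂ) w)
        (fun x => Algebra.commutes w x) (fun (r : Fin (M + 1)) i => L r i (Q r))
      have h2 : (List.ofFn fun r : Fin (M + 1) => L r 0 (Q r) +
          algebraMap ℂ (Matrix (Fin (M + 1)) (Fin (M + 1)) ℂ) w * L r 1 (Q r)) =
          (List.ofFn fun r : Fin (M + 1) => fusedFactor ![1, w] M r (Q r)).map fun X => η • X := by
        rw [List.map_ofFn]
        congr 1
        funext r
        rw [← Algebra.smul_def]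
        exact smul_fusedFactor η M r w (Q r) _ rfl
      have h3 : ∀ l : List (Matrix (Fin (M + 1)) (Fin (M + 1)) ℂ),
          (l.map fun X => η • X).prod = η ^ l.length • l.prod := by
        intro l
        induction l with
        | nil => simp
        | cons X l ih =>
          simp only [List.map_cons, List.prod_cons, ih, List.length_cons, pow_succ',
            smul_mul_smul_comm]
      rw [h2, h3, prod_fusedFactor, smul_zero] at h1
      rw [h1, ← Finset.sum_fiberwise_of_maps_to (s := Finset.univ) (t := Finset.range (M + 2))
        (g := ones) (fun P _ => by simpa [Nat.lt_succ_iff] using ones_le P)]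
      refine Finset.sum_congr rfl fun c _ => ?_
      rw [Finset.smul_sum]
      refine Finset.sum_congr rfl fun P hP => ?_
      rw [(Finset.mem_filter.mp hP).2, ← map_pow, ← Algebra.smul_def]
      rfl)
  by_cases hc : c < M + 2
  · exact key c hc
  · refine Finset.sum_eq_zero fun P hP => ?_
    have := ones_le P
    have := (Finset.mem_filter.mp hP).2
    omega

variable {N : ℕ} (η : ℂ) (m : Fin N → ℕ) (ξ : Fin N → ℂ)

theorem sum_tens_siteLax (a : Fin N) (Q : Fin (m a + 1) → Fin 2) (c : ℕ) :
    ∑ P with ones P = c, tens (fun r : Fin (m a + 1) => siteLax η m ξ a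
      (pt η m ξ a (m a) + (((m a + 1 : ℕ) : ℂ) - 1 - ((r : ℕ) : ℂ)) * η)) P Q = 0 := by
  have h := congrArg (embedHom (κ := fun n => Fin (m n + 1)) a) (sum_tens_lax η (m a) Q c)
  rw [map_sum, map_zero] at h
  rw [← h]
  refine Finset.sum_congr rfl fun P _ => ?_
  rw [tens, tens, map_list_prod, List.map_ofFn]
  congr 2
  funext r
  simp only [siteLax, Matrix.map_apply, Function.comp_apply, embedHom_apply, pt]
  congr 3
  push_cast
  ring

/-- Row symmetrisation passes through the factors to the left of the site a and reaches its Lax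
operators, where `sum_tens_siteLax` annihilates it. -/
theorem fusedTransfer_eq_zero (hη : η ≠ 0) (K : Matrix (Fin 2) (Fin 2) ℂ) (a : Fin N) :
    fusedTransfer η m ξ K (m a + 1) (pt η m ξ a (m a)) = 0 := by
  rw [fusedTransfer_eq η m ξ hη, fusedTr]
  refine Finset.sum_eq_zero fun c hc => ?_
  obtain ⟨J, hJ⟩ := exists_ones_eq (l := m a + 1) (c := c)
    (by simpa [Nat.lt_succ_iff] using hc)
  rw [← hJ, ← ((RTT_monodromy η m ξ K).fusable hη).sum_tens]
  obtain ⟨L₁, L₂, hL⟩ := List.append_of_mem (List.mem_reverse.mpr (List.mem_finRange a))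
  have hnd : (L₁ ++ a :: L₂).Nodup := hL ▸ nodup_sites
  have hnd' := List.nodup_append.mp hnd
  have hnd2 := List.nodup_cons.mp hnd'.2.1
  have ha1 : a ∉ L₁ := fun h => hnd'.2.2 a h a (by simp) rfl
  set y := pt η m ξ a (m a)
  set A : ℂ → Matrix (Fin 2) (Fin 2) (Op m) :=
    fun x => K.map (algebraMap ℂ (Op m)) * siteProd η m ξ L₁ x with hA
  have hfus : Fusable η A := (RTT_gauge_mul η m ξ K L₁ hnd'.1).fusable hη
  have hM : ∀ x, monodromy η m ξ K x = A x * (siteLax η m ξ a x * siteProd η m ξ L₂ x) := by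
    intro x
    rw [monodromy_eq, hL, siteProd_append, siteProd_cons, ← Matrix.mul_assoc]
  have hcommA : ∀ (Z : Op m), (∀ x i j, Commute (siteProd η m ξ L₁ x i j) Z) →
      ∀ x i j, Commute (A x i j) Z := by
    intro Z hZ x i j
    rw [hA]
    simp only [Matrix.mul_apply]
    exact Commute.sum_left _ _ _ fun k _ => (map_algebraMap_commute m K _ _ _).mul_left (hZ x k j)
  have hc1 : ∀ x y i j k l, Commute (A x i j) ((siteLax η m ξ a y * siteProd η m ξ L₂ y) k l) := by
    intro x y i j k l
    rw [← siteProd_cons]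
    refine hcommA _ (fun x i j => ?_) x i j
    exact siteProd_commute η m ξ (fun n hn hn' => hnd'.2.2 n hn n hn' rfl) _ _ _ _ _ _
  have hc2 : ∀ x y i j k l, Commute (siteLax η m ξ a x i j) (siteProd η m ξ L₂ y k l) := by
    intro x y i j k l
    refine siteProd_commute_of η m ξ L₂ (fun n' hn' y k l => ?_) y k l
    refine siteLax_commute η m ξ ?_ _ _ _ _ _ _
    rintro rfl
    exact hnd2.1 hn'
  simp only [hM]
  have e1 := fun I => tens_mul
    (fun r : Fin (m a + 1) => A (y + (((m a + 1 : ℕ) : ℂ) - 1 - ((r : ℕ) : ℂ)) * η))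
    (fun r : Fin (m a + 1) => siteLax η m ξ a (y + (((m a + 1 : ℕ) : ℂ) - 1 - ((r : ℕ) : ℂ)) * η) *
      siteProd η m ξ L₂ (y + (((m a + 1 : ℕ) : ℂ) - 1 - ((r : ℕ) : ℂ)) * η))
    (fun _ _ => hc1 _ _) I J
  have e2 := fun P => tens_mul
    (fun r : Fin (m a + 1) => siteLax η m ξ a (y + (((m a + 1 : ℕ) : ℂ) - 1 - ((r : ℕ) : ℂ)) * η))
    (fun r : Fin (m a + 1) => siteProd η m ξ L₂ (y + (((m a + 1 : ℕ) : ℂ) - 1 - ((r : ℕ) : ℂ)) * η))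
    (fun _ _ => hc2 _ _) P J
  simp only [e1, e2]
  rw [Finset.sum_comm]
  -- The row-symmetrised product of the `A`-factors depends on the intermediate index P only through
  -- `ones P`, so the local Lax operators are summed over classes of constant weight.
  simp only [← Finset.sum_mul, hfus.sum_tens y (m a + 1)]
  simp only [Finset.mul_sum]
  rw [Finset.sum_comm]
  refine Finset.sum_eq_zero fun Q _ => ?_
  simp only [← mul_assoc, ← Finset.sum_mul]
  rw [← Finset.sum_fiberwise_of_maps_to (s := Finset.univ) (t := Finset.range (m a + 2))
    (g := ones) (fun P _ => by simpa [Nat.lt_succ_iff] using ones_le P)]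
  rw [Finset.sum_eq_zero, zero_mul]
  intro c' _
  have := sum_tens_siteLax η m ξ a Q c'
  rw [Finset.sum_congr rfl fun P hP => by rw [(Finset.mem_filter.mp hP).2], ← Finset.mul_sum]
  exact (congrArg _ this).trans (mul_zero _)

end Vanishing

/-! ### The operators Q_a^{(h)} solve the discrete equation. -/

section Coefficients

variable {N : ℕ} (η : ℂ) (m : Fin N → ℕ) (ξ : Fin N → ℂ)

theorem aFun_eq (x : ℂ) : aFun η m ξ x = ∏ n, (x - pt η m ξ n (m n)) :=
  Finset.prod_congr rfl fun n _ => by rw [pt]; ring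

theorem dFun_eq (x : ℂ) : dFun η m ξ x = ∏ n, (x - pt η m ξ n 0) :=
  Finset.prod_congr rfl fun n _ => by rw [pt]; push_cast; ring

theorem pt_sub (a : Fin N) (h : ℕ) : pt η m ξ a h - η = pt η m ξ a (h + 1) := by
  simp only [pt]; push_cast; ring

theorem pt_add (a : Fin N) (h : ℕ) : pt η m ξ a (h + 1) + η = pt η m ξ a h := by
  simp only [pt]; push_cast; ring

theorem aFun_pt (a : Fin N) : aFun η m ξ (pt η m ξ a (m a)) = 0 := by
  rw [aFun_eq]; exact Finset.prod_eq_zero (Finset.mem_univ a) (sub_self _)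

theorem dFun_pt (a : Fin N) : dFun η m ξ (pt η m ξ a 0) = 0 := by
  rw [dFun_eq]; exact Finset.prod_eq_zero (Finset.mem_univ a) (sub_self _)

theorem Qcoef_self (hη : η ≠ 0) (K : Matrix (Fin 2) (Fin 2) ℂ) (k₂ : ℂ) (a : Fin N) :
    Qcoef η m ξ K k₂ a (m a) = 1 := by
  simp [Qcoef, fusedTransfer_zero η m ξ hη]

/-- The equation `T(x) Q(x) = k₁ a(x) Q(x - η) + k₂ d(x) Q(x + η)` at the point `ξ_a^{(h)}`. -/
theorem transfer_mul_Qcoef (hη : η ≠ 0) (K : Matrix (Fin 2) (Fin 2) ℂ) {k₁ k₂ : ℂ} (hk : k₂ ≠ 0)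
    (hK : K.det = k₁ * k₂) (a : Fin N) (hm : 0 < m a)
    (hd : ∀ h, 0 < h → h ≤ m a → dFun η m ξ (pt η m ξ a h) ≠ 0) (h : ℕ) (hh : h ≤ m a) :
    transfer η m ξ K (pt η m ξ a h) * Qcoef η m ξ K k₂ a h =
      (k₁ * aFun η m ξ (pt η m ξ a h)) • Qcoef η m ξ K k₂ a (h + 1) +
      (k₂ * dFun η m ξ (pt η m ξ a h)) • Qcoef η m ξ K k₂ a (h - 1) := by
  set y := pt η m ξ a (m a) with hy
  let c : ℕ → ℂ := fun l => (k₂ ^ l * ∏ k ∈ Finset.range l, dFun η m ξ (pt η m ξ a (m a - k)))⁻¹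
  have hQ : ∀ h, Qcoef η m ξ K k₂ a h = c (m a - h) • fusedTransfer η m ξ K (m a - h) y :=
    fun h => rfl
  have hc : ∀ l, l < m a → k₂ * dFun η m ξ (pt η m ξ a (m a - l)) * c (l + 1) = c l := by
    intro l hl
    have h0 := hd (m a - l) (by omega) (by omega)
    simp only [c, Finset.prod_range_succ, pow_succ, mul_inv]
    field_simp
  have hpt : ∀ l, l ≤ m a → y + (l : ℂ) * η = pt η m ξ a (m a - l) := by
    intro l hl
    rw [hy, pt, pt, Nat.cast_sub hl]; ring
  rcases hh.eq_or_lt with rfl | hlt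
  -- At h = 2s_a the term with h + 1 is only a value of truncated subtraction, and its factor
  -- a(ξ_a^{(2s_a)}) vanishes.
  · rw [← hy, hQ, hQ (m a + 1), hQ (m a - 1)]
    have e : m a - (m a - 1) = 1 := by omega
    have := hc 0 hm
    rw [Nat.sub_zero, ← hy, zero_add] at this
    rw [aFun_pt, mul_zero, zero_smul, zero_add, e, smul_smul, this, Nat.sub_self,
      fusedTransfer_zero η m ξ hη, fusedTransfer_one η m ξ hη, mul_smul_comm, mul_one]
  · obtain ⟨l, hl⟩ : ∃ l, m a - h = l + 1 := ⟨m a - h - 1, by omega⟩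
    have hl1 : m a - (l + 1) = h := by omega
    have hrec := fusedTransfer_rec η m ξ hη K l y
    rw [hpt _ (by omega), hpt _ (by omega), hl1, show m a - l = h + 1 by omega] at hrec
    have e1 : m a - (h + 1) = l := by omega
    have hcl := hc l (by omega)
    rw [show m a - l = h + 1 by omega] at hcl
    have hT : transfer η m ξ K (pt η m ξ a h) * fusedTransfer η m ξ K (l + 1) y =
        fusedTransfer η m ξ K (l + 2) y +
        (K.det * (aFun η m ξ (pt η m ξ a h) * dFun η m ξ (pt η m ξ a (h + 1)))) •
          fusedTransfer η m ξ K l y := by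
      rw [hrec]; abel
    rw [hQ, hQ (h + 1), hl, e1, mul_smul_comm, hT, smul_add, add_comm, smul_smul, smul_smul]
    congr 1
    · rw [hK, ← hcl]; congr 1; ring
    -- At h = 0 the index `h - 1` is truncated to 0, harmlessly since d(ξ_a^{(0)}) = 0; the
    -- recursion closes because the fused transfer matrix of order 2s_a + 1 is zero.
    · rcases Nat.eq_zero_or_pos h with rfl | hpos
      · have : l + 2 = m a + 1 := by omega
        rw [dFun_pt, this, hy, fusedTransfer_eq_zero η m ξ hη]
        simp
      · have e2 : m a - (h - 1) = l + 2 := by omega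
        have hcl1 := hc (l + 1) (by omega)
        rw [hl1] at hcl1
        rw [hQ, e2, smul_smul, hcl1]

end Coefficients

/-! ### GL(2) invariance and reduction to a diagonal twist. -/

section Gauge

theorem Sp_pow_apply (M k : ℕ) (i j : Fin (M + 1)) (h : (i : ℕ) + k ≠ j) : (Sp M ^ k) i j = 0 := by
  induction k generalizing i with
  | zero =>
    have : i ≠ j := fun e => h (by simp [e])
    simp [this]
  | succ k ih =>
    rw [pow_succ', Matrix.mul_apply]
    refine Finset.sum_eq_zero fun r _ => ?_
    by_cases hr : (i : ℕ) + 1 = r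
    · rw [ih r (by omega), mul_zero]
    · simp [Sp, hr]

theorem isNilpotent_Sp (M : ℕ) : IsNilpotent (Sp M) := by
  refine ⟨M + 1, ?_⟩
  ext i j
  exact Sp_pow_apply M _ i j (by omega)

theorem isNilpotent_Sm (M : ℕ) : IsNilpotent (Sm M) := by
  obtain ⟨k, hk⟩ := isNilpotent_Sp M
  exact ⟨k, by rw [Sm, ← Matrix.transpose_pow, hk, Matrix.transpose_zero]⟩

theorem IsNilpotent.commute_exp {A : Type*} [Ring A] [Module ℚ A] {a b : A} (ha : IsNilpotent a)
    (h : Commute a b) [SMulCommClass ℚ A A] [IsScalarTower ℚ A A] :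
    Commute (IsNilpotent.exp a) b := by
  obtain ⟨k, hk⟩ := ha
  rw [IsNilpotent.exp_eq_sum hk]
  exact Commute.sum_left _ _ _ fun i _ => (h.pow_left i).smul_left _

variable {N : ℕ} (η : ℂ) (m : Fin N → ℕ) (ξ : Fin N → ℂ)

/-- The transfer matrices with the twists `K` and `K'` are similar. -/
def SimilarTwists (K K' : Matrix (Fin 2) (Fin 2) ℂ) : Prop :=
  ∃ G G' : Op m, G * G' = 1 ∧ ∀ x, transfer η m ξ K x = G * transfer η m ξ K' x * G'

variable {η m ξ}

theorem SimilarTwists.trans {K K' K'' : Matrix (Fin 2) (Fin 2) ℂ} (h : SimilarTwists η m ξ K K')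
    (h' : SimilarTwists η m ξ K' K'') : SimilarTwists η m ξ K K'' := by
  obtain ⟨G, G', hG, hT⟩ := h
  obtain ⟨H, H', hH, hT'⟩ := h'
  refine ⟨G * H, H' * G', ?_, fun x => ?_⟩
  · rw [mul_assoc, ← mul_assoc H, hH, one_mul, hG]
  · rw [hT, hT']; simp only [mul_assoc]

variable (η m ξ)

theorem trace_mul_map_comm (W : Matrix (Fin 2) (Fin 2) ℂ) (A : Matrix (Fin 2) (Fin 2) (Op m)) :
    (W.map (algebraMap ℂ (Op m)) * A).trace = (A * W.map (algebraMap ℂ (Op m))).trace := by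
  simp only [Matrix.trace, Matrix.diag_apply, Matrix.mul_apply]
  rw [Finset.sum_comm]
  exact Finset.sum_congr rfl fun i _ => Finset.sum_congr rfl fun j _ =>
    (map_algebraMap_commute m W _ _ _).eq

/-- An infinitesimal symmetry X + s of each Lax operator sums to a symmetry of the chain and
exponentiates: conjugating the twist by 1 + X = exp X has the effect of conjugating the quantum
space by the exponential of the total s. Nilpotency makes both exponentials finite sums. -/
theorem similarTwists_of_generator (X : Matrix (Fin 2) (Fin 2) ℂ) (hX : X * X = 0)
    (s : ∀ M : ℕ, Matrix (Fin (M + 1)) (Fin (M + 1)) ℂ) (hs : ∀ M, IsNilpotent (s M))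
    (hc : ∀ M x, Commute (X.map (algebraMap ℂ (Matrix (Fin (M + 1)) (Fin (M + 1)) ℂ)) +
      Matrix.scalar (Fin 2) (s M)) (lax η M x)) (K : Matrix (Fin 2) (Fin 2) ℂ) :
    SimilarTwists η m ξ ((1 + X) * K * (1 - X)) K := by
  let S : Op m := ∑ n, embed n (s (m n))
  let e : ∀ n : Fin N, Matrix (Fin (m n + 1)) (Fin (m n + 1)) ℂ →ₐ[ℂ] Op m :=
    fun n => embedHom (κ := fun n => Fin (m n + 1)) n
  have hlax : ∀ n x, Commute (X.map (algebraMap ℂ (Op m)) + Matrix.scalar (Fin 2) S)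
      (siteLax η m ξ n x) := by
    intro n x
    have h1 := (hc (m n) (x - ξ n)).map (e n).toRingHom.mapMatrix
    have h2 : (e n).toRingHom.mapMatrix
        (X.map (algebraMap ℂ (Matrix (Fin (m n + 1)) (Fin (m n + 1)) ℂ)) +
        Matrix.scalar (Fin 2) (s (m n))) =
        X.map (algebraMap ℂ (Op m)) + Matrix.scalar (Fin 2) (embed n (s (m n)) : Op m) := by
      rw [map_add]
      congr 1
      · ext1 i j
        exact AlgHom.commutes (e n) (X i j)
      · ext1 i j
        simp only [RingHom.mapMatrix_apply, Matrix.map_apply, Matrix.scalar_apply,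
          Matrix.diagonal_apply]
        split_ifs
        · rfl
        · exact map_zero (e n)
    rw [h2] at h1
    have h3 : S = embed n (s (m n)) + ∑ n' ∈ Finset.univ.erase n, embed n' (s (m n')) :=
      (Finset.add_sum_erase _ _ (Finset.mem_univ n)).symm
    rw [h3, map_add, ← add_assoc]
    refine Commute.add_left h1 ?_
    rw [Matrix.scalar_commute_iff]
    ext i j
    have h4 : ∀ n' ∈ Finset.univ.erase n, Commute (embed n' (s (m n')) : Op m)
        (siteLax η m ξ n x i j) := fun n' hn' =>
      embed_mul_embed_comm (Finset.ne_of_mem_erase hn') _ _ fun _ _ _ _ => Commute.all _ _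
    have h5 := Commute.sum_left _ _ _ h4
    exact congrFun (congrFun h5.eq _) _
  have hprod : ∀ L x, Commute (X.map (algebraMap ℂ (Op m)) + Matrix.scalar (Fin 2) S)
      (siteProd η m ξ L x) := by
    intro L x
    refine Commute.list_prod_right _ _ fun Y hY => ?_
    obtain ⟨n, -, rfl⟩ := List.mem_map.mp hY
    exact hlax n x
  have hSnil : IsNilpotent S := by
    refine Commute.isNilpotent_sum (fun n _ => (hs (m n)).map (e n)) fun n n' _ _ => ?_
    by_cases h : n = n'
    · subst h; exact Commute.refl _
    · exact embed_mul_embed_comm h _ _ fun _ _ _ _ => Commute.all _ _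
  have hS'nil : IsNilpotent (Matrix.scalar (Fin 2) S) := hSnil.map (Matrix.scalar (Fin 2))
  have hX2 : X.map (algebraMap ℂ (Op m)) ^ 2 = 0 := by
    rw [pow_two, ← Matrix.map_mul, hX, Matrix.map_zero _ (map_zero _)]
  have hXnil : IsNilpotent (X.map (algebraMap ℂ (Op m))) := ⟨2, hX2⟩
  have hXS : Commute (X.map (algebraMap ℂ (Op m))) (Matrix.scalar (Fin 2) S) := by
    symm
    rw [Matrix.scalar_commute_iff]
    ext1 i j
    exact (map_algebraMap_commute m X S i j).symm.eq
  have hexpX : IsNilpotent.exp (X.map (algebraMap ℂ (Op m))) = (1 + X).map (algebraMap ℂ (Op m)) := by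
    rw [IsNilpotent.exp_eq_sum hX2, Matrix.map_add _ (map_add _),
      Matrix.map_one _ (map_zero _) (map_one _)]
    simp [Finset.sum_range_succ]
  set G := IsNilpotent.exp S with hG
  set G' := IsNilpotent.exp (-S) with hG'
  have hGG : G * G' = 1 := IsNilpotent.exp_mul_exp_neg_self hSnil
  have hexpS : IsNilpotent.exp (Matrix.scalar (Fin 2) S) = Matrix.scalar (Fin 2) G :=
    (IsNilpotent.map_exp hSnil (Matrix.scalar (Fin 2))).symm
  have hcomm : ∀ L x, (1 + X).map (algebraMap ℂ (Op m)) * Matrix.scalar (Fin 2) G *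
      siteProd η m ξ L x = siteProd η m ξ L x *
      ((1 + X).map (algebraMap ℂ (Op m)) * Matrix.scalar (Fin 2) G) := by
    intro L x
    have h := IsNilpotent.commute_exp (hXS.isNilpotent_add hXnil hS'nil) (hprod L x)
    rw [IsNilpotent.exp_add_of_commute hXS hXnil hS'nil, hexpX, hexpS] at h
    exact h
  have hGW : ∀ W : Matrix (Fin 2) (Fin 2) ℂ, Matrix.scalar (Fin 2) G * W.map (algebraMap ℂ (Op m)) =
      W.map (algebraMap ℂ (Op m)) * Matrix.scalar (Fin 2) G := by
    intro W
    have : Commute (Matrix.scalar (Fin 2) G) (W.map (algebraMap ℂ (Op m))) := by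
      rw [Matrix.scalar_commute_iff]
      ext1 i j
      exact (map_algebraMap_commute m W G i j).symm.eq
    exact this.eq
  refine ⟨G, G', hGG, fun x => ?_⟩
  set P := siteProd η m ξ (List.finRange N).reverse x with hP
  have hW : (1 - X).map (algebraMap ℂ (Op m)) * (1 + X).map (algebraMap ℂ (Op m)) = 1 := by
    rw [← Matrix.map_mul, show (1 - X) * (1 + X) = 1 - X * X by noncomm_ring, hX, sub_zero,
      Matrix.map_one _ (map_zero _) (map_one _)]
  have hGG' : Matrix.scalar (Fin 2) G * Matrix.scalar (Fin 2) G' = 1 := by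
    rw [← map_mul, hGG, map_one]
  have key : (1 - X).map (algebraMap ℂ (Op m)) * P * (1 + X).map (algebraMap ℂ (Op m)) =
      Matrix.scalar (Fin 2) G * P * Matrix.scalar (Fin 2) G' := by
    have h := hcomm (List.finRange N).reverse x
    rw [← hP] at h
    calc _ = (1 - X).map (algebraMap ℂ (Op m)) * (P * ((1 + X).map (algebraMap ℂ (Op m)) *
          Matrix.scalar (Fin 2) G)) * Matrix.scalar (Fin 2) G' := by
          simp only [mul_assoc, hGG', mul_one]
      _ = _ := by
          rw [← h]
          simp only [← mul_assoc, hW, one_mul]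
  have hT : ∀ K, transfer η m ξ K x = (K.map (algebraMap ℂ (Op m)) * P).trace := fun K => by
    rw [transfer, monodromy_eq]
  rw [hT, hT, Matrix.map_mul, Matrix.map_mul, mul_assoc, mul_assoc, trace_mul_map_comm, mul_assoc,
    key]
  have hlast : K.map (algebraMap ℂ (Op m)) * (Matrix.scalar (Fin 2) G * P * Matrix.scalar (Fin 2) G') =
      Matrix.scalar (Fin 2) G * (K.map (algebraMap ℂ (Op m)) * P) * Matrix.scalar (Fin 2) G' := by
    rw [mul_assoc, ← mul_assoc (K.map _), ← hGW]
    simp only [mul_assoc]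
  rw [hlast]
  simp only [Matrix.trace, Matrix.diag_apply, Matrix.scalar_apply, Matrix.diagonal_mul,
    Matrix.mul_diagonal, Finset.mul_sum, Finset.sum_mul]

theorem lax_eq_smul (M : ℕ) (x : ℂ) : lax η M x = x • 1 + η • laxE M := by
  ext1 i j
  rw [lax_eq]
  by_cases h : i = j <;> simp [h]

theorem commute_lax_upper (t : ℂ) (M : ℕ) (x : ℂ) :
    Commute ((!![0, t; 0, 0] : Matrix (Fin 2) (Fin 2) ℂ).map
      (algebraMap ℂ (Matrix (Fin (M + 1)) (Fin (M + 1)) ℂ)) + Matrix.scalar (Fin 2) (t • Sp M))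
      (lax η M x) := by
  have h1 := Sp_comm_Sm M
  have h2 := Sz_comm_Sp M
  have h1' : Sp M * Sm M = (2 : ℂ) • Sz M + Sm M * Sp M := by rw [← h1]; abel
  have h2' : Sz M * Sp M = Sp M + Sp M * Sz M := by rw [← sub_eq_iff_eq_add, h2]
  rw [lax_eq_smul]
  refine Commute.add_right (Commute.smul_right (Commute.one_right _) _) (Commute.smul_right ?_ _)
  ext1 i j
  simp only [Matrix.mul_apply, Fin.sum_univ_two]
  fin_cases i <;> fin_cases j <;>
    simp [laxE, Algebra.algebraMap_eq_smul_one, mul_add, add_mul, mul_sub, sub_mul, h1', h2'] <;>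
    module

theorem commute_lax_lower (t : ℂ) (M : ℕ) (x : ℂ) :
    Commute ((!![0, 0; t, 0] : Matrix (Fin 2) (Fin 2) ℂ).map
      (algebraMap ℂ (Matrix (Fin (M + 1)) (Fin (M + 1)) ℂ)) + Matrix.scalar (Fin 2) (t • Sm M))
      (lax η M x) := by
  have h1 := Sp_comm_Sm M
  have h2 := Sz_comm_Sm M
  have h1' : Sp M * Sm M = (2 : ℂ) • Sz M + Sm M * Sp M := by rw [← h1]; abel
  have h2' : Sz M * Sm M = - Sm M + Sm M * Sz M := by rw [← h2]; abel
  rw [lax_eq_smul]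
  refine Commute.add_right (Commute.smul_right (Commute.one_right _) _) (Commute.smul_right ?_ _)
  ext1 i j
  simp only [Matrix.mul_apply, Fin.sum_univ_two]
  fin_cases i <;> fin_cases j <;>
    simp [laxE, Algebra.algebraMap_eq_smul_one, mul_add, add_mul, mul_sub, sub_mul, h1', h2'] <;>
    module

theorem similarTwists_upper (t : ℂ) (K : Matrix (Fin 2) (Fin 2) ℂ) :
    SimilarTwists η m ξ ((1 + !![0, t; 0, 0]) * K * (1 - !![0, t; 0, 0])) K :=
  similarTwists_of_generator η m ξ _ (by ext i j; fin_cases i <;> fin_cases j <;> simp) (fun M => t • Sp M)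
    (fun M => (isNilpotent_Sp M).smul t) (commute_lax_upper η t) K

theorem similarTwists_lower (t : ℂ) (K : Matrix (Fin 2) (Fin 2) ℂ) :
    SimilarTwists η m ξ ((1 + !![0, 0; t, 0]) * K * (1 - !![0, 0; t, 0])) K :=
  similarTwists_of_generator η m ξ _ (by ext i j; fin_cases i <;> fin_cases j <;> simp) (fun M => t • Sm M)
    (fun M => (isNilpotent_Sm M).smul t) (commute_lax_lower η t) K

theorem conj_upper (a b c d t : ℂ) : (1 + !![0, t; 0, 0]) * !![a, b; c, d] * (1 - !![0, t; 0, 0]) =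
    !![a + t * c, b + t * d - t * a - t * t * c; c, d - t * c] := by
  ext i j
  fin_cases i <;> fin_cases j <;>
    simp [Matrix.mul_apply, Fin.sum_univ_two] <;> ring

theorem conj_lower (a b c d t : ℂ) : (1 + !![0, 0; t, 0]) * !![a, b; c, d] * (1 - !![0, 0; t, 0]) =
    !![a - t * b, b; c + t * a - t * d - t * t * b, d + t * b] := by
  ext i j
  fin_cases i <;> fin_cases j <;>
    simp [Matrix.mul_apply, Fin.sum_univ_two] <;> ring

theorem SimilarTwists.symm {K K' : Matrix (Fin 2) (Fin 2) ℂ} (h : SimilarTwists η m ξ K K') :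
    SimilarTwists η m ξ K' K := by
  obtain ⟨G, G', hG, hT⟩ := h
  have hG' : G' * G = 1 := mul_eq_one_comm.mp hG
  refine ⟨G', G, hG', fun x => ?_⟩
  rw [hT]
  simp only [mul_assoc, hG', mul_one]
  rw [← mul_assoc, hG', one_mul]

/-- The upper unipotent is chosen to put k₁ in the first diagonal place; the characteristic equation
then clears the upper right entry, and a lower unipotent clears the other one. -/
theorem similarTwists_diagonal_of_ne_zero {k₁ k₂ : ℂ} (hk : k₁ ≠ k₂) (a b c d : ℂ) (hc : c ≠ 0)
    (htr : a + d = k₁ + k₂) (hdet : a * d - b * c = k₁ * k₂) :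
    SimilarTwists η m ξ !![a, b; c, d] (Matrix.diagonal ![k₁, k₂]) := by
  have h1 := similarTwists_upper η m ξ ((k₁ - a) / c) !![a, b; c, d]
  rw [conj_upper] at h1
  have e1 : a + (k₁ - a) / c * c = k₁ := by field_simp; ring
  have e2 : d - (k₁ - a) / c * c = k₂ := by field_simp; linear_combination htr
  have e3 : b + (k₁ - a) / c * d - (k₁ - a) / c * a - (k₁ - a) / c * ((k₁ - a) / c) * c = 0 := by
    field_simp
    linear_combination (-1 : ℂ) * hdet + k₁ * htr
  rw [e1, e2, e3] at h1
  have h2 := similarTwists_lower η m ξ (c / (k₂ - k₁)) !![k₁, 0; c, k₂]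
  have hk' : k₂ - k₁ ≠ 0 := sub_ne_zero.mpr hk.symm
  have e4 : c + c / (k₂ - k₁) * k₁ - c / (k₂ - k₁) * k₂ - c / (k₂ - k₁) * (c / (k₂ - k₁)) * 0 = 0 := by
    field_simp; ring
  rw [conj_lower, e4] at h2
  have e5 : (!![k₁ - c / (k₂ - k₁) * 0, 0; 0, k₂ + c / (k₂ - k₁) * 0] : Matrix (Fin 2) (Fin 2) ℂ) =
      Matrix.diagonal ![k₁, k₂] := by
    ext i j
    fin_cases i <;> fin_cases j <;> simp
  rw [e5] at h2
  exact (h1.symm η m ξ).trans (h2.symm η m ξ)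

theorem similarTwists_diagonal {k₁ k₂ : ℂ} (hk : k₁ ≠ k₂) (K : Matrix (Fin 2) (Fin 2) ℂ)
    (htr : K.trace = k₁ + k₂) (hdet : K.det = k₁ * k₂) :
    SimilarTwists η m ξ K (Matrix.diagonal ![k₁, k₂]) := by
  obtain ⟨a, b, c, d, rfl⟩ : ∃ a b c d, K = !![a, b; c, d] :=
    ⟨_, _, _, _, Matrix.eta_fin_two K⟩
  rw [Matrix.trace_fin_two_of] at htr
  rw [Matrix.det_fin_two_of] at hdet
  by_cases hc : c = 0
  · subst hc
    -- A lower unipotent makes the lower left entry nonzero; if t = ±1 both failed, the triangular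
    -- matrix would have a = d, a double eigenvalue.
    obtain ⟨t, ht⟩ : ∃ t : ℂ, 0 + t * a - t * d - t * t * b ≠ 0 := by
      by_contra! h
      have h1 := h 1
      have h2 := h (-1)
      have had : a = d := by linear_combination (1 / 2 : ℂ) * h1 - (1 / 2 : ℂ) * h2
      subst had
      apply hk
      have : (k₁ - k₂) ^ 2 = 0 := by
        linear_combination (-(k₁ + k₂) - 2 * a) * htr + 4 * hdet
      exact sub_eq_zero.mp (pow_eq_zero_iff two_ne_zero |>.mp this)
    have h1 := similarTwists_lower η m ξ t !![a, b; 0, d]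
    rw [conj_lower] at h1
    refine (h1.symm η m ξ).trans (similarTwists_diagonal_of_ne_zero η m ξ hk _ _ _ _ ht ?_ ?_)
    · linear_combination htr
    · linear_combination hdet
  · exact similarTwists_diagonal_of_ne_zero η m ξ hk _ _ _ _ hc htr hdet

theorem det_smul_one_sub_eq_zero {K : Matrix (Fin 2) (Fin 2) ℂ} {k : ℂ}
    (h : Module.End.HasEigenvalue (Matrix.toLin' K) k) : k ^ 2 - K.trace * k + K.det = 0 := by
  obtain ⟨v, hv⟩ := h.exists_hasEigenvector
  have h1 : K.mulVec v = k • v := by simpa using hv.apply_eq_smul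
  have h0 := congrFun h1 0
  have h1 := congrFun h1 1
  simp only [Matrix.mulVec, dotProduct, Fin.sum_univ_two, Pi.smul_apply, smul_eq_mul] at h0 h1
  rw [Matrix.trace_fin_two, Matrix.det_fin_two]
  by_contra hne
  apply hv.2
  funext i
  have hv0 : (k ^ 2 - (K 0 0 + K 1 1) * k + (K 0 0 * K 1 1 - K 0 1 * K 1 0)) * v 0 = 0 := by
    linear_combination (K 1 1 - k) * h0 - K 0 1 * h1
  have hv1 : (k ^ 2 - (K 0 0 + K 1 1) * k + (K 0 0 * K 1 1 - K 0 1 * K 1 0)) * v 1 = 0 := by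
    linear_combination (K 0 0 - k) * h1 - K 1 0 * h0
  fin_cases i
  · exact (mul_eq_zero.mp hv0).resolve_left hne
  · exact (mul_eq_zero.mp hv1).resolve_left hne

theorem trace_det_of_eigenvalues {K : Matrix (Fin 2) (Fin 2) ℂ} {k₁ k₂ : ℂ} (hk : k₁ ≠ k₂)
    (h₁ : Module.End.HasEigenvalue (Matrix.toLin' K) k₁)
    (h₂ : Module.End.HasEigenvalue (Matrix.toLin' K) k₂) :
    K.trace = k₁ + k₂ ∧ K.det = k₁ * k₂ := by
  have e1 := det_smul_one_sub_eq_zero h₁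
  have e2 := det_smul_one_sub_eq_zero h₂
  have ht : K.trace = k₁ + k₂ := by
    have : (k₁ - k₂) * (K.trace - (k₁ + k₂)) = 0 := by linear_combination e2 - e1
    exact sub_eq_zero.mp ((mul_eq_zero.mp this).resolve_left (sub_ne_zero.mpr hk))
  exact ⟨ht, by rw [ht] at e1; linear_combination e1⟩

end Gauge

/-! ### Vector-valued polynomial solutions of the TQ equation. -/

section Solutions

variable {N : ℕ} (η : ℂ) (m : Fin N → ℕ) (ξ : Fin N → ℂ)

/-- The difference of the two sides of `T(x) Q(x) = k₁ a(x) Q(x - η) + k₂ d(x) Q(x + η)`. -/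
def tqDefect (K : Matrix (Fin 2) (Fin 2) ℂ) (k₁ k₂ : ℂ) (Q : Conf m → ℂ[X]) (x : ℂ) (f : Conf m) :
    ℂ :=
  ∑ g, transfer η m ξ K x f g * (Q g).eval x -
    (k₁ * aFun η m ξ x * (Q f).eval (x - η) + k₂ * dFun η m ξ x * (Q f).eval (x + η))

theorem coeff_taylor_of_natDegree_le {Q : ℂ[X]} {n : ℕ} (hQ : Q.natDegree ≤ n) (r : ℂ) :
    (taylor r Q).coeff n = Q.coeff n := by
  rcases hQ.eq_or_lt with h | h
  · rw [← h, coeff_taylor_natDegree, leadingCoeff]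
  · rw [coeff_eq_zero_of_natDegree_lt h, coeff_eq_zero_of_natDegree_lt (by rwa [natDegree_taylor])]

/-- The transfer matrix has leading coefficient tr K, while a and d are monic and shifts do not
change the top coefficient. For tr K = k₁ + k₂ the degree therefore drops by one. -/
theorem tqDefect_eq_eval (K : Matrix (Fin 2) (Fin 2) ℂ) (k₁ k₂ : ℂ) (Q : Conf m → ℂ[X]) {n : ℕ}
    (hQ : ∀ f, (Q f).natDegree ≤ n) (f : Conf m) :
    ∃ p : ℂ[X], p.natDegree ≤ N + n ∧ p.coeff (N + n) = (K.trace - k₁ - k₂) * (Q f).coeff n ∧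
      ∀ x, p.eval x = tqDefect η m ξ K k₁ k₂ Q x f := by
  have hT : ∀ g, ∃ p : ℂ[X], p.natDegree ≤ N ∧
      p.coeff N = (K.trace • (1 : Op m)) f g ∧ ∀ x, p.eval x = transfer η m ξ K x f g := fun g =>
    ((polyLead_transfer η m ξ K).map (Matrix.entryLinearMap ℂ ℂ f g)).exists_polynomial
  choose t ht1 ht2 ht3 using hT
  let A : ℂ[X] := ∏ n, (X - C (pt η m ξ n (m n)))
  let D : ℂ[X] := ∏ n, (X - C (pt η m ξ n 0))
  have hA1 : A.natDegree = N := by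
    rw [natDegree_prod_of_monic _ _ fun n _ => monic_X_sub_C _]; simp
  have hD1 : D.natDegree = N := by
    rw [natDegree_prod_of_monic _ _ fun n _ => monic_X_sub_C _]; simp
  have hA2 : A.coeff N = 1 := by
    have : A.Monic := monic_prod_of_monic _ _ fun n _ => monic_X_sub_C _
    conv_lhs => rw [← hA1]
    exact this
  have hD2 : D.coeff N = 1 := by
    have : D.Monic := monic_prod_of_monic _ _ fun n _ => monic_X_sub_C _
    conv_lhs => rw [← hD1]
    exact this
  have hQt : ∀ r, (taylor r (Q f)).natDegree ≤ n := fun r => by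
    rw [natDegree_taylor]; exact hQ f
  refine ⟨∑ g, t g * Q g - (C k₁ * (A * taylor (-η) (Q f)) + C k₂ * (D * taylor η (Q f))),
    ?_, ?_, ?_⟩
  · refine (natDegree_sub_le_of_le (natDegree_sum_le_of_forall_le _ _ fun g _ =>
      natDegree_mul_le_of_le (ht1 g) (hQ g)) (natDegree_add_le_of_degree_le
        ((natDegree_C_mul_le _ _).trans (natDegree_mul_le_of_le hA1.le (hQt _)))
        ((natDegree_C_mul_le _ _).trans (natDegree_mul_le_of_le hD1.le (hQt _))))).trans ?_
    simp
  · rw [coeff_sub, coeff_add, coeff_C_mul, coeff_C_mul, finsetSum_coeff,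
      coeff_mul_add_eq_of_natDegree_le hA1.le (hQt _), coeff_mul_add_eq_of_natDegree_le hD1.le (hQt _),
      hA2, hD2, coeff_taylor_of_natDegree_le (hQ f), coeff_taylor_of_natDegree_le (hQ f),
      Finset.sum_congr rfl fun g _ => coeff_mul_add_eq_of_natDegree_le (ht1 g) (hQ g)]
    simp only [ht2, Matrix.smul_apply, Matrix.one_apply]
    simp
    ring
  · intro x
    rw [tqDefect, aFun_eq, dFun_eq]
    simp only [eval_sub, eval_add, eval_finsetSum, eval_mul, eval_C, ht3, taylor_eval, A, D,
      eval_prod, eval_X]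
    rw [← sub_eq_add_neg]
    ring

/-- The point `z` is not a zero of a solution of the TQ equation with values in the quantum
space. -/
def NoSol (K : Matrix (Fin 2) (Fin 2) ℂ) (k₁ k₂ z : ℂ) : Prop :=
  ∀ Q : Conf m → ℂ[X], (∀ f, (Q f).natDegree ≤ ∑ n, m n) →
    (∀ x f, tqDefect η m ξ K k₁ k₂ Q x f = 0) → (∀ f, (Q f).eval z = 0) → Q = 0

/-- The constant matrix `G'` carries solutions for `K` to solutions for `K'`, because a and d are
scalars. -/
theorem NoSol.of_similar {K K' : Matrix (Fin 2) (Fin 2) ℂ} {k₁ k₂ z : ℂ}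
    (h : NoSol η m ξ K' k₁ k₂ z) (hs : SimilarTwists η m ξ K K') : NoSol η m ξ K k₁ k₂ z := by
  obtain ⟨G, G', hG, hT⟩ := hs
  have hG' : G' * G = 1 := mul_eq_one_comm.mp hG
  intro Q hdeg hTQ hz
  let Q' : Conf m → ℂ[X] := fun f => ∑ g, C (G' f g) * Q g
  have hev : ∀ x f, (Q' f).eval x = ∑ g, G' f g * (Q g).eval x := fun x f => by
    simp [Q', eval_finsetSum]
  have hmv : ∀ x, (fun f => (Q' f).eval x) = G'.mulVec fun f => (Q f).eval x := fun x =>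
    funext fun f => hev x f
  have hdef : ∀ K₀ (Q₀ : Conf m → ℂ[X]) x, tqDefect η m ξ K₀ k₁ k₂ Q₀ x =
      (transfer η m ξ K₀ x).mulVec (fun f => (Q₀ f).eval x) -
      ((k₁ * aFun η m ξ x) • (fun f => (Q₀ f).eval (x - η)) +
        (k₂ * dFun η m ξ x) • (fun f => (Q₀ f).eval (x + η))) := fun _ _ _ => rfl
  have hQ' : Q' = 0 := by
    refine h Q' (fun f => natDegree_sum_le_of_forall_le _ _ fun g _ =>
      (natDegree_C_mul_le _ _).trans (hdeg g)) (fun x f => ?_) (fun f => ?_)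
    · have h0 : tqDefect η m ξ K k₁ k₂ Q x = 0 := funext (hTQ x)
      have h1 := congrArg G'.mulVec h0
      rw [hdef, hT, Matrix.mulVec_sub, Matrix.mulVec_add, Matrix.mulVec_smul, Matrix.mulVec_smul,
        ← hmv, ← hmv, Matrix.mulVec_mulVec, mul_assoc, ← mul_assoc, hG', one_mul,
        ← Matrix.mulVec_mulVec, ← hmv, ← hdef, Matrix.mulVec_zero] at h1
      exact congrFun h1 f
    · rw [hev]
      exact Finset.sum_eq_zero fun g _ => by rw [hz, mul_zero]
  funext f
  refine Polynomial.funext fun x => ?_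
  have h1 := hmv x
  have h2 : (fun f => (Q' f).eval x) = 0 := by rw [hQ']; funext f; simp
  rw [h2] at h1
  have h3 := congrArg G.mulVec h1
  rw [Matrix.mulVec_mulVec, hG, Matrix.one_mulVec, Matrix.mulVec_zero] at h3
  simpa using (congrFun h3 f).symm

end Solutions

/-! ### The degenerate twist diag(0, 1), where the transfer matrix is triangular. -/

section Triangular

variable {N : ℕ} (η : ℂ) (m : Fin N → ℕ) (ξ : Fin N → ℂ)

/-- The strict colexicographic order on configurations. -/
def ColexLT (f g : Conf m) : Prop := ∃ n, f n < g n ∧ ∀ r, n < r → f r = g r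

theorem siteProd_apply_eq_zero (L : List (Fin N)) (x : ℂ) (i j : Fin 2) (f g : Conf m)
    (h : ∃ r, r ∉ L ∧ f r ≠ g r) : siteProd η m ξ L x i j f g = 0 := by
  induction L generalizing i j f with
  | nil =>
    obtain ⟨r, -, hr⟩ := h
    have : f ≠ g := fun e => hr (by rw [e])
    simp only [siteProd, List.map_nil, List.prod_nil, Matrix.one_apply]
    split_ifs <;> simp [this]
  | cons n L ih =>
    obtain ⟨r, hr, hfg⟩ := h
    have hr' : r ≠ n ∧ r ∉ L := by simpa using hr
    rw [siteProd_cons, Matrix.mul_apply, Matrix.sum_apply]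
    refine Finset.sum_eq_zero fun k _ => ?_
    rw [siteLax, Matrix.map_apply, embed_mul_apply]
    refine Finset.sum_eq_zero fun p _ => ?_
    rw [ih k j _ ⟨r, hr'.2, by simpa [hr'.1] using hfg⟩, mul_zero]

theorem embed_mul_siteProd (n : Fin N) (L : List (Fin N)) (hn : n ∉ L)
    (X : Matrix (Fin (m n + 1)) (Fin (m n + 1)) ℂ) (x : ℂ) (i j : Fin 2) (f g : Conf m) :
    ((embed n X : Op m) * siteProd η m ξ L x i j) f g =
      X (f n) (g n) * siteProd η m ξ L x i j (Function.update f n (g n)) g := by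
  rw [embed_mul_apply]
  refine Finset.sum_eq_single (g n) (fun k _ hk => ?_) (by simp)
  rw [siteProd_apply_eq_zero η m ξ L x i j _ g ⟨n, hn, by simpa using hk⟩, mul_zero]

/-- The auxiliary state 1 can be left only through S⁺, which increases the label of that site. The
remaining sites are smaller, so it is the largest changed site, and the configurations are
colexicographically ordered. -/
theorem siteProd_one_one (L : List (Fin N)) (hL : L.Pairwise (· > ·)) (x : ℂ) (f g : Conf m)
    (hfg : ¬ ColexLT m f g) : siteProd η m ξ L x 1 1 f g =
      if f = g then (L.map fun n => x - pt η m ξ n (f n)).prod else 0 := by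
  induction L generalizing f with
  | nil => simp [siteProd, Matrix.one_apply]
  | cons n L ih =>
    rw [List.pairwise_cons] at hL
    have hn : n ∉ L := fun h => lt_irrefl _ (hL.1 n h)
    rw [siteProd_cons, Matrix.mul_apply, Fin.sum_univ_two, Matrix.add_apply]
    simp only [siteLax, Matrix.map_apply]
    rw [embed_mul_siteProd η m ξ n L hn, embed_mul_siteProd η m ξ n L hn]
    have h1 : lax η (m n) (x - ξ n) 1 0 (f n) (g n) *
        siteProd η m ξ L x 0 1 (Function.update f n (g n)) g = 0 := by
      by_contra hne
      apply hfg
      refine ⟨n, ?_, fun r hr => ?_⟩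
      · by_contra hlt
        apply hne
        have : ¬ ((f n : ℕ) + 1 = g n) := by
          rw [Fin.lt_def] at hlt; omega
        simp [lax, Sp, this]
      · by_contra hfr
        apply hne
        rw [siteProd_apply_eq_zero η m ξ L x 0 1 _ g ⟨r, fun h => lt_asymm hr (hL.1 r h),
          by simpa [hr.ne'] using hfr⟩, mul_zero]
    rw [h1, zero_add]
    by_cases hfn : f n = g n
    · have hu : Function.update f n (g n) = f := by rw [← hfn, Function.update_eq_self]
      rw [hu, ih hL.2 f hfg]
      split_ifs with h
      · subst h
        have : lax η (m n) (x - ξ n) 1 1 (f n) (f n) = x - pt η m ξ n (f n) := by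
          simp [lax, Sz, pt]; ring
        rw [this, List.map_cons, List.prod_cons]
      · rw [mul_zero]
    · have h2 : lax η (m n) (x - ξ n) 1 1 (f n) (g n) = 0 := by
        simp [lax, Sz, hfn]
      have h3 : f ≠ g := fun e => hfn (by rw [e])
      rw [h2, zero_mul, if_neg h3]

theorem transfer_triangular (x : ℂ) (f g : Conf m) (hfg : ¬ ColexLT m f g) :
    transfer η m ξ (Matrix.diagonal ![0, 1]) x f g =
      if f = g then ∏ n, (x - pt η m ξ n (f n)) else 0 := by
  have h : transfer η m ξ (Matrix.diagonal ![0, 1]) x =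
      siteProd η m ξ (List.finRange N).reverse x 1 1 := by
    rw [transfer, monodromy_eq, Matrix.trace_fin_two, Matrix.diagonal_map (map_zero _)]
    simp [Matrix.diagonal_mul]
  have hp : (List.finRange N).reverse.Pairwise (· > ·) := by
    rw [List.pairwise_reverse]
    exact (List.sortedLT_finRange N).pairwise
  rw [h, siteProd_one_one η m ξ _ hp x f g hfg, List.map_reverse, List.prod_reverse,
    ← List.ofFn_eq_map, List.prod_ofFn]

theorem exists_maximal_colex {P : Conf m → Prop} (h : ∃ f, P f) :
    ∃ f, P f ∧ ∀ g, ColexLT m f g → ¬ P g := by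
  let r : Conf m → Conf m → Prop := fun g f => ColexLT m f g
  have ht : IsTrans (Conf m) r := ⟨by
    rintro a b c ⟨n, hn, hn'⟩ ⟨k, hk, hk'⟩
    rcases lt_trichotomy n k with h | h | h
    · exact ⟨k, hn' k h ▸ hk, fun r hr => (hk' r hr).trans (hn' r (h.trans hr))⟩
    · subst h
      exact ⟨n, hk.trans hn, fun r hr => (hk' r hr).trans (hn' r hr)⟩
    · exact ⟨n, hk' n h ▸ hn, fun r hr => (hk' r (h.trans hr)).trans (hn' r hr)⟩⟩
  have hi : Std.Irrefl r := ⟨fun a ⟨n, hn, _⟩ => lt_irrefl _ hn⟩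
  obtain ⟨f, hf, hmax⟩ := (Finite.wellFounded_of_trans_of_irrefl r).has_min {f | P f} h
  exact ⟨f, hf, fun g hg hPg => hmax g hPg hg⟩

/-- On a maximal configuration f with nonzero component, the equation becomes the scalar relation
∏(x - ξ_n^{(f_n)}) q(x) = d(x) q(x + η). A zero at z descends to z - η, z - 2η, … as long as these
avoid the zeros of the left factor, which `hz` ensures. -/
theorem noSol_special (hη : η ≠ 0) (z : ℂ)
    (hz : ∀ j : ℕ, ∀ n h, h ≤ m n → z - ((j : ℂ) + 1) * η ≠ pt η m ξ n h) :
    NoSol η m ξ (Matrix.diagonal ![0, 1]) 0 1 z := by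
  intro Q _ hTQ hQz
  by_contra hne
  obtain ⟨f, hf, hmax⟩ := exists_maximal_colex m (P := fun f => Q f ≠ 0) (by
    by_contra! h; exact hne (funext h))
  have hscalar : ∀ x, (∏ n, (x - pt η m ξ n (f n))) * (Q f).eval x =
      dFun η m ξ x * (Q f).eval (x + η) := by
    intro x
    have h := hTQ x f
    rw [tqDefect, Finset.sum_eq_single f] at h
    · rw [transfer_triangular η m ξ x f f (fun ⟨n, hn, _⟩ => lt_irrefl _ hn), if_pos rfl] at h
      linear_combination h
    · intro g _ hg
      by_cases hlt : ColexLT m f g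
      · rw [not_not.mp (hmax g hlt)]; simp
      · rw [transfer_triangular η m ξ x f g hlt, if_neg hg.symm, zero_mul]
    · simp
  have hzero : ∀ j : ℕ, (Q f).eval (z - (j : ℂ) * η) = 0 := by
    intro j
    induction j with
    | zero => simpa using hQz f
    | succ j ih =>
      have h := hscalar (z - ((j : ℂ) + 1) * η)
      rw [show z - ((j : ℂ) + 1) * η + η = z - (j : ℂ) * η by ring, ih, mul_zero] at h
      push_cast
      refine (mul_eq_zero.mp h).resolve_left (Finset.prod_ne_zero_iff.mpr fun n _ => ?_)
      exact sub_ne_zero.mpr (hz j n (f n) (Nat.lt_succ_iff.mp (f n).2))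
  apply hf
  refine Polynomial.eq_zero_of_infinite_isRoot _ ?_
  refine Set.Infinite.mono (s := Set.range fun j : ℕ => z - (j : ℂ) * η) ?_
    (Set.infinite_range_of_injective fun i j hij => ?_)
  · rintro _ ⟨j, rfl⟩
    exact hzero j
  · have : (i : ℂ) * η = j * η := sub_right_injective hij
    exact_mod_cast mul_right_cancel₀ hη this

end Triangular

/-! ### Genericity: one good parameter point is enough. -/

section Generic

/-- Polynomial functions of the variables indexed by `σ`. -/
def IsPoly {σ : Type*} (f : (σ → ℂ) → ℂ) : Prop :=
  ∃ P : MvPolynomial σ ℂ, ∀ v, MvPolynomial.eval v P = f v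

namespace IsPoly

variable {σ : Type*} {f g : (σ → ℂ) → ℂ}

theorem const (c : ℂ) : IsPoly fun _ : σ → ℂ => c := ⟨MvPolynomial.C c, fun v => by simp⟩

theorem var (i : σ) : IsPoly fun v : σ → ℂ => v i := ⟨MvPolynomial.X i, fun v => by simp⟩

theorem add (hf : IsPoly f) (hg : IsPoly g) : IsPoly fun v => f v + g v := by
  obtain ⟨P, hP⟩ := hf
  obtain ⟨Q, hQ⟩ := hg
  exact ⟨P + Q, fun v => by simp [hP, hQ]⟩

theorem mul (hf : IsPoly f) (hg : IsPoly g) : IsPoly fun v => f v * g v := by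
  obtain ⟨P, hP⟩ := hf
  obtain ⟨Q, hQ⟩ := hg
  exact ⟨P * Q, fun v => by simp [hP, hQ]⟩

theorem sub (hf : IsPoly f) (hg : IsPoly g) : IsPoly fun v => f v - g v := by
  obtain ⟨P, hP⟩ := hf
  obtain ⟨Q, hQ⟩ := hg
  exact ⟨P - Q, fun v => by simp [hP, hQ]⟩

theorem pow (hf : IsPoly f) (n : ℕ) : IsPoly fun v => f v ^ n := by
  obtain ⟨P, hP⟩ := hf
  exact ⟨P ^ n, fun v => by simp [hP]⟩

theorem sum {ι : Type*} {s : Finset ι} {F : ι → (σ → ℂ) → ℂ} (h : ∀ i ∈ s, IsPoly (F i)) :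
    IsPoly fun v => ∑ i ∈ s, F i v := by
  classical
  induction s using Finset.induction_on with
  | empty => simpa using const 0
  | insert a s ha ih =>
    simp only [Finset.sum_insert ha]
    exact (h a (by simp)).add (ih fun i hi => h i (by simp [hi]))

theorem prod {ι : Type*} {s : Finset ι} {F : ι → (σ → ℂ) → ℂ} (h : ∀ i ∈ s, IsPoly (F i)) :
    IsPoly fun v => ∏ i ∈ s, F i v := by
  classical
  induction s using Finset.induction_on with
  | empty => simpa using const 1
  | insert a s ha ih =>
    simp only [Finset.prod_insert ha]
    exact (h a (by simp)).mul (ih fun i hi => h i (by simp [hi]))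

theorem det {n : Type*} [Fintype n] [DecidableEq n] {A : (σ → ℂ) → Matrix n n ℂ}
    (h : ∀ i j, IsPoly fun v => A v i j) : IsPoly fun v => (A v).det := by
  simp only [Matrix.det_apply']
  exact sum fun π _ => (const _).mul (prod fun i _ => h _ _)

end IsPoly

/-- `S` holds off the zero set of a polynomial which does not vanish at `v₀`. -/
def GenericAt {σ : Type*} (v₀ : σ → ℂ) (S : (σ → ℂ) → Prop) : Prop :=
  ∃ P : MvPolynomial σ ℂ, MvPolynomial.eval v₀ P ≠ 0 ∧ ∀ v, MvPolynomial.eval v P ≠ 0 → S v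

namespace GenericAt

variable {σ : Type*} {v₀ : σ → ℂ} {S S' : (σ → ℂ) → Prop}

theorem and (h : GenericAt v₀ S) (h' : GenericAt v₀ S') : GenericAt v₀ fun v => S v ∧ S' v := by
  obtain ⟨P, hP, hS⟩ := h
  obtain ⟨P', hP', hS'⟩ := h'
  refine ⟨P * P', by simp [hP, hP'], fun v hv => ?_⟩
  rw [map_mul] at hv
  exact ⟨hS v (left_ne_zero_of_mul hv), hS' v (right_ne_zero_of_mul hv)⟩

theorem all {ι : Type*} [Fintype ι] {F : ι → (σ → ℂ) → Prop} (h : ∀ i, GenericAt v₀ (F i)) :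
    GenericAt v₀ fun v => ∀ i, F i v := by
  choose P hP hF using h
  refine ⟨∏ i, P i, ?_, fun v hv i => hF i v ?_⟩
  · rw [map_prod]; exact Finset.prod_ne_zero_iff.mpr fun i _ => hP i
  · rw [map_prod] at hv; exact Finset.prod_ne_zero_iff.mp hv i (Finset.mem_univ i)

theorem of_isPoly {f : (σ → ℂ) → ℂ} (hf : IsPoly f) (h : f v₀ ≠ 0) :
    GenericAt v₀ fun v => f v ≠ 0 := by
  obtain ⟨P, hP⟩ := hf
  exact ⟨P, by rwa [hP], fun v hv => by rw [hP] at hv; exact hv⟩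

theorem of_imp {p : Prop} (h : p → GenericAt v₀ S) : GenericAt v₀ fun v => p → S v := by
  by_cases hp : p
  · obtain ⟨P, hP, hS⟩ := h hp
    exact ⟨P, hP, fun v hv _ => hS v hv⟩
  · exact ⟨1, by simp, fun v _ h => absurd h hp⟩

end GenericAt

/-- Injectivity of a matrix with polynomial entries is a generic property. -/
theorem genericAt_injective {σ p q : Type*} [Fintype p] [Fintype q] [DecidableEq p] [DecidableEq q]
    {B : (σ → ℂ) → Matrix p q ℂ} (hB : ∀ i j, IsPoly fun v => B v i j) {v₀ : σ → ℂ}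
    (h : ∀ c, (B v₀).mulVec c = 0 → c = 0) :
    GenericAt v₀ fun v => ∀ c, (B v).mulVec c = 0 → c = 0 := by
  -- A left inverse `L` at v₀ is kept fixed: the polynomial det(L B(v)) is 1 at v₀, and wherever it
  -- is nonzero B(v) is injective.
  obtain ⟨g, hg⟩ := LinearMap.exists_leftInverse_of_injective (Matrix.toLin' (B v₀))
    (LinearMap.ker_eq_bot'.mpr fun c hc => h c (by simpa using hc))
  set L := LinearMap.toMatrix' g
  have hL : L * B v₀ = 1 := by
    have := congrArg LinearMap.toMatrix' hg
    rwa [LinearMap.toMatrix'_comp, LinearMap.toMatrix'_toLin', LinearMap.toMatrix'_id] at this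
  have hdet : IsPoly fun v => (L * B v).det := by
    refine IsPoly.det fun i j => ?_
    simp only [Matrix.mul_apply]
    exact IsPoly.sum fun k _ => (IsPoly.const _).mul (hB k j)
  obtain ⟨P, hP, hS⟩ := GenericAt.of_isPoly hdet (v₀ := v₀) (by simp [hL])
  refine ⟨P, hP, fun v hv c hc => ?_⟩
  have hu : IsUnit (L * B v).det := (hS v hv).isUnit
  have h0 : (L * B v).mulVec c = 0 := by rw [← Matrix.mulVec_mulVec, hc, Matrix.mulVec_zero]
  calc c = ((L * B v)⁻¹ * (L * B v)).mulVec c := by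
        rw [Matrix.nonsing_inv_mul _ hu, Matrix.one_mulVec]
    _ = 0 := by rw [← Matrix.mulVec_mulVec, h0, Matrix.mulVec_zero]

variable {N : ℕ} (η : ℂ) (m : Fin N → ℕ)

theorem isPoly_siteProd (L : List (Fin N)) (x : ℂ) (i j : Fin 2) (f g : Conf m) :
    IsPoly fun v : Fin N ⊕ Fin 2 → ℂ => siteProd η m (v ∘ Sum.inl) L x i j f g := by
  induction L generalizing i f with
  | nil =>
    simp only [siteProd, List.map_nil, List.prod_nil]
    exact IsPoly.const _
  | cons n L ih =>
    have h : ∀ v : Fin N ⊕ Fin 2 → ℂ, siteProd η m (v ∘ Sum.inl) (n :: L) x i j f g =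
        ∑ k, ∑ p, lax η (m n) (x - v (Sum.inl n)) i k (f n) p *
          siteProd η m (v ∘ Sum.inl) L x k j (Function.update f n p) g := by
      intro v
      rw [siteProd_cons, Matrix.mul_apply, Matrix.sum_apply]
      refine Finset.sum_congr rfl fun k _ => ?_
      rw [siteLax, Matrix.map_apply, embed_mul_apply]
      rfl
    simp only [h, lax_eq]
    refine IsPoly.sum fun k _ => IsPoly.sum fun p _ => IsPoly.mul ?_ (ih _ _)
    simp only [Matrix.add_apply, Matrix.smul_apply, smul_eq_mul]
    refine IsPoly.add (IsPoly.mul ?_ (IsPoly.const _)) (IsPoly.const _)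
    by_cases hik : i = k
    · simp only [hik, if_true]
      exact (IsPoly.const _).sub (IsPoly.var _)
    · simp only [hik, if_false]
      exact IsPoly.const _

theorem isPoly_transfer (x : ℂ) (f g : Conf m) :
    IsPoly fun v : Fin N ⊕ Fin 2 → ℂ => transfer η m (v ∘ Sum.inl)
      (Matrix.diagonal ![v (Sum.inr 0), v (Sum.inr 1)]) x f g := by
  have h : ∀ v : Fin N ⊕ Fin 2 → ℂ, transfer η m (v ∘ Sum.inl)
      (Matrix.diagonal ![v (Sum.inr 0), v (Sum.inr 1)]) x f g =
      v (Sum.inr 0) * siteProd η m (v ∘ Sum.inl) (List.finRange N).reverse x 0 0 f g +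
      v (Sum.inr 1) * siteProd η m (v ∘ Sum.inl) (List.finRange N).reverse x 1 1 f g := by
    intro v
    rw [transfer, monodromy_eq, Matrix.trace_fin_two, Matrix.diagonal_map (map_zero _)]
    simp [Matrix.diagonal_mul, ← Algebra.smul_def]
  simp only [h]
  exact ((IsPoly.var _).mul (isPoly_siteProd η m _ _ _ _ _ _)).add
    ((IsPoly.var _).mul (isPoly_siteProd η m _ _ _ _ _ _))

theorem isPoly_pt (n : Fin N) (h : ℕ) :
    IsPoly fun v : Fin N ⊕ Fin 2 → ℂ => pt η m (v ∘ Sum.inl) n h :=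
  ((IsPoly.var _).sub (IsPoly.const _)).add (IsPoly.const _)

theorem isPoly_aFun (x : ℂ) : IsPoly fun v : Fin N ⊕ Fin 2 → ℂ => aFun η m (v ∘ Sum.inl) x := by
  simp only [aFun_eq]
  exact IsPoly.prod fun n _ => (IsPoly.const _).sub (isPoly_pt η m n _)

theorem isPoly_dFun (x : ℂ) : IsPoly fun v : Fin N ⊕ Fin 2 → ℂ => dFun η m (v ∘ Sum.inl) x := by
  simp only [dFun_eq]
  exact IsPoly.prod fun n _ => (IsPoly.const _).sub (isPoly_pt η m n _)

/-- The matrix of the linear system "TQ equation at sufficiently many points and `Q(z) = 0`" for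
the coefficients of a polynomial of degree at most `∑ n, m n` with values in the quantum space. -/
def tqSystem (ξ : Fin N → ℂ) (k₁ k₂ z : ℂ) :
    Matrix (Fin (N + ∑ n, m n + 1) × Conf m ⊕ Conf m) (Fin (∑ n, m n + 1) × Conf m) ℂ :=
  Matrix.of fun r c => match r with
    | Sum.inl (i, f) => transfer η m ξ (Matrix.diagonal ![k₁, k₂]) (i : ℕ) f c.2 * ((i : ℕ) : ℂ) ^ (c.1 : ℕ) -
        (if f = c.2 then 1 else 0) * (k₁ * aFun η m ξ (i : ℕ) * (((i : ℕ) : ℂ) - η) ^ (c.1 : ℕ) +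
          k₂ * dFun η m ξ (i : ℕ) * (((i : ℕ) : ℂ) + η) ^ (c.1 : ℕ))
    | Sum.inr f => (if f = c.2 then 1 else 0) * z ^ (c.1 : ℕ)

variable {m} in
/-- The polynomials with the given coefficients. -/
def ofCoeffs {d : ℕ} (c : Fin d × Conf m → ℂ) (f : Conf m) : ℂ[X] :=
  ∑ j : Fin d, C (c (j, f)) * X ^ (j : ℕ)

theorem eval_ofCoeffs {d : ℕ} (c : Fin d × Conf m → ℂ) (f : Conf m) (x : ℂ) :
    (ofCoeffs c f).eval x = ∑ j : Fin d, c (j, f) * x ^ (j : ℕ) := by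
  simp [ofCoeffs, eval_finsetSum]

theorem coeff_ofCoeffs {d : ℕ} (c : Fin d × Conf m → ℂ) (f : Conf m) (j : Fin d) :
    (ofCoeffs c f).coeff j = c (j, f) := by
  simp only [ofCoeffs, finsetSum_coeff, coeff_C_mul, coeff_X_pow]
  rw [Finset.sum_eq_single j]
  · simp
  · intro k _ hk
    have : ¬ (j : ℕ) = k := fun h => hk (Fin.ext h.symm)
    simp [this]
  · simp

theorem natDegree_ofCoeffs {d : ℕ} (c : Fin (d + 1) × Conf m → ℂ) (f : Conf m) :
    (ofCoeffs c f).natDegree ≤ d :=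
  natDegree_sum_le_of_forall_le _ _ fun j _ =>
    (natDegree_C_mul_X_pow_le _ _).trans (Nat.lt_succ_iff.mp j.2)

theorem ofCoeffs_coeff (Q : Conf m → ℂ[X]) {d : ℕ} (hQ : ∀ f, (Q f).natDegree ≤ d) :
    ofCoeffs (fun p : Fin (d + 1) × Conf m => (Q p.2).coeff p.1) = Q := by
  funext f
  have := (Q f).as_sum_range' (d + 1) (Nat.lt_succ_iff.mpr (hQ f))
  conv_rhs => rw [this]
  rw [ofCoeffs, ← Fin.sum_univ_eq_sum_range fun i => monomial i ((Q f).coeff i)]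
  exact Finset.sum_congr rfl fun i _ => C_mul_X_pow_eq_monomial

theorem tqSystem_mulVec_inl (ξ : Fin N → ℂ) (k₁ k₂ z : ℂ)
    (c : Fin (∑ n, m n + 1) × Conf m → ℂ) (i : Fin (N + ∑ n, m n + 1)) (f : Conf m) :
    (tqSystem η m ξ k₁ k₂ z).mulVec c (Sum.inl (i, f)) =
      tqDefect η m ξ (Matrix.diagonal ![k₁, k₂]) k₁ k₂ (ofCoeffs c) (i : ℕ) f := by
  simp only [Matrix.mulVec, dotProduct, tqSystem, Matrix.of_apply, tqDefect, eval_ofCoeffs,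
    Fintype.sum_prod_type, sub_mul, Finset.sum_sub_distrib]
  congr 1
  · rw [Finset.sum_comm]
    simp only [Finset.mul_sum]
    exact Finset.sum_congr rfl fun g _ => Finset.sum_congr rfl fun j _ => by ring
  · rw [Finset.sum_comm, Finset.sum_eq_single f]
    · simp only [if_true, one_mul, Finset.mul_sum, ← Finset.sum_add_distrib]
      exact Finset.sum_congr rfl fun j _ => by ring
    · intro g _ hg
      exact Finset.sum_eq_zero fun j _ => by simp [hg.symm]
    · simp

theorem tqSystem_mulVec_inr (ξ : Fin N → ℂ) (k₁ k₂ z : ℂ)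
    (c : Fin (∑ n, m n + 1) × Conf m → ℂ) (f : Conf m) :
    (tqSystem η m ξ k₁ k₂ z).mulVec c (Sum.inr f) = (ofCoeffs c f).eval z := by
  simp only [Matrix.mulVec, dotProduct, tqSystem, Matrix.of_apply, eval_ofCoeffs,
    Fintype.sum_prod_type]
  rw [Finset.sum_comm, Finset.sum_eq_single f]
  · exact Finset.sum_congr rfl fun j _ => by simp; ring
  · intro g _ hg
    exact Finset.sum_eq_zero fun j _ => by simp [hg.symm]
  · simp

/-- The defect has degree at most N + N_s, so testing it at N + N_s + 1 integers is no loss; the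
condition becomes injectivity of a finite matrix. -/
theorem noSol_iff_tqSystem (ξ : Fin N → ℂ) (k₁ k₂ z : ℂ) :
    NoSol η m ξ (Matrix.diagonal ![k₁, k₂]) k₁ k₂ z ↔
      ∀ c, (tqSystem η m ξ k₁ k₂ z).mulVec c = 0 → c = 0 := by
  constructor
  · intro h c hc
    have hQ := h (ofCoeffs c) (natDegree_ofCoeffs m c) (fun x f => ?_) (fun f => ?_)
    · funext ⟨j, f⟩
      rw [← coeff_ofCoeffs m c f j, hQ]; simp
    · obtain ⟨p, hp, -, hpe⟩ := tqDefect_eq_eval η m ξ (Matrix.diagonal ![k₁, k₂]) k₁ k₂ (ofCoeffs c)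
        (natDegree_ofCoeffs m c) f
      have : p = 0 := by
        refine Polynomial.eq_zero_of_natDegree_lt_card_of_eval_eq_zero p
          (f := fun i : Fin (N + ∑ n, m n + 1) => ((i : ℕ) : ℂ))
          (fun i j hij => Fin.ext (Nat.cast_injective hij)) (fun i => ?_) ?_
        · rw [hpe, ← tqSystem_mulVec_inl η m ξ k₁ k₂ z, hc]; rfl
        · simpa [Nat.lt_succ_iff] using hp
      rw [← hpe, this, eval_zero]
    · rw [← tqSystem_mulVec_inr η m ξ k₁ k₂ z, hc]; rfl
  · intro h Q hdeg hTQ hz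
    have hc := h (fun p => (Q p.2).coeff p.1) ?_
    · rw [← ofCoeffs_coeff m Q hdeg, hc]
      funext f
      simp [ofCoeffs]
    · funext r
      rcases r with ⟨i, f⟩ | f
      · rw [tqSystem_mulVec_inl, ofCoeffs_coeff m Q hdeg, hTQ]; rfl
      · rw [tqSystem_mulVec_inr, ofCoeffs_coeff m Q hdeg, hz]; rfl

theorem isPoly_tqSystem {z : (Fin N ⊕ Fin 2 → ℂ) → ℂ} (hz : IsPoly z)
    (r : Fin (N + ∑ n, m n + 1) × Conf m ⊕ Conf m) (c : Fin (∑ n, m n + 1) × Conf m) :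
    IsPoly fun v : Fin N ⊕ Fin 2 → ℂ =>
      tqSystem η m (v ∘ Sum.inl) (v (Sum.inr 0)) (v (Sum.inr 1)) (z v) r c := by
  rcases r with ⟨i, f⟩ | f
  · simp only [tqSystem, Matrix.of_apply]
    exact ((isPoly_transfer η m _ _ _).mul (IsPoly.const _)).sub ((IsPoly.const _).mul
      ((((IsPoly.var _).mul (isPoly_aFun η m _)).mul (IsPoly.const _)).add
      (((IsPoly.var _).mul (isPoly_dFun η m _)).mul (IsPoly.const _))))
  · simp only [tqSystem, Matrix.of_apply]
    exact (IsPoly.const _).mul (hz.pow _)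

theorem genericAt_noSol {z : (Fin N ⊕ Fin 2 → ℂ) → ℂ} (hz : IsPoly z) (ξ₀ : Fin N → ℂ)
    (h : NoSol η m ξ₀ (Matrix.diagonal ![0, 1]) 0 1 (z (Sum.elim ξ₀ ![0, 1]))) :
    GenericAt (Sum.elim ξ₀ ![0, 1]) fun v => NoSol η m (v ∘ Sum.inl)
      (Matrix.diagonal ![v (Sum.inr 0), v (Sum.inr 1)]) (v (Sum.inr 0)) (v (Sum.inr 1)) (z v) := by
  simp only [noSol_iff_tqSystem]
  exact genericAt_injective (isPoly_tqSystem η m hz) ((noSol_iff_tqSystem η m ξ₀ 0 1 _).mp h)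

/-- Inhomogeneities for which all the points `ξ_n^{(h)}`, and `z`, are in general position. -/
def specialXi (z : ℂ) (n : Fin N) : ℂ :=
  z + (((n : ℕ) : ℂ) + 1) / ((N : ℂ) + 2) * η + η / 2 - (m n : ℂ) / 2 * η

theorem pt_specialXi (z : ℂ) (n : Fin N) (h : ℕ) :
    pt η m (specialXi η m z) n h = z + ((((n : ℕ) : ℂ) + 1) / ((N : ℂ) + 2) - h) * η := by
  simp only [pt, specialXi]; ring

/-- The fractions with denominator N + 2 lie in [0, 1), so they are recovered as fractional parts.
This is what keeps the strings of points at `specialXi` disjoint from each other and from that of z.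
-/
theorem int_eq_of_fractions {n n' : ℕ} (hn : n < N + 2) (hn' : n' < N + 2) {a b : ℕ}
    (h : (n : ℂ) / ((N : ℂ) + 2) - a = (n' : ℂ) / ((N : ℂ) + 2) - b) : n = n' ∧ a = b := by
  have h0 : ((N : ℂ) + 2) ≠ 0 := by exact_mod_cast (show N + 2 ≠ 0 by omega)
  have h1 : (n : ℂ) - a * ((N : ℂ) + 2) = n' - b * ((N : ℂ) + 2) := by
    field_simp at h
    linear_combination h
  have h2 : (n : ℤ) - a * ((N : ℤ) + 2) = n' - b * ((N : ℤ) + 2) := by exact_mod_cast h1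
  have hab : (a : ℤ) = b := by
    by_contra hne
    rcases lt_or_gt_of_ne hne with hlt | hlt
    · nlinarith
    · nlinarith
  rw [hab] at h2
  constructor <;> omega

theorem pt_specialXi_injective (hη : η ≠ 0) (z : ℂ) {n n' : Fin N} {h h' : ℕ}
    (e : pt η m (specialXi η m z) n h = pt η m (specialXi η m z) n' h') : n = n' ∧ h = h' := by
  rw [pt_specialXi, pt_specialXi] at e
  have e1 := mul_right_cancel₀ hη (add_left_cancel e)
  have := int_eq_of_fractions (N := N) (n := n + 1) (n' := n' + 1) (by omega) (by omega)
    (by push_cast; exact e1)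
  exact ⟨Fin.ext (by omega), this.2⟩

theorem pt_specialXi_ne (hη : η ≠ 0) (z : ℂ) (j : ℕ) (n : Fin N) (h : ℕ) :
    z - (j : ℂ) * η ≠ pt η m (specialXi η m z) n h := by
  rw [pt_specialXi]
  intro e
  have e1 : ((0 : ℕ) : ℂ) / ((N : ℂ) + 2) - j =
      ((((n : ℕ) + 1 : ℕ) : ℂ)) / ((N : ℂ) + 2) - h := by
    apply mul_right_cancel₀ hη
    push_cast
    linear_combination e
  have := int_eq_of_fractions (N := N) (by omega) (by omega) e1
  omega

/-- Below ξ_a^{(2s_a)} the string of a continues with the indices 2s_a + 1, 2s_a + 2, …, which are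
not among the points to be avoided. -/
theorem genericAt_noSol_pt (hη : η ≠ 0) (z : ℂ) (a : Fin N) :
    GenericAt (Sum.elim (specialXi η m z) ![0, 1]) fun v => NoSol η m (v ∘ Sum.inl)
      (Matrix.diagonal ![v (Sum.inr 0), v (Sum.inr 1)]) (v (Sum.inr 0)) (v (Sum.inr 1))
      (pt η m (v ∘ Sum.inl) a (m a)) := by
  refine genericAt_noSol η m (isPoly_pt η m a (m a)) _ (noSol_special η m _ hη _ ?_)
  intro j n h hh e
  have e1 : pt η m (specialXi η m z) a (m a + (j + 1)) = pt η m (specialXi η m z) n h := by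
    rw [← e, Sum.elim_comp_inl]; simp only [pt]; push_cast; ring
  obtain ⟨rfl, rfl⟩ := pt_specialXi_injective η m hη z e1
  omega

theorem genericAt_noSol_const (hη : η ≠ 0) (z : ℂ) :
    GenericAt (Sum.elim (specialXi η m z) ![0, 1]) fun v => NoSol η m (v ∘ Sum.inl)
      (Matrix.diagonal ![v (Sum.inr 0), v (Sum.inr 1)]) (v (Sum.inr 0)) (v (Sum.inr 1)) z := by
  refine genericAt_noSol η m (IsPoly.const z) _ (noSol_special η m _ hη _ ?_)
  intro j n h _
  exact_mod_cast pt_specialXi_ne η m hη z (j + 1) n h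

theorem genericAt_pt_injective (hη : η ≠ 0) (z : ℂ) :
    GenericAt (Sum.elim (specialXi η m z) ![0, 1]) fun v =>
      ∀ p q : Σ n : Fin N, Fin (m n + 1), p ≠ q →
        pt η m (v ∘ Sum.inl) p.1 p.2 - pt η m (v ∘ Sum.inl) q.1 q.2 ≠ 0 := by
  refine GenericAt.all fun p => GenericAt.all fun q => GenericAt.of_imp fun hpq =>
    GenericAt.of_isPoly ((isPoly_pt η m _ _).sub (isPoly_pt η m _ _)) ?_
  rw [Sum.elim_comp_inl, sub_ne_zero]
  intro e
  obtain ⟨h1, h2⟩ := pt_specialXi_injective η m hη z e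
  obtain ⟨n, h⟩ := p
  obtain ⟨n', h'⟩ := q
  obtain rfl : n = n' := h1
  exact hpq (congrArg _ (Fin.ext h2))

theorem genericAt_node_ne (hη : η ≠ 0) (z : ℂ) :
    GenericAt (Sum.elim (specialXi η m z) ![0, 1]) fun v =>
      ∀ p, node η m (v ∘ Sum.inl) p - z ≠ 0 := by
  refine GenericAt.all fun p => GenericAt.of_isPoly
    ((isPoly_pt η m _ _).sub (IsPoly.const z)) ?_
  rw [Sum.elim_comp_inl, sub_ne_zero]
  have := pt_specialXi_ne η m hη z 0 p.1 (p.2 + 1)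
  rw [Nat.cast_zero, zero_mul, sub_zero] at this
  exact this.symm

end Generic

/-! ### Lagrange polynomials for ζ and the nodes. -/

section Lagrange

variable {N : ℕ} (η : ℂ) (m : Fin N → ℕ) (ξ : Fin N → ℂ) (ζ : ℂ)

/-- The Lagrange polynomial of the node `p` with respect to `ζ` and all nodes. -/
def lagNode (p : Σ b : Fin N, Fin (m b)) : ℂ[X] :=
  C ((node η m ξ p - ζ)⁻¹) * (X - C ζ) *
    ∏ p' ∈ Finset.univ.erase p, C ((node η m ξ p - node η m ξ p')⁻¹) * (X - C (node η m ξ p'))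

/-- The Lagrange polynomial of `ζ` with respect to `ζ` and all nodes. -/
def lagBase : ℂ[X] :=
  ∏ p : Σ b : Fin N, Fin (m b), C ((ζ - node η m ξ p)⁻¹) * (X - C (node η m ξ p))

theorem eval_lagNode (p : Σ b : Fin N, Fin (m b)) (x : ℂ) : (lagNode η m ξ ζ p).eval x =
    (x - ζ) / (node η m ξ p - ζ) *
      ∏ p' ∈ Finset.univ.erase p, (x - node η m ξ p') / (node η m ξ p - node η m ξ p') := by
  simp only [lagNode, eval_mul, eval_C, eval_sub, eval_X, eval_prod, div_eq_inv_mul]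

theorem eval_lagBase (x : ℂ) : (lagBase η m ξ ζ).eval x =
    ∏ p, (x - node η m ξ p) / (ζ - node η m ξ p) := by
  simp only [lagBase, eval_mul, eval_C, eval_sub, eval_X, eval_prod, div_eq_inv_mul]

theorem natDegree_C_mul_X_sub_C_le (a b : ℂ) : (C a * (X - C b)).natDegree ≤ 1 :=
  (natDegree_C_mul_le _ _).trans (natDegree_X_sub_C b).le

theorem card_nodes : Fintype.card (Σ b : Fin N, Fin (m b)) = ∑ n, m n := by simp

theorem natDegree_lagBase : (lagBase η m ξ ζ).natDegree ≤ ∑ n, m n := by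
  refine (natDegree_prod_le _ _).trans ?_
  refine (Finset.sum_le_sum fun p _ => natDegree_C_mul_X_sub_C_le _ _).trans ?_
  simp

theorem natDegree_lagNode (p : Σ b : Fin N, Fin (m b)) :
    (lagNode η m ξ ζ p).natDegree ≤ ∑ n, m n := by
  have h1 : (∏ p' ∈ Finset.univ.erase p, C ((node η m ξ p - node η m ξ p')⁻¹) *
      (X - C (node η m ξ p'))).natDegree ≤ (∑ n, m n) - 1 := by
    refine (natDegree_prod_le _ _).trans ?_
    refine (Finset.sum_le_sum fun p _ => natDegree_C_mul_X_sub_C_le _ _).trans ?_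
    rw [Finset.sum_const, Finset.card_erase_of_mem (Finset.mem_univ p), Finset.card_univ, card_nodes]
    simp
  have h2 : 0 < ∑ n, m n := by
    rw [← card_nodes]
    exact Fintype.card_pos_iff.mpr ⟨p⟩
  refine (natDegree_mul_le_of_le (natDegree_C_mul_X_sub_C_le _ _) h1).trans ?_
  omega

theorem eval_lagNode_node (hinj : Function.Injective (node η m ξ)) (hζ : ∀ p, node η m ξ p ≠ ζ)
    (p q : Σ b : Fin N, Fin (m b)) :
    (lagNode η m ξ ζ p).eval (node η m ξ q) = if p = q then 1 else 0 := by
  rw [eval_lagNode]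
  split_ifs with h
  · subst h
    rw [div_self (sub_ne_zero.mpr (hζ p)), one_mul]
    refine Finset.prod_eq_one fun p' hp' => div_self (sub_ne_zero.mpr fun e => ?_)
    exact Finset.ne_of_mem_erase hp' (hinj e).symm
  · rw [Finset.prod_eq_zero (Finset.mem_erase.mpr ⟨Ne.symm h, Finset.mem_univ q⟩) (by simp),
      mul_zero]

theorem eval_lagNode_self (p : Σ b : Fin N, Fin (m b)) : (lagNode η m ξ ζ p).eval ζ = 0 := by
  simp [eval_lagNode]

theorem eval_lagBase_node (q : Σ b : Fin N, Fin (m b)) :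
    (lagBase η m ξ ζ).eval (node η m ξ q) = 0 := by
  rw [eval_lagBase]
  exact Finset.prod_eq_zero (Finset.mem_univ q) (by simp)

theorem eval_lagBase_self (hζ : ∀ p, node η m ξ p ≠ ζ) : (lagBase η m ξ ζ).eval ζ = 1 := by
  rw [eval_lagBase]
  exact Finset.prod_eq_one fun p _ => div_self (sub_ne_zero.mpr (hζ p).symm)

end Lagrange

/-! ### From the discrete equation to the functional equation. -/

section TQ

variable {N : ℕ} {η : ℂ} {m : Fin N → ℕ} {ξ : Fin N → ℂ} {K : Matrix (Fin 2) (Fin 2) ℂ} {k₁ k₂ : ℂ}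

theorem aFun_ne_zero (hpt : ∀ p q : Σ n : Fin N, Fin (m n + 1), p ≠ q →
    pt η m ξ p.1 p.2 ≠ pt η m ξ q.1 q.2) (c : Fin N) {h : ℕ} (hh : h < m c) :
    aFun η m ξ (pt η m ξ c h) ≠ 0 := by
  rw [aFun_eq]
  refine Finset.prod_ne_zero_iff.mpr fun n _ => sub_ne_zero.mpr ?_
  have := hpt ⟨c, ⟨h, by omega⟩⟩ ⟨n, ⟨m n, by omega⟩⟩ (by
    intro e
    obtain ⟨rfl, e2⟩ := Sigma.mk.inj_iff.mp e
    have := congrArg Fin.val (eq_of_heq e2)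
    simp only at this
    omega)
  exact this

theorem dFun_ne_zero (hpt : ∀ p q : Σ n : Fin N, Fin (m n + 1), p ≠ q →
    pt η m ξ p.1 p.2 ≠ pt η m ξ q.1 q.2) (c : Fin N) {h : ℕ} (h0 : 0 < h) (hh : h ≤ m c) :
    dFun η m ξ (pt η m ξ c h) ≠ 0 := by
  rw [dFun_eq]
  refine Finset.prod_ne_zero_iff.mpr fun n _ => sub_ne_zero.mpr ?_
  have := hpt ⟨c, ⟨h, by omega⟩⟩ ⟨n, ⟨0, by omega⟩⟩ (by
    intro e
    obtain ⟨rfl, e2⟩ := Sigma.mk.inj_iff.mp e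
    have := congrArg Fin.val (eq_of_heq e2)
    simp only at this
    omega)
  exact this

/-- A solution of the TQ equation vanishing at `ξ_c^{(0)}` vanishes at `ξ_c^{(2s_c)}`. -/
theorem NoSol.pt_zero (hk₁ : k₁ ≠ 0) (hpt : ∀ p q : Σ n : Fin N, Fin (m n + 1), p ≠ q →
    pt η m ξ p.1 p.2 ≠ pt η m ξ q.1 q.2) {c : Fin N}
    (h : NoSol η m ξ K k₁ k₂ (pt η m ξ c (m c))) : NoSol η m ξ K k₁ k₂ (pt η m ξ c 0) := by
  intro Q hdeg hTQ hz
  -- The recurrence is of second order, so two consecutive zeros are carried along; at the start the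
  -- missing one is replaced by d(ξ_c^{(0)}) = 0.
  have key : ∀ i, i ≤ m c → (∀ f, (Q f).eval (pt η m ξ c i) = 0) ∧
      (0 < i → ∀ f, (Q f).eval (pt η m ξ c (i - 1)) = 0) := by
    intro i
    induction i with
    | zero => exact fun _ => ⟨hz, fun h => absurd h (lt_irrefl 0)⟩
    | succ i ih =>
      intro hi
      obtain ⟨h1, h2⟩ := ih (by omega)
      refine ⟨fun f => ?_, fun _ => h1⟩
      have h3 := hTQ (pt η m ξ c i) f
      rw [tqDefect, Finset.sum_eq_zero fun g _ => by rw [h1 g, mul_zero], pt_sub] at h3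
      have h4 : dFun η m ξ (pt η m ξ c i) * (Q f).eval (pt η m ξ c i + η) = 0 := by
        rcases Nat.eq_zero_or_pos i with rfl | hpos
        · rw [dFun_pt, zero_mul]
        · have e : pt η m ξ c i + η = pt η m ξ c (i - 1) := by
            conv_lhs => rw [show i = i - 1 + 1 by omega]
            exact pt_add η m ξ c (i - 1)
          rw [e, h2 hpos, mul_zero]
      have h5 : k₁ * aFun η m ξ (pt η m ξ c i) * (Q f).eval (pt η m ξ c (i + 1)) = 0 := by
        linear_combination -h3 - k₂ * h4
      exact (mul_eq_zero.mp h5).resolve_left (mul_ne_zero hk₁ (aFun_ne_zero hpt c (by omega)))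
  exact h Q hdeg hTQ (key (m c) le_rfl).1

/-- A family of polynomials of degree at most `∑ n, m n` with the values `Q_a^{(h)} w_a` at the
points `ξ_a^{(h)}` solves the TQ equation. -/
theorem tqDefect_eq_zero (hη : η ≠ 0) (hm : ∀ n, 0 < m n) (hk₂ : k₂ ≠ 0) (htr : K.trace = k₁ + k₂)
    (hdet : K.det = k₁ * k₂) (hpt : ∀ p q : Σ n : Fin N, Fin (m n + 1), p ≠ q →
      pt η m ξ p.1 p.2 ≠ pt η m ξ q.1 q.2) {V : Conf m → ℂ[X]}
    (hdeg : ∀ f, (V f).natDegree ≤ ∑ n, m n) (w : Fin N → Conf m → ℂ)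
    (hV : ∀ a h, h ≤ m a → ∀ f, (V f).eval (pt η m ξ a h) = (Qcoef η m ξ K k₂ a h).mulVec (w a) f)
    (x : ℂ) (f : Conf m) : tqDefect η m ξ K k₁ k₂ V x f = 0 := by
  obtain ⟨p, hp, hpc, hpe⟩ := tqDefect_eq_eval η m ξ K k₁ k₂ V hdeg f
  -- The trace condition removes the coefficient of degree N + N_s, leaving a degree below the
  -- number of points ξ_a^{(h)}.
  have hlt : p.degree < ((N + ∑ n, m n : ℕ) : WithBot ℕ) := by
    rw [degree_lt_iff_coeff_zero]
    intro k hk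
    rcases hk.eq_or_lt with h | h
    · rw [← h, hpc, htr]; ring
    · exact coeff_eq_zero_of_natDegree_lt (lt_of_le_of_lt hp h)
  have hp0 : p = 0 := by
    have hinj : Set.InjOn (fun q : Σ n : Fin N, Fin (m n + 1) => pt η m ξ q.1 q.2)
        (Finset.univ : Finset (Σ n : Fin N, Fin (m n + 1))) := fun q _ q' _ h => by
      by_contra hne
      exact hpt q q' hne h
    refine eq_zero_of_degree_lt_of_eval_index_eq_zero _ hinj ?_ ?_
    · rw [Finset.card_univ, Fintype.card_sigma]
      simpa [Finset.sum_add_distrib, add_comm] using hlt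
    · rintro ⟨a, h⟩ -
      have hh : (h : ℕ) ≤ m a := Nat.lt_succ_iff.mp h.2
      rw [hpe, tqDefect, pt_sub]
      simp only
      have hmain := congrFun (congrArg (fun M : Op m => M.mulVec (w a))
        (transfer_mul_Qcoef η m ξ hη K hk₂ hdet a (hm a)
        (fun h h0 hh => dFun_ne_zero hpt a h0 hh) h hh)) f
      simp only [← Matrix.mulVec_mulVec, Matrix.add_mulVec, Matrix.smul_mulVec, Pi.add_apply,
        Pi.smul_apply, smul_eq_mul] at hmain
      have h1 : ∑ g, transfer η m ξ K (pt η m ξ a h) f g * (V g).eval (pt η m ξ a h) =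
          (transfer η m ξ K (pt η m ξ a h)).mulVec ((Qcoef η m ξ K k₂ a h).mulVec (w a)) f := by
        rw [Matrix.mulVec, dotProduct]
        exact Finset.sum_congr rfl fun g _ => by rw [hV a h hh g]
      have h2 : k₁ * aFun η m ξ (pt η m ξ a h) * (V f).eval (pt η m ξ a (h + 1)) =
          k₁ * aFun η m ξ (pt η m ξ a h) * (Qcoef η m ξ K k₂ a (h + 1)).mulVec (w a) f := by
        rcases hh.eq_or_lt with e | hlt
        · rw [e, aFun_pt]; ring
        · rw [hV a (h + 1) hlt]
      have h3 : k₂ * dFun η m ξ (pt η m ξ a h) * (V f).eval (pt η m ξ a h + η) =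
          k₂ * dFun η m ξ (pt η m ξ a h) * (Qcoef η m ξ K k₂ a (h - 1)).mulVec (w a) f := by
        rcases Nat.eq_zero_or_pos (h : ℕ) with e | hpos
        · rw [e, dFun_pt]; ring
        · have e : pt η m ξ a h + η = pt η m ξ a (h - 1) := by
            conv_lhs => rw [show (h : ℕ) = h - 1 + 1 by omega]
            exact pt_add η m ξ a (h - 1)
          rw [e, hV a (h - 1) (by omega)]
      rw [h1, h2, h3, hmain, sub_self]
  rw [← hpe, hp0, eval_zero]

end TQ

/-! ### Commutative algebra of transfer matrices and determinants over it. -/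

section Reconstruction

theorem fusedTransfer_mem_adjoin {N : ℕ} (η : ℂ) (m : Fin N → ℕ) (ξ : Fin N → ℂ) (hη : η ≠ 0)
    (K : Matrix (Fin 2) (Fin 2) ℂ) (l : ℕ) (y : ℂ) :
    fusedTransfer η m ξ K l y ∈ Algebra.adjoin ℂ (Set.range (transfer η m ξ K)) := by
  have hT : ∀ x, transfer η m ξ K x ∈ Algebra.adjoin ℂ (Set.range (transfer η m ξ K)) := fun x =>
    Algebra.subset_adjoin ⟨x, rfl⟩
  induction l using Nat.twoStepInduction with
  | zero => rw [fusedTransfer_zero η m ξ hη]; exact one_mem _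
  | one => rw [fusedTransfer_one η m ξ hη]; exact hT _
  | more l h0 h1 =>
    rw [fusedTransfer_rec η m ξ hη]
    exact sub_mem (mul_mem (hT _) h1) (Subalgebra.smul_mem _ h0 _)

open scoped IsMulCommutative in
-- Within a commutative ring, ordinary determinants and matrix inverses are available; they are
-- carried back to operators through φ.
theorem exists_commutative_model {N : ℕ} (η : ℂ) (m : Fin N → ℕ) (ξ : Fin N → ℂ) (hη : η ≠ 0)
    (K : Matrix (Fin 2) (Fin 2) ℂ) (k₂ : ℂ) :
    ∃ (S : Type) (_ : CommRing S) (_ : Algebra ℂ S) (φ : S →ₐ[ℂ] Op m),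
      Function.Injective φ ∧ FiniteDimensional ℂ S ∧ (∀ x, ∃ s, φ s = transfer η m ξ K x) ∧
      ∀ a h, ∃ s, φ s = Qcoef η m ξ K k₂ a h := by
  let A := Algebra.adjoin ℂ (Set.range (transfer η m ξ K))
  have hc : ∀ a ∈ Set.range (transfer η m ξ K), ∀ b ∈ Set.range (transfer η m ξ K), a * b = b * a := by
    rintro _ ⟨x, rfl⟩ _ ⟨y, rfl⟩
    exact (transfer_commute η m ξ K x y).eq
  have := Algebra.isMulCommutative_adjoin ℂ hc
  refine ⟨A, inferInstance, inferInstanceAs (Algebra ℂ A), A.val,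
    Subtype.val_injective, inferInstanceAs (FiniteDimensional ℂ A), fun x => ?_, fun a h => ?_⟩
  · exact ⟨⟨_, Algebra.subset_adjoin ⟨x, rfl⟩⟩, rfl⟩
  · exact ⟨⟨_, A.smul_mem (fusedTransfer_mem_adjoin η m ξ hη K _ _) _⟩, rfl⟩

/-- Multiplication by s is injective on S, hence surjective by finite dimension: the inverse
operator already lies in the algebra. -/
theorem isUnit_of_isUnit_map {S A : Type*} [CommRing S] [Algebra ℂ S] [Ring A] [Algebra ℂ A]
    [FiniteDimensional ℂ S] (φ : S →ₐ[ℂ] A) (hφ : Function.Injective φ) {s : S}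
    (h : IsUnit (φ s)) : IsUnit s := by
  have hinj : Function.Injective (LinearMap.mulLeft ℂ s) := by
    intro a b hab
    apply hφ
    have : φ s * φ a = φ s * φ b := by rw [← map_mul, ← map_mul]; exact congrArg φ hab
    exact h.mul_left_cancel this
  obtain ⟨t, ht⟩ := (LinearMap.injective_iff_surjective.mp hinj) 1
  exact IsUnit.of_mul_eq_one t ht

theorem opDet_map {S A : Type*} [CommRing S] [Ring A] {N : ℕ} (φ : S →+* A)
    (M : Matrix (Fin N) (Fin N) S) : opDet (M.map φ) = φ M.det := by
  rw [← opDet_eq_det, opDet, opDet, map_sum]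
  refine Finset.sum_congr rfl fun σ _ => ?_
  rw [map_mul, map_intCast, map_list_prod, List.map_ofFn]
  rfl

end Reconstruction

/-- A matrix with entries in a commutative ring of operators has an invertible determinant if it
acts injectively on tuples of vectors. -/
theorem isUnit_map_det {S n : Type*} [CommRing S] [Fintype n] [DecidableEq n] {N : ℕ}
    (φ : S →+* Matrix n n ℂ) (M : Matrix (Fin N) (Fin N) S)
    (h : ∀ w : Fin N → n → ℂ, (∀ a, ∑ b, (φ (M a b)).mulVec (w b) = 0) → w = 0) :
    IsUnit (φ M.det) := by
  -- For commuting blocks, the determinant of the block determinant is the determinant of the whole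
  -- block matrix.
  rw [Matrix.isUnit_iff_isUnit_det, Matrix.det_det, ← Matrix.isUnit_iff_isUnit_det,
    ← Matrix.mulVec_injective_iff_isUnit]
  refine (injective_iff_map_eq_zero (Matrix.mulVecLin
    (Matrix.comp (Fin N) (Fin N) n n ℂ (M.map φ)))).mpr fun c hc => ?_
  have hw := h (fun b f => c (b, f)) fun a => by
    ext f
    have := congrFun hc (a, f)
    simpa [Matrix.mulVec, dotProduct, Fintype.sum_prod_type] using this
  ext ⟨b, f⟩
  exact congrFun (congrFun hw b) f

theorem det_add_rank_one {S : Type*} [CommRing S] {N : ℕ} {A : Matrix (Fin N) (Fin N) S}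
    (hA : IsUnit A.det) {u r q : Fin N → S} (hq : A.mulVec q = -u) :
    (A + Matrix.of fun a b => u a * r b).det = A.det * (1 - ∑ b, r b * q b) := by
  have h1 : (Matrix.of fun a b => u a * r b : Matrix (Fin N) (Fin N) S) =
      Matrix.replicateCol Unit u * Matrix.replicateRow Unit r := by
    ext a b
    simp [Matrix.mul_apply]
  have h2 : A⁻¹.mulVec u = -q := by
    rw [← neg_neg u, ← hq, Matrix.mulVec_neg, Matrix.mulVec_mulVec, Matrix.nonsing_inv_mul A hA,
      Matrix.one_mulVec]
  rw [h1, Matrix.det_add_replicateCol_mul_replicateRow hA]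
  congr 1
  rw [Matrix.det_unique, Matrix.mul_assoc, ← Matrix.replicateCol_mulVec, h2]
  simp [Matrix.mul_apply, sub_eq_add_neg]

/-! ### Interpolation polynomials as solutions, and invertibility. -/

section Interpolation

variable {N : ℕ}

/-- The conditions on the parameters under which the reconstruction works. -/
structure Regular (η : ℂ) (m : Fin N → ℕ) (ξ : Fin N → ℂ) (K : Matrix (Fin 2) (Fin 2) ℂ)
    (k₁ k₂ ζ : ℂ) : Prop where
  eta_ne_zero : η ≠ 0
  pos : ∀ n, 0 < m n
  ne_zero : k₂ ≠ 0
  trace_eq : K.trace = k₁ + k₂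
  det_eq : K.det = k₁ * k₂
  pt_ne : ∀ p q : Σ n : Fin N, Fin (m n + 1), p ≠ q → pt η m ξ p.1 p.2 ≠ pt η m ξ q.1 q.2
  node_ne : ∀ p, node η m ξ p ≠ ζ
  noSol_pt : ∀ a, NoSol η m ξ K k₁ k₂ (pt η m ξ a (m a))
  noSol_zeta : NoSol η m ξ K k₁ k₂ ζ

variable (η : ℂ) (m : Fin N → ℕ) (ξ : Fin N → ℂ) (K : Matrix (Fin 2) (Fin 2) ℂ) (k₂ ζ : ℂ)

/-- The interpolation polynomials with the value `v` at `ζ` and `Q_b^{(h)} w_b` at the nodes. -/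
def interp (v : Conf m → ℂ) (w : Fin N → Conf m → ℂ) (f : Conf m) : ℂ[X] :=
  lagBase η m ξ ζ * C (v f) +
    ∑ p : Σ b : Fin N, Fin (m b),
      lagNode η m ξ ζ p * C ((Qcoef η m ξ K k₂ p.1 (p.2 + 1)).mulVec (w p.1) f)

theorem eval_interp (v : Conf m → ℂ) (w : Fin N → Conf m → ℂ) (f : Conf m) (x : ℂ) :
    (interp η m ξ K k₂ ζ v w f).eval x = (lagBase η m ξ ζ).eval x * v f +
      ∑ p, (lagNode η m ξ ζ p).eval x * (Qcoef η m ξ K k₂ p.1 (p.2 + 1)).mulVec (w p.1) f := by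
  simp [interp, eval_finsetSum]

theorem natDegree_interp (v : Conf m → ℂ) (w : Fin N → Conf m → ℂ) (f : Conf m) :
    (interp η m ξ K k₂ ζ v w f).natDegree ≤ ∑ n, m n :=
  natDegree_add_le_of_degree_le
    ((natDegree_mul_C_le _ _).trans (natDegree_lagBase η m ξ ζ))
    (natDegree_sum_le_of_forall_le _ _ fun p _ =>
      (natDegree_mul_C_le _ _).trans (natDegree_lagNode η m ξ ζ p))

theorem Cmat_apply (a b : Fin N) : Cmat η m ξ K k₂ ζ a b =
    -(if a = b then Qcoef η m ξ K k₂ a 0 else 0) +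
      ∑ h : Fin (m b), (lagNode η m ξ ζ ⟨b, h⟩).eval (pt η m ξ a 0) •
        Qcoef η m ξ K k₂ b (h + 1) := by
  simp only [Cmat, Matrix.of_apply, eval_lagNode]

/-- The coefficients of `Δ_ζ(x)` without the factors depending on the row. -/
def deltaCoef (x : ℂ) (p : Σ b : Fin N, Fin (m b)) : ℂ :=
  (x - ζ) / (node η m ξ p - x) / ((node η m ξ p - ζ) *
    ∏ p' ∈ Finset.univ.erase p, (node η m ξ p - node η m ξ p'))

theorem Deltamat_apply (x : ℂ) (a b : Fin N) : Deltamat η m ξ K k₂ ζ x a b =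
    (∏ p, (pt η m ξ a 0 - node η m ξ p)) •
      ∑ h : Fin (m b), deltaCoef η m ξ ζ x ⟨b, h⟩ • Qcoef η m ξ K k₂ b (h + 1) := by
  simp only [Deltamat, Matrix.of_apply, Finset.smul_sum, smul_smul, deltaCoef]
  refine Finset.sum_congr rfl fun h _ => ?_
  congr 1
  ring

/-- The coefficients of Δ_ζ are Lagrange polynomials with the common product over the nodes taken
out and the sign reversed, which is why the determinant formula requires x to avoid the nodes. -/
theorem prod_mul_deltaCoef {x : ℂ} {p : Σ b : Fin N, Fin (m b)} (hx : x ≠ node η m ξ p) :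
    (∏ p', (x - node η m ξ p')) * deltaCoef η m ξ ζ x p = -(lagNode η m ξ ζ p).eval x := by
  rw [eval_lagNode, deltaCoef, ← Finset.mul_prod_erase _ _ (Finset.mem_univ p),
    Finset.prod_div_distrib]
  have h1 : x - node η m ξ p ≠ 0 := sub_ne_zero.mpr hx
  have h2 : (x - ζ) / (node η m ξ p - x) = -((x - ζ) / (x - node η m ξ p)) := by
    rw [← neg_sub x, div_neg]
  rw [h2, div_mul_eq_div_div]
  field_simp

variable {η m ξ K k₂ ζ} {k₁ : ℂ}

theorem Regular.node_injective (R : Regular η m ξ K k₁ k₂ ζ) :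
    Function.Injective (node η m ξ) := by
  rintro ⟨a, h⟩ ⟨b, h'⟩ e
  by_contra hne
  refine R.pt_ne ⟨a, h.succ⟩ ⟨b, h'.succ⟩ (fun e' => hne ?_) (by simpa [node] using e)
  obtain ⟨rfl, e2⟩ := Sigma.mk.inj_iff.mp e'
  rw [Fin.succ_injective _ (eq_of_heq e2)]

theorem Regular.dFun_node (R : Regular η m ξ K k₁ k₂ ζ) (p : Σ b : Fin N, Fin (m b)) :
    dFun η m ξ (node η m ξ p) ≠ 0 :=
  dFun_ne_zero R.pt_ne p.1 (Nat.succ_pos _) p.2.2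

theorem Regular.interp_node (R : Regular η m ξ K k₁ k₂ ζ) (v : Conf m → ℂ)
    (w : Fin N → Conf m → ℂ) (f : Conf m) (p : Σ b : Fin N, Fin (m b)) :
    (interp η m ξ K k₂ ζ v w f).eval (node η m ξ p) =
      (Qcoef η m ξ K k₂ p.1 (p.2 + 1)).mulVec (w p.1) f := by
  rw [eval_interp, eval_lagBase_node, zero_mul, zero_add, Finset.sum_eq_single p,
    eval_lagNode_node _ _ _ _ R.node_injective R.node_ne, if_pos rfl, one_mul]
  · intro q _ hq
    rw [eval_lagNode_node _ _ _ _ R.node_injective R.node_ne, if_neg hq, zero_mul]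
  · exact fun h => absurd (Finset.mem_univ p) h

theorem Regular.interp_zeta (R : Regular η m ξ K k₁ k₂ ζ) (v : Conf m → ℂ)
    (w : Fin N → Conf m → ℂ) (f : Conf m) : (interp η m ξ K k₂ ζ v w f).eval ζ = v f := by
  rw [eval_interp, eval_lagBase_self _ _ _ _ R.node_ne, one_mul,
    Finset.sum_eq_zero fun p _ => by rw [eval_lagNode_self, zero_mul], add_zero]

/-- This is where C_ζ comes from: together with the `lagBase` term it measures the failure of the
interpolant to take the value Q_a^{(0)} w_a at ξ_a^{(0)}. -/
theorem interp_eval_pt_zero (v : Conf m → ℂ) (w : Fin N → Conf m → ℂ) (a : Fin N) (f : Conf m) :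
    (interp η m ξ K k₂ ζ v w f).eval (pt η m ξ a 0) =
      (Qcoef η m ξ K k₂ a 0).mulVec (w a) f + (lagBase η m ξ ζ).eval (pt η m ξ a 0) * v f +
        (∑ b, (Cmat η m ξ K k₂ ζ a b).mulVec (w b)) f := by
  have h1 : ∑ b, (Cmat η m ξ K k₂ ζ a b).mulVec (w b) = -(Qcoef η m ξ K k₂ a 0).mulVec (w a) +
      ∑ p : Σ b : Fin N, Fin (m b), (lagNode η m ξ ζ p).eval (pt η m ξ a 0) •
        (Qcoef η m ξ K k₂ p.1 (p.2 + 1)).mulVec (w p.1) := by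
    rw [Fintype.sum_sigma]
    simp only [Cmat_apply, Matrix.add_mulVec, Finset.sum_add_distrib, Matrix.sum_mulVec,
      Matrix.smul_mulVec, Matrix.neg_mulVec, Finset.sum_neg_distrib]
    congr 2
    rw [Finset.sum_eq_single a]
    · rw [if_pos rfl]
    · intro b _ hb
      rw [if_neg hb.symm, Matrix.zero_mulVec]
    · exact fun h => absurd (Finset.mem_univ a) h
  rw [h1, eval_interp]
  simp only [Pi.add_apply, Pi.neg_apply, Finset.sum_apply, Pi.smul_apply, smul_eq_mul]
  ring

theorem Regular.interp_pt (R : Regular η m ξ K k₁ k₂ ζ) {v : Conf m → ℂ} {w : Fin N → Conf m → ℂ}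
    (h : ∀ a, ∑ b, (Cmat η m ξ K k₂ ζ a b).mulVec (w b) =
      -((lagBase η m ξ ζ).eval (pt η m ξ a 0) • v)) {a : Fin N} {i : ℕ} (hi : i ≤ m a)
    (f : Conf m) : (interp η m ξ K k₂ ζ v w f).eval (pt η m ξ a i) =
      (Qcoef η m ξ K k₂ a i).mulVec (w a) f := by
  cases i with
  | zero =>
    rw [interp_eval_pt_zero, h]
    simp only [Pi.neg_apply, Pi.smul_apply, smul_eq_mul]
    ring
  | succ i => exact R.interp_node v w f ⟨a, ⟨i, hi⟩⟩

theorem Regular.tqDefect_interp (R : Regular η m ξ K k₁ k₂ ζ) {v : Conf m → ℂ}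
    {w : Fin N → Conf m → ℂ} (h : ∀ a, ∑ b, (Cmat η m ξ K k₂ ζ a b).mulVec (w b) =
      -((lagBase η m ξ ζ).eval (pt η m ξ a 0) • v)) (x : ℂ) (f : Conf m) :
    tqDefect η m ξ K k₁ k₂ (interp η m ξ K k₂ ζ v w) x f = 0 :=
  tqDefect_eq_zero R.eta_ne_zero R.pos R.ne_zero R.trace_eq R.det_eq R.pt_ne
    (natDegree_interp η m ξ K k₂ ζ v w) w (fun _ _ hi f => R.interp_pt h hi f) x f

/-- A kernel vector interpolates to a solution vanishing at ζ, hence to zero; since Q_a^{(2s_a)} =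
1, its value at ξ_a^{(2s_a)} is w_a itself. -/
theorem Regular.eq_zero_of_Cmat (R : Regular η m ξ K k₁ k₂ ζ) {w : Fin N → Conf m → ℂ}
    (h : ∀ a, ∑ b, (Cmat η m ξ K k₂ ζ a b).mulVec (w b) = 0) : w = 0 := by
  have h' : ∀ a, ∑ b, (Cmat η m ξ K k₂ ζ a b).mulVec (w b) =
      -((lagBase η m ξ ζ).eval (pt η m ξ a 0) • (0 : Conf m → ℂ)) := fun a => by
    rw [h, smul_zero, neg_zero]
  have h0 := R.noSol_zeta (interp η m ξ K k₂ ζ 0 w) (natDegree_interp η m ξ K k₂ ζ 0 w)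
    (R.tqDefect_interp h') (R.interp_zeta 0 w)
  ext a f
  have h1 := R.interp_pt h' (le_refl (m a)) f
  rw [h0, Qcoef_self η m ξ R.eta_ne_zero, Matrix.one_mulVec] at h1
  simpa using h1.symm

/-- The matrix of polynomials with the value `1` at `ζ` and `Q_b^{(h)} W_b` at the nodes. -/
def interpOp (η : ℂ) (m : Fin N → ℕ) (ξ : Fin N → ℂ) (K : Matrix (Fin 2) (Fin 2) ℂ) (k₂ ζ : ℂ)
    (W : Fin N → Op m) : Matrix (Conf m) (Conf m) ℂ[X] :=
  Matrix.of fun f g => interp η m ξ K k₂ ζ (fun f' => (1 : Op m) f' g) (fun b f' => W b f' g) f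

theorem natDegree_interpOp (W : Fin N → Op m) (f g : Conf m) :
    (interpOp η m ξ K k₂ ζ W f g).natDegree ≤ ∑ n, m n := by
  rw [interpOp, Matrix.of_apply]
  exact natDegree_interp η m ξ K k₂ ζ _ _ f

theorem evalAt_interpOp (W : Fin N → Op m) (x : ℂ) : evalAt (interpOp η m ξ K k₂ ζ W) x =
    (lagBase η m ξ ζ).eval x • 1 +
      ∑ p, (lagNode η m ξ ζ p).eval x • (Qcoef η m ξ K k₂ p.1 (p.2 + 1) * W p.1) := by
  ext f g
  simp only [evalAt, Matrix.map_apply, interpOp, Matrix.of_apply, eval_interp, Matrix.add_apply,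
    Matrix.smul_apply, Matrix.sum_apply, smul_eq_mul]
  rfl

theorem interpOp_mulVec (W : Fin N → Op m) (x : ℂ) (v : Conf m → ℂ) (f : Conf m) :
    (evalAt (interpOp η m ξ K k₂ ζ W) x).mulVec v f =
      (interp η m ξ K k₂ ζ v (fun b => (W b).mulVec v) f).eval x := by
  rw [evalAt_interpOp, eval_interp]
  simp only [Matrix.add_mulVec, Matrix.sum_mulVec, Matrix.smul_mulVec, Matrix.one_mulVec,
    Pi.add_apply, Finset.sum_apply, Pi.smul_apply, smul_eq_mul, Matrix.mulVec_mulVec]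

variable {W : Fin N → Op m}

theorem sum_Cmat_mulVec (hW : ∀ a, ∑ b, Cmat η m ξ K k₂ ζ a b * W b =
    -((lagBase η m ξ ζ).eval (pt η m ξ a 0) • 1)) (v : Conf m → ℂ) (a : Fin N) :
    ∑ b, (Cmat η m ξ K k₂ ζ a b).mulVec ((W b).mulVec v) =
      -((lagBase η m ξ ζ).eval (pt η m ξ a 0) • v) := by
  simp only [Matrix.mulVec_mulVec]
  rw [← Matrix.sum_mulVec, hW, Matrix.neg_mulVec, Matrix.smul_mulVec, Matrix.one_mulVec]

/-- The TQ equation for operators. -/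
theorem Regular.transfer_mul_interpOp (R : Regular η m ξ K k₁ k₂ ζ)
    (hW : ∀ a, ∑ b, Cmat η m ξ K k₂ ζ a b * W b =
      -((lagBase η m ξ ζ).eval (pt η m ξ a 0) • 1)) (x : ℂ) :
    transfer η m ξ K x * evalAt (interpOp η m ξ K k₂ ζ W) x =
      (k₁ * aFun η m ξ x) • evalAt (interpOp η m ξ K k₂ ζ W) (x - η) +
        (k₂ * dFun η m ξ x) • evalAt (interpOp η m ξ K k₂ ζ W) (x + η) := by
  refine Matrix.ext_of_mulVec_single fun g => ?_
  rw [← Matrix.mulVec_mulVec]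
  ext f
  have h := R.tqDefect_interp (sum_Cmat_mulVec hW (Pi.single g 1)) x f
  rw [tqDefect, sub_eq_zero] at h
  simp only [← interpOp_mulVec] at h
  rw [Matrix.mulVec, dotProduct, h]
  simp only [Matrix.add_mulVec, Matrix.smul_mulVec, Pi.add_apply, Pi.smul_apply, smul_eq_mul]

/-- A vector v killed by Q(ξ_a^{(2s_a)}) makes Q(x) v a solution with a zero there, so it vanishes
identically; but its value at ζ is v. -/
theorem Regular.isUnit_interpOp (R : Regular η m ξ K k₁ k₂ ζ)
    (hW : ∀ a, ∑ b, Cmat η m ξ K k₂ ζ a b * W b =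
      -((lagBase η m ξ ζ).eval (pt η m ξ a 0) • 1)) (a : Fin N) :
    IsUnit (evalAt (interpOp η m ξ K k₂ ζ W) (pt η m ξ a (m a))) := by
  rw [← Matrix.mulVec_injective_iff_isUnit]
  refine (injective_iff_map_eq_zero (Matrix.mulVecLin
    (evalAt (interpOp η m ξ K k₂ ζ W) (pt η m ξ a (m a))))).mpr fun v hv => ?_
  have h0 := R.noSol_pt a _ (natDegree_interp η m ξ K k₂ ζ v fun b => (W b).mulVec v)
    (R.tqDefect_interp (sum_Cmat_mulVec hW v)) fun f => by
      rw [← interpOp_mulVec]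
      exact congrFun hv f
  ext f
  rw [← R.interp_zeta v (fun b => (W b).mulVec v) f, h0]
  simp

/-- In the TQ equation at x - η, multiplied by β(x), the term k₁ a(x) k₂ d(x - η) Q(x) is the
quantum determinant term. -/
theorem Regular.baxter (R : Regular η m ξ K k₁ k₂ ζ)
    (hW : ∀ a, ∑ b, Cmat η m ξ K k₂ ζ a b * W b =
      -((lagBase η m ξ ζ).eval (pt η m ξ a 0) • 1)) (x : ℂ) :
    alphaFun η m ξ k₁ x • evalAt (interpOp η m ξ K k₂ ζ W) (x - 2 * η)
      - betaFun η m ξ k₁ x •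
        (transfer η m ξ K (x - η) * evalAt (interpOp η m ξ K k₂ ζ W) (x - η))
      + qdet η m ξ K x * evalAt (interpOp η m ξ K k₂ ζ W) x = 0 := by
  rw [R.transfer_mul_interpOp hW, qdet_eq η m ξ R.eta_ne_zero, R.det_eq, smul_one_mul,
    sub_add_cancel, sub_sub, ← two_mul, smul_add, smul_smul, smul_smul, alphaFun, betaFun, betaFun]
  module

end Interpolation

/-! ### The determinant formula. -/

section Reconstruction

variable {N : ℕ} {η : ℂ} {m : Fin N → ℕ} {ξ : Fin N → ℂ} {K : Matrix (Fin 2) (Fin 2) ℂ}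
  {k₁ k₂ ζ : ℂ}

/-- The reconstruction of the operator family inside a commutative algebra which contains the
operators `Q_a^{(h)}`. -/
theorem Regular.reconstruct (R : Regular η m ξ K k₁ k₂ ζ) {S : Type*} [CommRing S] [Algebra ℂ S]
    [FiniteDimensional ℂ S] (φ : S →ₐ[ℂ] Op m) (hφ : Function.Injective φ)
    {qS : Fin N → ℕ → S}
    (hq : ∀ a h, φ (qS a h) = Qcoef η m ξ K k₂ a h) :
    IsUnit (opDet (Cmat η m ξ K k₂ ζ)) ∧
    ∃ W : Fin N → Op m,
      (∀ a, ∑ b, Cmat η m ξ K k₂ ζ a b * W b = -((lagBase η m ξ ζ).eval (pt η m ξ a 0) • 1)) ∧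
      (∀ x, ∃ s, φ s = evalAt (interpOp η m ξ K k₂ ζ W) x) ∧
      ∀ x : ℂ, (∀ p, x ≠ node η m ξ p) →
        evalAt (interpOp η m ξ K k₂ ζ W) x =
          (∏ p, (x - node η m ξ p) / (ζ - node η m ξ p)) •
            ((opDet (Cmat η m ξ K k₂ ζ))⁻¹ *
              opDet (Cmat η m ξ K k₂ ζ + Deltamat η m ξ K k₂ ζ x)) := by
  let CS : Matrix (Fin N) (Fin N) S := Matrix.of fun a b =>
    -(if a = b then qS a 0 else 0) +
      ∑ h : Fin (m b), (lagNode η m ξ ζ ⟨b, h⟩).eval (pt η m ξ a 0) • qS b (h + 1)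
  let u : Fin N → S := fun a => algebraMap ℂ S (∏ p, (pt η m ξ a 0 - node η m ξ p))
  let r : ℂ → Fin N → S := fun x b =>
    ∑ h : Fin (m b), deltaCoef η m ξ ζ x ⟨b, h⟩ • qS b (h + 1)
  have hCS : CS.map φ = Cmat η m ξ K k₂ ζ := by
    ext1 a b
    rw [Cmat_apply]
    simp only [CS, Matrix.map_apply, Matrix.of_apply, map_add, map_neg, map_sum, map_smul, hq]
    split_ifs <;> simp [hq]
  have hDS : ∀ x, (Matrix.of fun a b => u a * r x b).map φ = Deltamat η m ξ K k₂ ζ x := fun x => by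
    ext1 a b
    rw [Deltamat_apply]
    simp only [u, r, Matrix.map_apply, Matrix.of_apply, ← Algebra.smul_def, map_smul, map_sum, hq]
  have hdetC : opDet (Cmat η m ξ K k₂ ζ) = φ CS.det := by
    rw [← hCS]; exact opDet_map φ.toRingHom CS
  have hunit : IsUnit (φ CS.det) := by
    refine isUnit_map_det φ.toRingHom CS fun w hw => R.eq_zero_of_Cmat ?_
    rw [← hCS]
    exact hw
  have hCdet : IsUnit CS.det := isUnit_of_isUnit_map φ hφ hunit
  have hκ : ∏ p, (ζ - node η m ξ p) ≠ 0 :=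
    Finset.prod_ne_zero_iff.mpr fun p _ => sub_ne_zero.mpr (R.node_ne p).symm
  let κ : ℂ := ∏ p, (ζ - node η m ξ p)
  -- The value of `lagBase` at ξ_a^{(0)} is κ⁻¹ u_a, so κ⁻¹ q solves the interpolation system; the
  -- same u is the column factor of the rank-one matrix Δ_ζ.
  let q : Fin N → S := CS⁻¹.mulVec (-u)
  have hCq : CS.mulVec q = -u := by
    simp only [q]
    rw [Matrix.mulVec_mulVec, Matrix.mul_nonsing_inv _ hCdet, Matrix.one_mulVec]
  have hbase : ∀ x, (lagBase η m ξ ζ).eval x = κ⁻¹ * ∏ p, (x - node η m ξ p) := fun x => by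
    rw [eval_lagBase, Finset.prod_div_distrib, div_eq_inv_mul]
  let W : Fin N → Op m := fun a => κ⁻¹ • φ (q a)
  have hev : ∀ x, evalAt (interpOp η m ξ K k₂ ζ W) x = φ ((lagBase η m ξ ζ).eval x • 1 +
      ∑ p : Σ b : Fin N, Fin (m b),
        (lagNode η m ξ ζ p).eval x • (qS p.1 (p.2 + 1) * κ⁻¹ • q p.1)) := fun x => by
    rw [evalAt_interpOp]
    simp only [W, map_add, map_smul, map_sum, map_mul, map_one, hq]
  refine ⟨hdetC ▸ hunit, W, fun a => ?_, fun x => ⟨_, (hev x).symm⟩, fun x hx => ?_⟩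
  · have h1 := congrFun hCq a
    rw [Matrix.mulVec, dotProduct] at h1
    have h2 : ∑ b, Cmat η m ξ K k₂ ζ a b * W b = κ⁻¹ • φ (∑ b, CS a b * q b) := by
      rw [← hCS, map_sum, Finset.smul_sum]
      refine Finset.sum_congr rfl fun b _ => ?_
      rw [Matrix.map_apply, map_mul, mul_smul_comm]
    rw [h2, h1, hbase, mul_smul, Pi.neg_apply, map_neg, smul_neg]
    simp only [u]
    rw [AlgHom.commutes, Algebra.algebraMap_eq_smul_one]
  · have hdetCD : opDet (Cmat η m ξ K k₂ ζ + Deltamat η m ξ K k₂ ζ x) =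
        φ (CS.det * (1 - ∑ b, r x b * q b)) := by
      rw [← det_add_rank_one hCdet hCq, ← hCS, ← hDS, ← Matrix.map_add φ (map_add φ)]
      exact opDet_map φ.toRingHom _
    have hinv : (φ CS.det)⁻¹ * φ CS.det = 1 :=
      Matrix.nonsing_inv_mul _ ((Matrix.isUnit_iff_isUnit_det _).mp hunit)
    rw [hev, hdetC, hdetCD, map_mul, ← mul_assoc, hinv, one_mul, ← map_smul, ← eval_lagBase]
    congr 1
    -- Multiplying 1 - ∑ r_b q_b by `lagBase` turns the coefficients r_b into Lagrange polynomials,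
    -- which recovers the interpolation formula.
    rw [smul_sub, sub_eq_add_neg, Finset.smul_sum, ← Finset.sum_neg_distrib, Fintype.sum_sigma]
    congr 1
    refine Finset.sum_congr rfl fun b _ => ?_
    simp only [r]
    rw [Finset.sum_mul, Finset.smul_sum, ← Finset.sum_neg_distrib]
    refine Finset.sum_congr rfl fun h _ => ?_
    rw [← neg_eq_iff_eq_neg.mpr (prod_mul_deltaCoef η m ξ ζ (hx ⟨b, h⟩)), hbase, mul_smul_comm,
      smul_smul, smul_mul_assoc, smul_smul, ← neg_smul]
    congr 1
    ring

end Reconstruction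

/-! ### Regularity of generic parameters. -/

section Main

theorem exists_regular {N : ℕ} (m : Fin N → ℕ) (hm : ∀ n, 0 < m n) {η : ℂ} (hη : η ≠ 0)
    {ζ : (Fin N → ℂ) → ℂ}
    (hζ : (∃ z : ℂ, ∀ ξ, ζ ξ = z) ∨ (∃ c : Fin N, ∀ ξ, ζ ξ = pt η m ξ c 0)) :
    ∃ P : MvPolynomial (Fin N ⊕ Fin 2) ℂ, P ≠ 0 ∧
      ∀ (ξ : Fin N → ℂ) (k₁ k₂ : ℂ) (K : Matrix (Fin 2) (Fin 2) ℂ), k₁ ≠ k₂ → k₁ ≠ 0 → k₂ ≠ 0 →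
        K.trace = k₁ + k₂ → K.det = k₁ * k₂ →
        MvPolynomial.eval (Sum.elim ξ ![k₁, k₂]) P ≠ 0 → Regular η m ξ K k₁ k₂ (ζ ξ) := by
  rcases hζ with ⟨z, hz⟩ | ⟨c, hc⟩
  · obtain ⟨P, hP, h⟩ := (genericAt_pt_injective η m hη z).and
      ((GenericAt.all fun a => genericAt_noSol_pt η m hη z a).and
        ((genericAt_noSol_const η m hη z).and (genericAt_node_ne η m hη z)))
    refine ⟨P, fun h0 => hP (by rw [h0, map_zero]), ?_⟩
    intro ξ k₁ k₂ K hk hk₁ hk₂ htr hdet hev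
    obtain ⟨h1, h2, h3, h4⟩ := h _ hev
    rw [Sum.elim_comp_inl] at h1 h3 h4
    have hs := similarTwists_diagonal η m ξ hk K htr hdet
    exact
      { eta_ne_zero := hη
        pos := hm
        ne_zero := hk₂
        trace_eq := htr
        det_eq := hdet
        pt_ne := fun p q hpq => sub_ne_zero.mp (h1 p q hpq)
        node_ne := fun p => hz ξ ▸ sub_ne_zero.mp (h4 p)
        noSol_pt := fun a => NoSol.of_similar η m ξ (h2 a) hs
        noSol_zeta := hz ξ ▸ NoSol.of_similar η m ξ h3 hs }
  -- The base point 0 is arbitrary. For ζ = ξ_c^{(0)} the descent z - η, z - 2η, … would run through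
  -- the string of c itself, so `noSol_special` does not apply; `NoSol.pt_zero` deduces this case
  -- from ξ_c^{(2s_c)}.
  · obtain ⟨P, hP, h⟩ := (genericAt_pt_injective η m hη 0).and
      (GenericAt.all fun a => genericAt_noSol_pt η m hη 0 a)
    refine ⟨P, fun h0 => hP (by rw [h0, map_zero]), ?_⟩
    intro ξ k₁ k₂ K hk hk₁ hk₂ htr hdet hev
    obtain ⟨h1, h2⟩ := h _ hev
    rw [Sum.elim_comp_inl] at h1
    have hs := similarTwists_diagonal η m ξ hk K htr hdet
    have hpt : ∀ p q : Σ n : Fin N, Fin (m n + 1), p ≠ q →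
        pt η m ξ p.1 p.2 ≠ pt η m ξ q.1 q.2 := fun p q hpq => sub_ne_zero.mp (h1 p q hpq)
    have hns : ∀ a, NoSol η m ξ K k₁ k₂ (pt η m ξ a (m a)) := fun a =>
      NoSol.of_similar η m ξ (h2 a) hs
    exact
      { eta_ne_zero := hη
        pos := hm
        ne_zero := hk₂
        trace_eq := htr
        det_eq := hdet
        pt_ne := hpt
        node_ne := fun p => by
          rw [hc ξ]
          refine hpt ⟨p.1, p.2.succ⟩ ⟨c, 0⟩ fun e => ?_
          obtain ⟨rfl, e2⟩ := Sigma.mk.inj_iff.mp e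
          exact Fin.succ_ne_zero _ (eq_of_heq e2)
        noSol_pt := hns
        noSol_zeta := hc ξ ▸ NoSol.pt_zero hk₁ hpt (hns c) }

theorem exists_map_eq_Cmat {N : ℕ} {η : ℂ} {m : Fin N → ℕ} {ξ : Fin N → ℂ}
    {K : Matrix (Fin 2) (Fin 2) ℂ} {k₂ : ℂ} {S : Type*} [CommRing S] [Algebra ℂ S]
    (φ : S →ₐ[ℂ] Op m) {qS : Fin N → ℕ → S} (hq : ∀ a h, φ (qS a h) = Qcoef η m ξ K k₂ a h)
    (ζ : ℂ) (a b : Fin N) : ∃ s, φ s = Cmat η m ξ K k₂ ζ a b := by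
  rw [Cmat_apply]
  refine ⟨-(if a = b then qS a 0 else 0) + ∑ h : Fin (m b),
    (lagNode η m ξ ζ ⟨b, h⟩).eval (pt η m ξ a 0) • qS b (h + 1), ?_⟩
  simp only [map_add, map_neg, map_sum, map_smul, hq]
  split_ifs <;> simp [hq]

theorem exists_map_eq_Deltamat {N : ℕ} {η : ℂ} {m : Fin N → ℕ} {ξ : Fin N → ℂ}
    {K : Matrix (Fin 2) (Fin 2) ℂ} {k₂ : ℂ} {S : Type*} [CommRing S] [Algebra ℂ S]
    (φ : S →ₐ[ℂ] Op m) {qS : Fin N → ℕ → S} (hq : ∀ a h, φ (qS a h) = Qcoef η m ξ K k₂ a h)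
    (ζ x : ℂ) (a b : Fin N) : ∃ s, φ s = Deltamat η m ξ K k₂ ζ x a b := by
  rw [Deltamat_apply]
  refine ⟨(∏ p, (pt η m ξ a 0 - node η m ξ p)) • ∑ h : Fin (m b),
    deltaCoef η m ξ ζ x ⟨b, h⟩ • qS b (h + 1), ?_⟩
  simp only [map_sum, map_smul, hq]

end Main

end HigherSpinChain

end

theorem corollary5p2 {N : ℕ} (m : Fin N → ℕ) (hm : ∀ n, 0 < m n) (η : ℂ) (hη : η ≠ 0)
    (ζ : (Fin N → ℂ) → ℂ)
    (hζ : (∃ z : ℂ, ∀ ξ, ζ ξ = z) ∨ (∃ c : Fin N, ∀ ξ, ζ ξ = pt η m ξ c 0)) :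
    ∃ P : MvPolynomial (Fin N ⊕ Fin 2) ℂ, P ≠ 0 ∧
      ∀ (ξ : Fin N → ℂ) (k₁ k₂ : ℂ) (K : Matrix (Fin 2) (Fin 2) ℂ),
        k₁ ≠ k₂ → k₁ ≠ 0 → k₂ ≠ 0 →
        Module.End.HasEigenvalue (Matrix.toLin' K) k₁ →
        Module.End.HasEigenvalue (Matrix.toLin' K) k₂ →
        MvPolynomial.eval (Sum.elim ξ ![k₁, k₂]) P ≠ 0 →
        -- all the denominators are nonzero
        (∀ p, node η m ξ p ≠ ζ ξ) ∧
        Function.Injective (node η m ξ) ∧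
        (∀ p, dFun η m ξ (node η m ξ p) ≠ 0) ∧
        -- the entries of the matrices commute, so that their determinants make sense
        (∀ a b c d, Commute (Cmat η m ξ K k₂ (ζ ξ) a b) (Cmat η m ξ K k₂ (ζ ξ) c d)) ∧
        (∀ x a b c d,
          Commute (Cmat η m ξ K k₂ (ζ ξ) a b) (Deltamat η m ξ K k₂ (ζ ξ) x c d)) ∧
        (∀ x y a b c d,
          Commute (Deltamat η m ξ K k₂ (ζ ξ) x a b) (Deltamat η m ξ K k₂ (ζ ξ) y c d)) ∧
        IsUnit (opDet (Cmat η m ξ K k₂ (ζ ξ))) ∧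
        -- the operator family is polynomial, with the determinant formula
        ∃ Q : Matrix (Conf m) (Conf m) ℂ[X],
          (∀ i j, (Q i j).natDegree ≤ ∑ n, m n) ∧
          (∀ x : ℂ, (∀ p, x ≠ node η m ξ p) →
            evalAt Q x =
              (∏ p, (x - node η m ξ p) / (ζ ξ - node η m ξ p)) •
                ((opDet (Cmat η m ξ K k₂ (ζ ξ)))⁻¹ *
                  opDet (Cmat η m ξ K k₂ (ζ ξ) + Deltamat η m ξ K k₂ (ζ ξ) x))) ∧
          (∀ x y, Commute (evalAt Q x) (evalAt Q y)) ∧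
          (∀ x y, Commute (evalAt Q x) (transfer η m ξ K y)) ∧
          (∀ x : ℂ,
            alphaFun η m ξ k₁ x • evalAt Q (x - 2 * η)
              - betaFun η m ξ k₁ x • (transfer η m ξ K (x - η) * evalAt Q (x - η))
              + qdet η m ξ K x * evalAt Q x = 0) ∧
          (∀ a : Fin N, IsUnit (evalAt Q (pt η m ξ a (m a)))) := by
  obtain ⟨P, hP, hgen⟩ := exists_regular m hm hη hζ
  refine ⟨P, hP, fun ξ k₁ k₂ K hk hk₁ hk₂ he₁ he₂ hev => ?_⟩
  obtain ⟨htr, hdet⟩ := trace_det_of_eigenvalues hk he₁ he₂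
  have R := hgen ξ k₁ k₂ K hk hk₁ hk₂ htr hdet hev
  obtain ⟨S, _, _, φ, hφ, _, hT, hq⟩ := exists_commutative_model η m ξ hη K k₂
  choose qS hqS using hq
  have hcomm : ∀ {X Y : Op m}, (∃ s, φ s = X) → (∃ s, φ s = Y) → Commute X Y := by
    rintro _ _ ⟨s, rfl⟩ ⟨t, rfl⟩
    exact (Commute.all s t).map φ
  have hC := exists_map_eq_Cmat φ hqS (ζ ξ)
  have hD := exists_map_eq_Deltamat φ hqS (ζ ξ)
  obtain ⟨hunit, W, hW, hQS, hQ⟩ := R.reconstruct φ hφ hqS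
  exact ⟨R.node_ne, R.node_injective, R.dFun_node, fun a b c d => hcomm (hC a b) (hC c d),
    fun x a b c d => hcomm (hC a b) (hD x c d), fun x y a b c d => hcomm (hD x a b) (hD y c d),
    hunit, interpOp η m ξ K k₂ (ζ ξ) W, natDegree_interpOp W, hQ,
    fun x y => hcomm (hQS x) (hQS y), fun x y => hcomm (hQS x) (hT y), R.baxter hW,
    R.isUnit_interpOp hW⟩
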